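/- Let $l\ge 1$, $m,n\ge 0$, $\varkappa=m+n$, let $\bm s=(s_1,\dots,s_\varkappa)\in\{\pm1\}^\varkappa$ contain exactly $m$ entries $1$, and let $\bm\varepsilon=(\varepsilon_1,\dots,\varepsilon_\varkappa)\in\{\pm1\}^\varkappa$. Write $s_i=(-1)^{|i|}$ with $|i|\in\mathbb Z/2$. Let $V=\mathbb C^{m|n}$ be the superspace with basis $v_i$ of parity $|i|$, let $E_{ij}$ be the matrix units of $\mathrm{End}(V)$, let $E_{ij}^{(k)}\in\mathrm{End}(V^{\otimes l})=\mathrm{End}(V)^{\otimes l}$ (graded tensor product) be $E_{ij}$ in the $k$-th factor, and put $G^{\bm\varepsilon}=\mathrm{diag}(\varepsilon_1,\dots,\varepsilon_\varkappa)$, $\varpi_1=\sum_a s_a\varepsilon_a$, $\jmath=\tfrac12\sum_a s_a$. **Twisted super Yangians.** The extended twisted super Yangian $\widetilde{\mathscr B}_{\bm s,\bm\varepsilon}$ is the superalgebra over $\mathbb C$ with generators $b_{ij}^{(r)}$ ($1\le i,j\le\varkappa$, $r\ge1$) of parity $|i|+|j|$ and, with $b_{ij}(u)=\delta_{ij}\varepsilon_i+\sum_{r\ge1}b_{ij}^{(r)}u^{-r}$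 and $\theta=(-1)^{|i||j|+|i||k|+|j||k|}$, the relations (for supercommutators, both sides being multiplied by $u^2-v^2$) $$\begin{aligned}[][b_{ij}(u),b_{kp}(v)]={}&\tfrac{\theta}{u-v}\big(b_{kj}(u)b_{ip}(v)-b_{kj}(v)b_{ip}(u)\big)\\&+\tfrac{\theta}{u+v}\Big(\delta_{kj}\sum_a b_{ia}(u)b_{ap}(v)-\delta_{ip}\sum_a b_{ka}(v)b_{aj}(u)\Big)\\&-\tfrac{\delta_{ij}}{u^2-v^2}\Big(\sum_a b_{ka}(u)b_{ap}(v)-\sum_a b_{ka}(v)b_{ap}(u)\Big).\end{aligned}$$ The twisted super Yangian $\mathscr B_{\bm s,\bm\varepsilon}$ is defined in the same way with the additional unitary relations $\sum_a b_{ia}(u)b_{aj}(-u)=\delta_{ij}$. In both cases $B(u)=\sum_{i,j}(-1)^{|i||j|+|j|}b_{ij}(u)\otimes E_{ij}$. A module over a superalgebra is a superspace with a (parity preserving) superalgebra homomorphism to its endomorphisms; morphisms are the even linear maps commuting with the action. **Hecke algebra.** Let $\mathscr W_l=\mathbb Z_2\wr\mathfrak S_l$, let $\sigma_i$ interchange the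 coordinates $i,i+1$ and let $\varsigma_i$ change the sign of coordinate $i$. For $\vartheta_1,\vartheta_2\in\mathbb C$ let $\mathscr H=\mathscr H^l_{\vartheta_1,\vartheta_2}$ be the algebra generated by $\mathbb C[\mathscr W_l]$ and $y_1,\dots,y_l$ with relations $y_iy_j=y_jy_i$; $\sigma_iy_i-y_{i+1}\sigma_i=\vartheta_1$; $\sigma_iy_j=y_j\sigma_i$ for $j\ne i,i+1$; $\varsigma_ly_i=y_i\varsigma_l$ for $i<l$; $\varsigma_ly_l+y_l\varsigma_l=\vartheta_2$. **The quotient.** On $V^{\otimes l}$ let $\sigma_i$ act by the super flip $\sum_{a,b}s_bE_{ab}^{(i)}E_{ba}^{(i+1)}$ and $\varsigma_k$ by $G^{\bm\varepsilon}$ on the $k$-th factor. Let $\varepsilon\in\{\pm1\}$. For an $\mathscr H$-module $M$ (purely even), let $\mathscr W_l$ act diagonally on $M\otimes V^{\otimes l}$ and put $$\mathcal D^\varepsilon_{\bm s,\bm\varepsilon}(M)=(M\otimes V^{\otimes l})\Big/\Big(\sum_{i=1}^{l-1}\mathrm{Im}(\sigma_i-\varepsilon)+\mathrm{Im}(\varsigma_l-\varepsilon)\Big).$$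 **The matrix.** For $\gamma,\chi\in\mathbb C$ put $\mathcal Q^{(k)}=\sum_{i,j}(-1)^{|i||j|+|i|+|j|}E_{ij}^{(k)}\otimes E_{ij}$ and, as series in $u^{-1}$ over $\mathscr H\otimes\mathrm{End}(V^{\otimes l})\otimes\mathrm{End}(V)$, $$\mathcal T_k^\chi(u)=1+\tfrac1{u-\jmath-\chi y_k}\otimes\mathcal Q^{(k)},\qquad \mathcal S_k^\chi(u)=1-\tfrac1{u+\jmath-\chi y_k}\otimes\mathcal Q^{(k)},$$ $$\mathcal B^\chi(u)=\mathcal T_1^\chi(u)\cdots\mathcal T_l^\chi(u)\,\big(G^{\bm\varepsilon}+\gamma u^{-1}\big)\,\mathcal S_l^\chi(-u)\cdots\mathcal S_1^\chi(-u).$$ **Proposition.** Assume $\vartheta_2=\vartheta_1(2\gamma+\varpi_1)$ and $\vartheta_1\chi=\varepsilon$. Then for every $\mathscr H$-module $M$: 1. the parity of $V^{\otimes l}$ makes $\mathcal D^\varepsilon_{\bm s,\bm\varepsilon}(M)$ a superspace, and $B(u)\mapsto\mathcal B^\chi(u)$ defines a unique $\widetilde{\mathscr B}_{\bm s,\bm\varepsilon}$-module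 structure on it (in particular, the coefficients of $\mathcal B^\chi(u)$ descend to the quotient); 2. $B(u)\mapsto(1-\gamma u^{-1})^{-1}\mathcal B^\chi(u)$ defines a unique $\mathscr B_{\bm s,\bm\varepsilon}$-module structure on $\mathcal D^\varepsilon_{\bm s,\bm\varepsilon}(M)$; for $\gamma=0$ this is $B(u)\mapsto\mathcal B^\chi(u)$. With the structure in 2, $M\mapsto\mathcal D^\varepsilon_{\bm s,\bm\varepsilon}(M)$, $f\mapsto$ (the map induced by $f\otimes1$), is a functor from the category of $\mathscr H$-modules to the category of $\mathscr B_{\bm s,\bm\varepsilon}$-modules. -/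

import Mathlib

open scoped TensorProduct ModuleCat

universe u v

noncomputable section

namespace DrinfeldBC

/-! ## Signs and parities

A parity sequence is a function `s : Fin N → ℤˣ`, where `N = m + n` and `m`, `n` are the numbers of
indices with `s i = 1`, `s i = -1`. -/

/-- The complex number `±1` given by a sign. -/
abbrev signC (x : ℤˣ) : ℂ := ((x : ℤ) : ℂ)

/-- The parity `|i|`, determined by `s i = (-1)^|i|`. -/
def par {N : ℕ} (s : Fin N → ℤˣ) (i : Fin N) : ZMod 2 := if s i = 1 then 0 else 1

/-- The sign `(-1)^p` of a parity `p`. -/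
def sgn (p : ZMod 2) : ℂ := (-1) ^ p.val

/-- The number `ϖ₁ = ∑ₐ sₐ εₐ`. -/
def varpiOne {N : ℕ} (s ε : Fin N → ℤˣ) : ℂ := ∑ a, signC (s a) * signC (ε a)

/-- The number `ȷ = (m - n) / 2 = (∑ₐ sₐ) / 2`. -/
def halfSdim {N : ℕ} (s : Fin N → ℤˣ) : ℂ := (∑ a, signC (s a)) / 2

/-! ## The twisted super Yangian of type AIII

A matrix of series `b i j (u) = ∑ r, b i j r * u⁻ʳ` over an algebra `A` is a function
`b : Fin N → Fin N → ℕ → A`. A series in `u⁻¹` and `v⁻¹` is the function `ℕ → ℕ → A` which sends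
`p`, `q` to the coefficient of `u⁻ᵖ v⁻ᵠ`. -/

section Relations

variable {A : Type u} [Ring A] [Algebra ℂ A] {N : ℕ}

/-- Multiplication of a series in `u⁻¹`, `v⁻¹` by `u⁻ᵃ v⁻ᶜ`. -/
def shift (a c : ℕ) (F : ℕ → ℕ → A) (p q : ℕ) : A :=
  if a ≤ p ∧ c ≤ q then F (p - a) (q - c) else 0

/-- The supercommutator `[b i j (u), b k l (v)]`. -/
def superComm (s : Fin N → ℤˣ) (b : Fin N → Fin N → ℕ → A) (i j k l : Fin N) (p q : ℕ) : A :=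
  b i j p * b k l q
    - sgn ((par s i + par s j) * (par s k + par s l)) • (b k l q * b i j p)

/-- The series `b k j (u) b i l (v) - b k j (v) b i l (u)`. -/
def exchangeTerm (b : Fin N → Fin N → ℕ → A) (i j k l : Fin N) (p q : ℕ) : A :=
  b k j p * b i l q - b k j q * b i l p

/-- The series `δ_{kj} ∑ₐ b i a (u) b a l (v) - δ_{il} ∑ₐ b k a (v) b a j (u)`. -/
def contractTerm (b : Fin N → Fin N → ℕ → A) (i j k l : Fin N) (p q : ℕ) : A :=
  (if k = j then ∑ a, b i a p * b a l q else 0) - (if i = l then ∑ a, b k a q * b a j p else 0)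

/-- The series `δ_{ij} (∑ₐ b k a (u) b a l (v) - ∑ₐ b k a (v) b a l (u))`. -/
def diagTerm (b : Fin N → Fin N → ℕ → A) (i j k l : Fin N) (p q : ℕ) : A :=
  if i = j then ∑ a, b k a p * b a l q - ∑ a, b k a q * b a l p else 0

/-- The coefficient of `u⁻ᵖ v⁻ᵠ` in the left-hand side, multiplied by
`u⁻² v⁻² (u² - v²) = v⁻² - u⁻²`, of the relation
`[b i j (u), b k l (v)]`
`  = θ / (u - v) * (b k j (u) b i l (v) - b k j (v) b i l (u))`
`  + θ / (u + v) * (δ_{kj} ∑ₐ b i a (u) b a l (v) - δ_{il} ∑ₐ b k a (v) b a j (u))`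
`  - 1 / (u² - v²) * δ_{ij} (∑ₐ b k a (u) b a l (v) - ∑ₐ b k a (v) b a l (u))`,
where `θ = (-1)^(|i||j| + |i||k| + |j||k|)`. -/
def reflLHS (s : Fin N → ℤˣ) (b : Fin N → Fin N → ℕ → A) (i j k l : Fin N) (p q : ℕ) : A :=
  shift 0 2 (superComm s b i j k l) p q - shift 2 0 (superComm s b i j k l) p q

/-- The coefficient of `u⁻ᵖ v⁻ᵠ` in the right-hand side of the same relation, multiplied by
`u⁻² v⁻² (u² - v²)`. -/
def reflRHS (s : Fin N → ℤˣ) (b : Fin N → Fin N → ℕ → A) (i j k l : Fin N) (p q : ℕ) : A :=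
  sgn (par s i * par s j + par s i * par s k + par s j * par s k) •
      (shift 1 2 (exchangeTerm b i j k l) p q + shift 2 1 (exchangeTerm b i j k l) p q)
    + sgn (par s i * par s j + par s i * par s k + par s j * par s k) •
      (shift 1 2 (contractTerm b i j k l) p q - shift 2 1 (contractTerm b i j k l) p q)
    - shift 2 2 (diagTerm b i j k l) p q

/-- The coefficient of `u⁻ʳ` in `∑ₐ b i a (u) b a j (-u)`. -/
def unitCoeff (b : Fin N → Fin N → ℕ → A) (i j : Fin N) (r : ℕ) : A :=
  ∑ a, ∑ pq ∈ Finset.HasAntidiagonal.antidiagonal r, (-1) ^ pq.2 * (b i a pq.1 * b a j pq.2)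

end Relations

/-- Index set of the generators: `(i, j, r)` stands for the generator `b i j` of index `r + 1`. -/
abbrev YGen (N : ℕ) : Type := Fin N × Fin N × ℕ

/-- The series `b i j (u) = δ_{ij} ε_i + ∑_{r ≥ 1} b i j r u⁻ʳ` over the free algebra. -/
def genSeries {N : ℕ} (ε : Fin N → ℤˣ) (i j : Fin N) : ℕ → FreeAlgebra ℂ (YGen N)
  | 0 => algebraMap ℂ _ (if i = j then signC (ε i) else 0)
  | r + 1 => FreeAlgebra.ι ℂ (i, j, r)

/-- The defining relations of the extended twisted super Yangian. -/
inductive ExtRel {N : ℕ} (s ε : Fin N → ℤˣ) :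
    FreeAlgebra ℂ (YGen N) → FreeAlgebra ℂ (YGen N) → Prop
  | reflection (i j k l : Fin N) (p q : ℕ) :
      ExtRel s ε (reflLHS s (genSeries ε) i j k l p q) (reflRHS s (genSeries ε) i j k l p q)

/-- The defining relations of the twisted super Yangian: those of the extended one, and the
unitary condition `∑ₐ b i a (u) b a j (-u) = δ_{ij}`. -/
inductive TwRel {N : ℕ} (s ε : Fin N → ℤˣ) :
    FreeAlgebra ℂ (YGen N) → FreeAlgebra ℂ (YGen N) → Prop
  | reflection (i j k l : Fin N) (p q : ℕ) :
      TwRel s ε (reflLHS s (genSeries ε) i j k l p q) (reflRHS s (genSeries ε) i j k l p q)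
  | unitary (i j : Fin N) (r : ℕ) :
      TwRel s ε (unitCoeff (genSeries ε) i j r) (if r = 0 ∧ i = j then 1 else 0)

/-- The extended twisted super Yangian of type AIII. -/
abbrev ExtTwistedYangian {N : ℕ} (s ε : Fin N → ℤˣ) : Type := RingQuot (ExtRel s ε)

/-- The twisted super Yangian of type AIII. -/
abbrev TwistedYangian {N : ℕ} (s ε : Fin N → ℤˣ) : Type := RingQuot (TwRel s ε)

/-- The coefficient of `u⁻ʳ` in `b i j (u)`, in the extended twisted super Yangian. -/
def ExtTwistedYangian.b {N : ℕ} (s ε : Fin N → ℤˣ) (i j : Fin N) (r : ℕ) :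
    ExtTwistedYangian s ε :=
  RingQuot.mkAlgHom ℂ (ExtRel s ε) (genSeries ε i j r)

/-- The coefficient of `u⁻ʳ` in `b i j (u)`, in the twisted super Yangian. -/
def TwistedYangian.b {N : ℕ} (s ε : Fin N → ℤˣ) (i j : Fin N) (r : ℕ) : TwistedYangian s ε :=
  RingQuot.mkAlgHom ℂ (TwRel s ε) (genSeries ε i j r)

/-- The parity of a word in the generators; the generator `b i j r` has parity `|i| + |j|`. -/
def wordPar {N : ℕ} (s : Fin N → ℤˣ) (w : List (YGen N)) : ZMod 2 :=
  (w.map fun g => par s g.1 + par s g.2.1).sum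

/-- The homogeneous component of parity `p` of the extended twisted super Yangian. -/
def ExtTwistedYangian.grade {N : ℕ} (s ε : Fin N → ℤˣ) (p : ZMod 2) :
    Submodule ℂ (ExtTwistedYangian s ε) :=
  Submodule.span ℂ {x | ∃ w : List (YGen N), wordPar s w = p ∧
    x = (w.map fun g => ExtTwistedYangian.b s ε g.1 g.2.1 (g.2.2 + 1)).prod}

/-- The homogeneous component of parity `p` of the twisted super Yangian. -/
def TwistedYangian.grade {N : ℕ} (s ε : Fin N → ℤˣ) (p : ZMod 2) :
    Submodule ℂ (TwistedYangian s ε) :=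
  Submodule.span ℂ {x | ∃ w : List (YGen N), wordPar s w = p ∧
    x = (w.map fun g => TwistedYangian.b s ε g.1 g.2.1 (g.2.2 + 1)).prod}

/-! ## Modules over a superalgebra -/

/-- `ρ : A → End(W)` is compatible with the gradings of the superalgebra `A` and of `W`. -/
def IsEvenRep {A : Type u} [Ring A] [Algebra ℂ A] (𝒜 : ZMod 2 → Submodule ℂ A)
    {W : Type v} [AddCommGroup W] [Module ℂ W] (𝒲 : ZMod 2 → Submodule ℂ W)
    (ρ : A →ₐ[ℂ] Module.End ℂ W) : Prop :=
  ∀ p q, ∀ a ∈ 𝒜 p, ∀ x ∈ 𝒲 q, ρ a x ∈ 𝒲 (p + q)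

/-- A module over the superalgebra `A`: a vector superspace with a homomorphism of superalgebras
from `A` to its endomorphisms. -/
structure SuperRep (A : Type u) [Ring A] [Algebra ℂ A] (𝒜 : ZMod 2 → Submodule ℂ A) :
    Type (max u (v + 1)) where
  carrier : Type v
  [addCommGroup : AddCommGroup carrier]
  [module : Module ℂ carrier]
  grade : ZMod 2 → Submodule ℂ carrier
  isInternal : DirectSum.IsInternal grade
  ρ : A →ₐ[ℂ] Module.End ℂ carrier
  isEven : IsEvenRep 𝒜 grade ρ

attribute [instance] SuperRep.addCommGroup SuperRep.module

namespace SuperRep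

variable {A : Type u} [Ring A] [Algebra ℂ A] {𝒜 : ZMod 2 → Submodule ℂ A}

/-- Even homomorphisms of modules. -/
@[ext]
structure Hom (X Y : SuperRep.{u, v} A 𝒜) : Type v where
  toLin : X.carrier →ₗ[ℂ] Y.carrier
  comm : ∀ a x, toLin (X.ρ a x) = Y.ρ a (toLin x)
  map_grade : ∀ p, ∀ x ∈ X.grade p, toLin x ∈ Y.grade p

instance : CategoryTheory.Category (SuperRep.{u, v} A 𝒜) where
  Hom := Hom
  id X := ⟨LinearMap.id, fun _ _ => rfl, fun _ _ h => h⟩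
  comp f g := ⟨g.toLin ∘ₗ f.toLin, fun a x => by simp [f.comm, g.comm],
    fun p x h => g.map_grade p _ (f.map_grade p x h)⟩

/-- The linear map underlying a morphism. -/
def linOf {X Y : SuperRep.{u, v} A 𝒜} (f : X ⟶ Y) : X.carrier →ₗ[ℂ] Y.carrier := Hom.toLin f

end SuperRep

/-! ## The degenerate affine Hecke algebra of type BC -/

/-- The symmetric group acts on sign vectors by permuting the coordinates. -/
def permAct (l : ℕ) : Equiv.Perm (Fin l) →* MulAut (Fin l → ℤˣ) where
  toFun π :=
    { toFun := fun x => x ∘ π.symm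
      invFun := fun x => x ∘ π
      left_inv := fun x => by ext i; simp
      right_inv := fun x => by ext i; simp
      map_mul' := fun _ _ => rfl }
  map_one' := rfl
  map_mul' _ _ := rfl

/-- The Weyl group of type `BC_l`, the wreath product of `ℤ/2` with the symmetric group. -/
abbrev Weyl (l : ℕ) : Type := (Fin l → ℤˣ) ⋊[permAct l] Equiv.Perm (Fin l)

/-- The reflection `σ_{ij}`, which interchanges the coordinates `i` and `j`. -/
def Weyl.σ {l : ℕ} (i j : Fin l) : Weyl l := SemidirectProduct.inr (Equiv.swap i j)

/-- The reflection `ς_i`, which changes the sign of the coordinate `i`. -/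
def Weyl.ς {l : ℕ} (i : Fin l) : Weyl l := SemidirectProduct.inl (Pi.mulSingle i (-1))

/-- The free algebra on the elements of the Weyl group and on `y_1, …, y_l`. -/
abbrev HeckeFree (l : ℕ) : Type := FreeAlgebra ℂ (Weyl l ⊕ Fin l)

/-- An element of the Weyl group, in the free algebra. -/
def HeckeFree.w {l : ℕ} (x : Weyl l) : HeckeFree l := FreeAlgebra.ι ℂ (Sum.inl x)

/-- The generator `y_i`, in the free algebra. -/
def HeckeFree.y {l : ℕ} (i : Fin l) : HeckeFree l := FreeAlgebra.ι ℂ (Sum.inr i)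

open HeckeFree in
/-- The defining relations of the degenerate affine Hecke algebra of type `BC_l`. The first two
are those of the group algebra. A pair `i`, `j` with `i + 1 = j` is a pair of adjacent indices,
and `k` with `k + 1 = l` is the last index. -/
inductive HeckeRel (l : ℕ) (θ₁ θ₂ : ℂ) : HeckeFree l → HeckeFree l → Prop
  | w_one : HeckeRel l θ₁ θ₂ (w 1) 1
  | w_mul (x x' : Weyl l) : HeckeRel l θ₁ θ₂ (w x * w x') (w (x * x'))
  | y_comm (i j : Fin l) : HeckeRel l θ₁ θ₂ (y i * y j) (y j * y i)
  | σ_y (i j : Fin l) (h : i.val + 1 = j.val) :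
      HeckeRel l θ₁ θ₂ (w (Weyl.σ i j) * y i - y j * w (Weyl.σ i j)) (algebraMap ℂ _ θ₁)
  | σ_y_far (i j k : Fin l) (h : i.val + 1 = j.val) (hi : k ≠ i) (hj : k ≠ j) :
      HeckeRel l θ₁ θ₂ (w (Weyl.σ i j) * y k) (y k * w (Weyl.σ i j))
  | ς_y_far (k i : Fin l) (h : k.val + 1 = l) (hi : i ≠ k) :
      HeckeRel l θ₁ θ₂ (w (Weyl.ς k) * y i) (y i * w (Weyl.ς k))
  | ς_y (k : Fin l) (h : k.val + 1 = l) :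
      HeckeRel l θ₁ θ₂ (w (Weyl.ς k) * y k + y k * w (Weyl.ς k)) (algebraMap ℂ _ θ₂)

/-- The degenerate affine Hecke algebra of type `BC_l`. -/
abbrev Hecke (l : ℕ) (θ₁ θ₂ : ℂ) : Type := RingQuot (HeckeRel l θ₁ θ₂)

/-- An element of the Weyl group, in the Hecke algebra. -/
def Hecke.w {l : ℕ} {θ₁ θ₂ : ℂ} (x : Weyl l) : Hecke l θ₁ θ₂ :=
  RingQuot.mkAlgHom ℂ (HeckeRel l θ₁ θ₂) (HeckeFree.w x)

/-- The element `y_i` of the Hecke algebra. -/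
def Hecke.y {l : ℕ} {θ₁ θ₂ : ℂ} (i : Fin l) : Hecke l θ₁ θ₂ :=
  RingQuot.mkAlgHom ℂ (HeckeRel l θ₁ θ₂) (HeckeFree.y i)

/-! ## Operators on the tensor power of the vector representation -/

/-- The space `V^{⊗l}`, where `V = ℂ^{m|n}` has basis `v_i = Pi.single i 1`, of parity `|i|`. -/
abbrev TensorV (N l : ℕ) : Type := ⨂[ℂ] _ : Fin l, (Fin N → ℂ)

/-- The basis vector `v_{a_1} ⊗ ⋯ ⊗ v_{a_l}` of `V^{⊗l}`. -/
def basisVec {N l : ℕ} (a : Fin l → Fin N) : TensorV N l :=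
  PiTensorProduct.tprod ℂ fun k => (Pi.single (a k) 1 : Fin N → ℂ)

/-- The operator `E_{ij}` on `V`. -/
def matUnit {N : ℕ} (i j : Fin N) : Module.End ℂ (Fin N → ℂ) :=
  Matrix.toLin' (Matrix.single i j 1)

/-- The operator on `V` which multiplies a vector of parity `q` by `(-1)^{pq}`. -/
def parityOp {N : ℕ} (s : Fin N → ℤˣ) (p : ZMod 2) : Module.End ℂ (Fin N → ℂ) :=
  Matrix.toLin' (Matrix.diagonal fun a => sgn (p * par s a))

/-- The operator `E_{ij}^{(k)} = 1^{⊗(k-1)} ⊗ E_{ij} ⊗ 1^{⊗(l-k)}` on `V^{⊗l}`. By the sign rule,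
`E_{ij}`, which has parity `|i| + |j|`, yields a sign when it passes the factors before the
`k`-th one. -/
def matUnitAt {N l : ℕ} (s : Fin N → ℤˣ) (i j : Fin N) (k : Fin l) :
    Module.End ℂ (TensorV N l) :=
  PiTensorProduct.map fun q =>
    if q < k then parityOp s (par s i + par s j) else if q = k then matUnit i j else LinearMap.id

/-- The super flip `𝒫^{(k,r)} = ∑_{a,b} s_b E_{ab}^{(k)} E_{ba}^{(r)}` on `V^{⊗l}`, for `k < r`,
which is the action of `σ_{kr}`. -/
def superFlip {N l : ℕ} (s : Fin N → ℤˣ) (k r : Fin l) : Module.End ℂ (TensorV N l) :=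
  ∑ a, ∑ b, signC (s b) • (matUnitAt s a b k * matUnitAt s b a r)

/-- Multiplication by `G^ε = diag(ε_1, …, ε_N)` on the `k`-th factor of `V^{⊗l}`, which is the
action of `ς_k`. -/
def diagAt {N l : ℕ} (s ε : Fin N → ℤˣ) (k : Fin l) : Module.End ℂ (TensorV N l) :=
  ∑ a, signC (ε a) • matUnitAt s a a k

/-! ## The matrix `ℬ^χ(u)`

A series in `u⁻¹` is a power series in `X = u⁻¹`. An even element of `A[[u⁻¹]] ⊗ End(V)` (graded
tensor product) is written uniquely as `∑_{i,j} (-1)^{|i||j|+|j|} x_{ij}(u) ⊗ E_{ij}` with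
`x_{ij}` of parity `|i| + |j|`, and it is identified with the matrix `(x_{ij}(u))`. Due to the
sign, the product of such elements corresponds to the usual product of matrices. -/

/-- The algebra `H ⊗ End(V^{⊗l})`; the Hecke algebra `H` is purely even. -/
abbrev OpAlg (N l : ℕ) (θ₁ θ₂ : ℂ) : Type := Hecke l θ₁ θ₂ ⊗[ℂ] Module.End ℂ (TensorV N l)

/-- Matrices of series in `u⁻¹` over `H ⊗ End(V^{⊗l})`. -/
abbrev SeriesMat (N l : ℕ) (θ₁ θ₂ : ℂ) : Type :=
  Matrix (Fin N) (Fin N) (PowerSeries (OpAlg N l θ₁ θ₂))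

section Series

variable {N l : ℕ} {θ₁ θ₂ : ℂ}

/-- The series `1 / (u - a) = ∑_{r ≥ 0} aʳ u^{-r-1}`. -/
def invSub {A : Type u} [Ring A] (a : A) : PowerSeries A :=
  PowerSeries.X * PowerSeries.mk fun r => a ^ r

/-- The substitution of `-u` for `u`. -/
def negU {A : Type u} [Ring A] (f : PowerSeries A) : PowerSeries A :=
  PowerSeries.mk fun r => (-1) ^ r * PowerSeries.coeff r f

/-- The element `χ y_k + c` of `H ⊗ End(V^{⊗l})`. -/
def yShift (χ c : ℂ) (k : Fin l) : OpAlg N l θ₁ θ₂ :=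
  (χ • Hecke.y k + algebraMap ℂ _ c) ⊗ₜ[ℂ] 1

/-- The matrix of `𝒬^{(k)} = ∑_{i,j} (-1)^{|i||j|+|i|+|j|} E_{ij}^{(k)} ⊗ E_{ij}`: its entries are
`(-1)^{|i|} E_{ij}^{(k)} = s_i E_{ij}^{(k)}`. -/
def qMat (s : Fin N → ℤˣ) (k : Fin l) : SeriesMat N l θ₁ θ₂ :=
  Matrix.of fun i j => PowerSeries.C (1 ⊗ₜ[ℂ] (signC (s i) • matUnitAt s i j k))

/-- `𝒯_k^χ(u) = 1 + 1 / (u - ȷ - χ y_k) ⊗ 𝒬^{(k)}`. -/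
def tMat (s : Fin N → ℤˣ) (χ : ℂ) (k : Fin l) : SeriesMat N l θ₁ θ₂ :=
  1 + Matrix.of fun i j => invSub (yShift χ (halfSdim s) k) * qMat s k i j

/-- `𝒮_k^χ(u) = 1 - 1 / (u + ȷ - χ y_k) ⊗ 𝒬^{(k)}`. -/
def sMat (s : Fin N → ℤˣ) (χ : ℂ) (k : Fin l) : SeriesMat N l θ₁ θ₂ :=
  1 - Matrix.of fun i j => invSub (yShift χ (-halfSdim s) k) * qMat s k i j

/-- `G^{ε,γ}(u) = G^ε + γ u⁻¹`. -/
def gMat (ε : Fin N → ℤˣ) (γ : ℂ) : SeriesMat N l θ₁ θ₂ :=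
  Matrix.diagonal fun i =>
    PowerSeries.C (algebraMap ℂ _ (signC (ε i))) +
      PowerSeries.C (algebraMap ℂ _ γ) * PowerSeries.X

/-- `ℬ^χ(u) = 𝒯_1^χ(u) ⋯ 𝒯_l^χ(u) G^{ε,γ}(u) 𝒮_l^χ(-u) ⋯ 𝒮_1^χ(-u)`. -/
def bMat (l : ℕ) (θ₁ θ₂ : ℂ) (s ε : Fin N → ℤˣ) (γ χ : ℂ) : SeriesMat N l θ₁ θ₂ :=
  (List.ofFn fun k : Fin l => tMat s χ k).prod * gMat ε γ *
    (List.ofFn fun k : Fin l => (sMat s χ k).map negU).reverse.prod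

/-- The normalized matrix `(1 - γ u⁻¹)⁻¹ ℬ^χ(u)`, where `(1 - γ u⁻¹)⁻¹ = ∑_{r ≥ 0} γʳ u⁻ʳ`. -/
def bMatNorm (l : ℕ) (θ₁ θ₂ : ℂ) (s ε : Fin N → ℤˣ) (γ χ : ℂ) : SeriesMat N l θ₁ θ₂ :=
  Matrix.of fun i j =>
    (PowerSeries.mk fun r => algebraMap ℂ (OpAlg N l θ₁ θ₂) (γ ^ r)) * bMat l θ₁ θ₂ s ε γ χ i j

end Series

/-! ## The Drinfeld functor on objects and morphisms -/

section Functor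

variable {N l : ℕ} {θ₁ θ₂ : ℂ}
variable (M : Type v) [AddCommGroup M] [Module ℂ M] [Module (Hecke l θ₁ θ₂) M]
  [IsScalarTower ℂ (Hecke l θ₁ θ₂) M]
variable (M' : Type v) [AddCommGroup M'] [Module ℂ M'] [Module (Hecke l θ₁ θ₂) M']
  [IsScalarTower ℂ (Hecke l θ₁ θ₂) M']

/-- The action of `H ⊗ End(V^{⊗l})` on `M ⊗ V^{⊗l}`. -/
def act : OpAlg N l θ₁ θ₂ →ₐ[ℂ] Module.End ℂ (M ⊗[ℂ] TensorV N l) :=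
  (Module.endTensorEndAlgHom (R := ℂ) (S := ℂ) (A := ℂ) (M := M) (N := TensorV N l)).comp
    (Algebra.TensorProduct.map (Algebra.lsmul ℂ ℂ M) (AlgHom.id ℂ _))

/-- The sum of the images of `σ_i - e`, for `1 ≤ i < l`, and of `ς_l - e`, where the Weyl group
acts diagonally on `M ⊗ V^{⊗l}`. -/
def drinfeldKer (l : ℕ) (θ₁ θ₂ : ℂ) (M : Type v) [AddCommGroup M] [Module ℂ M]
    [Module (Hecke l θ₁ θ₂) M] [IsScalarTower ℂ (Hecke l θ₁ θ₂) M] (s ε : Fin N → ℤˣ) (e : ℤˣ) : Submodule ℂ (M ⊗[ℂ] TensorV N l) :=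
  (⨆ (i : Fin l) (j : Fin l) (_ : i.val + 1 = j.val),
      LinearMap.range (act M (Hecke.w (θ₁ := θ₁) (θ₂ := θ₂) (Weyl.σ i j) ⊗ₜ[ℂ] superFlip s i j) - signC e • 1)) ⊔
    ⨆ (k : Fin l) (_ : k.val + 1 = l),
      LinearMap.range (act M (Hecke.w (θ₁ := θ₁) (θ₂ := θ₂) (Weyl.ς k) ⊗ₜ[ℂ] diagAt s ε k) - signC e • 1)

/-- The space `𝒟^e_{s,ε}(M)`. -/
abbrev DrinfeldObj (l : ℕ) (θ₁ θ₂ : ℂ) (M : Type v) [AddCommGroup M] [Module ℂ M]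
    [Module (Hecke l θ₁ θ₂) M] [IsScalarTower ℂ (Hecke l θ₁ θ₂) M] (s ε : Fin N → ℤˣ) (e : ℤˣ) : Type v :=
  (M ⊗[ℂ] TensorV N l) ⧸ drinfeldKer l θ₁ θ₂ M s ε e

/-- The component of parity `p` of `𝒟^e_{s,ε}(M)`: the module `M` is purely even, and
`v_{a_1} ⊗ ⋯ ⊗ v_{a_l}` has parity `|a_1| + ⋯ + |a_l|`. -/
def drinfeldGrade (l : ℕ) (θ₁ θ₂ : ℂ) (M : Type v) [AddCommGroup M] [Module ℂ M]
    [Module (Hecke l θ₁ θ₂) M] [IsScalarTower ℂ (Hecke l θ₁ θ₂) M] (s ε : Fin N → ℤˣ) (e : ℤˣ) (p : ZMod 2) :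
    Submodule ℂ (DrinfeldObj l θ₁ θ₂ M s ε e) :=
  Submodule.span ℂ {x | ∃ (m : M) (a : Fin l → Fin N), ∑ k, par s (a k) = p ∧
    x = (drinfeldKer l θ₁ θ₂ M s ε e).mkQ (m ⊗ₜ[ℂ] basisVec a)}

variable {M M'}

theorem rTensor_act (f : M →ₗ[Hecke l θ₁ θ₂] M') (a : OpAlg N l θ₁ θ₂)
    (x : M ⊗[ℂ] TensorV N l) :
    (f.restrictScalars ℂ).rTensor _ (act M a x) =
      act M' a ((f.restrictScalars ℂ).rTensor _ x) := by
  induction a using TensorProduct.induction_on with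
  | zero => simp
  | add a b ha hb => simp only [map_add, LinearMap.add_apply, ha, hb]
  | tmul h T =>
    induction x using TensorProduct.induction_on with
    | zero => simp
    | add x y hx hy => simp only [map_add, hx, hy]
    | tmul m t => simp [act, Module.endTensorEndAlgHom_apply]

theorem drinfeldKer_le_comap (s ε : Fin N → ℤˣ) (e : ℤˣ) (f : M →ₗ[Hecke l θ₁ θ₂] M') :
    drinfeldKer l θ₁ θ₂ M s ε e ≤
      (drinfeldKer l θ₁ θ₂ M' s ε e).comap ((f.restrictScalars ℂ).rTensor (TensorV N l)) := by
  refine sup_le (iSup_le fun i => iSup_le fun j => iSup_le fun h => ?_)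
    (iSup_le fun k => iSup_le fun h => ?_)
  · rintro _ ⟨x, rfl⟩
    refine Submodule.mem_sup_left (Submodule.mem_iSup_of_mem i (Submodule.mem_iSup_of_mem j
      (Submodule.mem_iSup_of_mem h ⟨(f.restrictScalars ℂ).rTensor _ x, ?_⟩)))
    simp [rTensor_act]
  · rintro _ ⟨x, rfl⟩
    refine Submodule.mem_sup_right (Submodule.mem_iSup_of_mem k
      (Submodule.mem_iSup_of_mem h ⟨(f.restrictScalars ℂ).rTensor _ x, ?_⟩))
    simp [rTensor_act]

/-- The map `𝒟^e_{s,ε}(M) → 𝒟^e_{s,ε}(M')` induced by `f ⊗ 1`. -/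
def drinfeldMap (s ε : Fin N → ℤˣ) (e : ℤˣ) (f : M →ₗ[Hecke l θ₁ θ₂] M') :
    DrinfeldObj l θ₁ θ₂ M s ε e →ₗ[ℂ] DrinfeldObj l θ₁ θ₂ M' s ε e :=
  Submodule.mapQ _ _ ((f.restrictScalars ℂ).rTensor (TensorV N l)) (drinfeldKer_le_comap s ε e f)

end Functor

end DrinfeldBC

end

open DrinfeldBC

open DrinfeldBC

set_option linter.unusedSectionVars false

noncomputable section

namespace DrinfeldBC

/-! ## Signs -/

section Signs

/-! All factors of `ℬ^χ(u)` other than `G + γ u⁻¹` have the form `L_a(u) = 1 + (u - a)⁻¹ Q`, where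
`Q` acts at one site and on the auxiliary space. At site `k` the parameter is `a = ȷ + χ y_k` to the
left of `G + γ u⁻¹` and, once `-u` is substituted in `𝒮_k`, `a = ȷ - χ y_k` to the right of it. The
two parameters add up to `2ȷ`. On two auxiliary legs `Q₁ Q₂ = Q₁ P` and `Q₂ Q₁ = Q₂ P`, and `Q² = 2ȷ
Q`; these rules reduce each identity between factors to a partial fraction identity between
resolvents.

Relations. The quadratic relations of the Yangian are the entries of the reflection equation `(u - v
- P) B₁(u) (u + v - P) B₂(v) = B₂(v) (u + v - P) B₁(u) (u - v - P)`. Each `L_a` satisfies an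
exchange relation with itself (`exchange_laxMat`), and `L_a`, `L_b` satisfy a reflection relation if
`a + b = 2ȷ` (`reflect_laxMat`). Factors at different sites supercommute, so both pass to ordered
products. As `G + γ u⁻¹` solves the reflection equation because `G² = 1`, so does the whole product
(`reflection_of_factors`). Moreover `L_a(u) L_b(-u) = 1` if `a + b = 2ȷ`, hence `ℬ(u) = T(u) (G + γ
u⁻¹) T(-u)⁻¹` and `ℬ(u) ℬ(-u) = 1 - γ² u⁻²`; dividing by `1 - γ u⁻¹` makes it unitary.

Descent. An operator `X` preserves the image of `d` as soon as `X d = d Y` for some `Y`. Such `X`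
form a monoid (`transporter`), so the condition can be tested on blocks of factors. For `d = σ P -
e` only the two adjacent sites matter: the commutator of `σ P` with the product of their factors is
a right multiple of `d` (`transport_of_swap`), because `χ θ₁ = e`. For `d = ς g - e` only the block
`L (G + γ u⁻¹) L'` at the last site matters. It contains the term `(2γ + ϖ₁) h k Q`, with `h`, `k`
the two resolvents, and the same phenomenon occurs because `χ θ₂ = e (2γ + ϖ₁)`
(`transport_of_sign`).

Parity. The total parity operator commutes with the relations defining the quotient, so the quotient
is the sum of its two eigenspaces. Functoriality holds because `f ⊗ 1` commutes with `H ⊗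
End(V^{⊗l})`. -/

theorem sgn_add (p q : ZMod 2) : sgn (p + q) = sgn p * sgn q := by
  revert p q
  have h : ∀ p q : ZMod 2, (p = 0 ∨ p = 1) ∧ (q = 0 ∨ q = 1) := by decide
  intro p q
  have h11 : (1 + 1 : ZMod 2) = 0 := by decide
  rcases h p q with ⟨rfl | rfl, rfl | rfl⟩ <;> simp [sgn, h11, ZMod.val_one]

@[simp] theorem sgn_zero : sgn 0 = 1 := by simp [sgn]

@[simp] theorem sgn_one : sgn 1 = -1 := by simp [sgn, ZMod.val_one]

@[simp] theorem sgn_mul_self (p : ZMod 2) : sgn p * sgn p = 1 := by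
  rw [← sgn_add, CharTwo.add_self_eq_zero, sgn_zero]

theorem sgn_sum {ι : Type*} (t : Finset ι) (f : ι → ZMod 2) :
    sgn (∑ i ∈ t, f i) = ∏ i ∈ t, sgn (f i) := by
  classical
  induction t using Finset.induction_on with
  | empty => simp
  | insert a t ha ih => rw [Finset.sum_insert ha, Finset.prod_insert ha, sgn_add, ih]

theorem zmod_two_mul_self (p : ZMod 2) : p * p = p := by
  revert p; decide

theorem zmod_two_cases (p : ZMod 2) : p = 0 ∨ p = 1 := by
  revert p; decide

@[simp] theorem signC_mul_self (x : ℤˣ) : signC x * signC x = 1 := by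
  rcases Int.units_eq_one_or x with rfl | rfl <;> norm_num [signC]

variable {N : ℕ} (s : Fin N → ℤˣ)

theorem signC_eq_sgn (i : Fin N) : signC (s i) = sgn (par s i) := by
  rcases Int.units_eq_one_or (s i) with h | h <;> norm_num [par, h, signC]

end Signs

/-! ## Series -/

section Series

variable {A : Type u} [Ring A]

open PowerSeries in
/-- The substitution of `-u` for `u`, as a ring homomorphism. -/
noncomputable def negUHom : PowerSeries A →+* PowerSeries A where
  toFun := negU
  map_zero' := by ext r; simp [negU]
  map_one' := by
    ext r
    rcases r with _ | r <;> simp [negU, coeff_one]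
  map_add' f g := by ext r; simp [negU, mul_add]
  map_mul' f g := by
    ext r
    simp only [negU, coeff_mk, coeff_mul, Finset.mul_sum]
    refine Finset.sum_congr rfl fun pq h => ?_
    rw [← Finset.HasAntidiagonal.mem_antidiagonal.1 h, pow_add, mul_assoc, mul_assoc]
    congr 1
    rw [← mul_assoc, ← mul_assoc]
    congr 1
    exact ((Commute.neg_one_left _).pow_left _).eq

theorem negUHom_apply (f : PowerSeries A) : negUHom f = negU f := rfl

@[simp] theorem negUHom_X : negUHom (PowerSeries.X : PowerSeries A) = -PowerSeries.X := by
  ext r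
  by_cases h : r = 1 <;> simp [negUHom_apply, negU, PowerSeries.coeff_X, h]

@[simp] theorem negUHom_C (a : A) : negUHom (PowerSeries.C a) = PowerSeries.C a := by
  ext r
  by_cases h : r = 0 <;> simp [negUHom_apply, negU, PowerSeries.coeff_C, h]

@[simp] theorem negUHom_negUHom (f : PowerSeries A) : negUHom (negUHom f) = f := by
  ext r
  simp only [negUHom_apply, negU, PowerSeries.coeff_mk, ← mul_assoc, ← pow_add, ← two_mul]
  simp

theorem coeff_invSub (a : A) (r : ℕ) :
    PowerSeries.coeff r (invSub a) = if r = 0 then 0 else a ^ (r - 1) := by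
  rcases r with _ | r
  · simp [invSub]
  · simp [invSub, PowerSeries.coeff_succ_X_mul]

theorem negUHom_invSub (a : A) : negUHom (invSub a) = -invSub (-a) := by
  ext r
  rw [negUHom_apply, negU, PowerSeries.coeff_mk, coeff_invSub, map_neg, coeff_invSub]
  rcases r with _ | r
  · simp
  · rw [if_neg (Nat.succ_ne_zero r), if_neg (Nat.succ_ne_zero r), Nat.succ_sub_one, neg_pow a]
    simp [pow_succ]

theorem invSub_mul (a : A) :
    invSub a * (1 - PowerSeries.C a * PowerSeries.X) = PowerSeries.X := by
  ext r
  rw [mul_sub, mul_one, ← mul_assoc, map_sub, coeff_invSub]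
  rcases r with _ | r
  · simp
  · rw [PowerSeries.coeff_succ_mul_X, PowerSeries.coeff_mul_C, coeff_invSub, PowerSeries.coeff_X]
    rcases r with _ | r
    · simp
    · simp [pow_succ]

theorem mul_invSub (a : A) :
    (1 - PowerSeries.C a * PowerSeries.X) * invSub a = PowerSeries.X := by
  ext r
  rw [sub_mul, one_mul, mul_assoc, map_sub, coeff_invSub, PowerSeries.coeff_C_mul]
  rcases r with _ | r
  · simp
  · rw [PowerSeries.coeff_succ_X_mul, coeff_invSub, PowerSeries.coeff_X]
    rcases r with _ | r
    · simp
    · simp [pow_succ']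

theorem commute_C_invSub {a b : A} (h : Commute b a) :
    Commute (PowerSeries.C b) (invSub a) := by
  ext r
  rw [PowerSeries.coeff_C_mul, PowerSeries.coeff_mul_C, coeff_invSub]
  split_ifs
  · simp
  · exact (h.pow_right _).eq

theorem commute_invSub {a b : A} (h : Commute a b) : Commute (invSub a) (invSub b) := by
  ext r
  rw [PowerSeries.coeff_mul, PowerSeries.coeff_mul, ← Finset.Nat.sum_antidiagonal_swap]
  refine Finset.sum_congr rfl fun pq _ => ?_
  simp only [coeff_invSub, Prod.fst_swap, Prod.snd_swap]
  split_ifs <;> simp [(h.pow_pow _ _).eq]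

/-- Moving a constant past `1 / (u - a)`, given its commutation with `a` up to a constant. -/
theorem C_mul_invSub {a b τ c : A} (h : τ * a = b * τ + c) :
    PowerSeries.C τ * invSub a =
      invSub b * PowerSeries.C τ + invSub b * PowerSeries.C c * invSub a := by
  have hX : ∀ f : PowerSeries A, PowerSeries.X * f = f * PowerSeries.X := fun f =>
    PowerSeries.X_mul
  -- Since `X` can be cancelled, it suffices to prove the identity times `X`. That is `e1`
  -- sandwiched between the resolvents `invSub b` and `invSub a`, which turn `1 - b X` and `1 - a X`
  -- into `X`.
  apply PowerSeries.X_mul_cancel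
  have e1 : PowerSeries.C τ * (1 - PowerSeries.C a * PowerSeries.X) =
      (1 - PowerSeries.C b * PowerSeries.X) * PowerSeries.C τ
        - PowerSeries.C c * PowerSeries.X := by
    rw [mul_sub, ← mul_assoc, ← map_mul, h, sub_mul, mul_assoc (PowerSeries.C b), hX, ← mul_assoc,
      map_add, map_mul, add_mul]
    simp only [mul_one, one_mul]
    abel
  have e2 := congrArg (fun x => invSub b * x * invSub a) e1
  simp only [sub_mul, mul_sub] at e2
  have i1 := invSub_mul b
  have i2 := mul_invSub a
  rw [mul_sub, mul_one] at i1
  rw [sub_mul, one_mul] at i2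
  have e3 : invSub b * (PowerSeries.C τ * (1 - PowerSeries.C a * PowerSeries.X)) * invSub a =
      PowerSeries.X * (invSub b * PowerSeries.C τ) := by
    rw [mul_assoc, mul_assoc, mul_invSub, hX, mul_assoc]
  have e4 : invSub b * ((1 - PowerSeries.C b * PowerSeries.X) * PowerSeries.C τ
        - PowerSeries.C c * PowerSeries.X) * invSub a =
      PowerSeries.X * (PowerSeries.C τ * invSub a)
        - PowerSeries.X * (invSub b * PowerSeries.C c * invSub a) := by
    rw [mul_sub, sub_mul, ← mul_assoc, invSub_mul, mul_assoc PowerSeries.X, hX (invSub b * _ * _)]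
    congr 1
    simp only [mul_assoc, hX]
  rw [mul_add, ← e3, e1, e4]
  abel

end Series

/-! ## Matrices acting on two legs -/

section Legs

variable {R : Type u} [Ring R] {N : ℕ}

/-- The matrix `M ⊗ 1`. -/
def leg₁ : Matrix (Fin N) (Fin N) R →+* Matrix (Fin N × Fin N) (Fin N × Fin N) R :=
  (Matrix.blockDiagonalRingHom (Fin N) (Fin N) R).comp (Pi.constRingHom (Fin N) _)

theorem leg₁_apply (M : Matrix (Fin N) (Fin N) R) (i j k l : Fin N) :
    leg₁ M (i, k) (j, l) = if k = l then M i j else 0 := by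
  simp [leg₁, Matrix.blockDiagonal_apply]

variable [Algebra ℂ R]

/-- The matrix of the super permutation of two factors. -/
def superPerm (s : Fin N → ℤˣ) : Matrix (Fin N × Fin N) (Fin N × Fin N) R :=
  Matrix.of fun p q => if q = p.swap then algebraMap ℂ R (sgn (par s p.1 * par s p.2)) else 0

variable (s : Fin N → ℤˣ)

theorem superPerm_mul_apply (M : Matrix (Fin N × Fin N) (Fin N × Fin N) R) (i k : Fin N)
    (q : Fin N × Fin N) :
    (superPerm (R := R) s * M) (i, k) q = sgn (par s i * par s k) • M (k, i) q := by
  simp [superPerm, Matrix.mul_apply, Algebra.smul_def]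

theorem mul_superPerm_apply (M : Matrix (Fin N × Fin N) (Fin N × Fin N) R) (j l : Fin N)
    (p : Fin N × Fin N) :
    (M * superPerm (R := R) s) p (j, l) = sgn (par s j * par s l) • M p (l, j) := by
  rw [Matrix.mul_apply, Finset.sum_eq_single (l, j)]
  · simp [superPerm, Algebra.smul_def, mul_comm (par s l), Algebra.commutes]
  · rintro ⟨a, b⟩ _ h
    simp only [superPerm, Matrix.of_apply, Prod.swap_prod_mk, Prod.mk.injEq]
    rw [if_neg, mul_zero]
    rintro ⟨rfl, rfl⟩
    exact h rfl
  · simp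

theorem superPerm_mul_self : superPerm (R := R) s * superPerm s =
    (1 : Matrix (Fin N × Fin N) (Fin N × Fin N) R) := by
  ext ⟨i, k⟩ ⟨j, l⟩
  rw [superPerm_mul_apply]
  by_cases h : i = j ∧ k = l
  · obtain ⟨rfl, rfl⟩ := h
    simp [superPerm, Algebra.smul_def, ← map_mul, mul_comm (par s k)]
  · rw [Matrix.one_apply_ne (by simpa using h)]
    simp only [superPerm, Matrix.of_apply, Prod.swap_prod_mk, Prod.mk.injEq]
    rw [if_neg (by tauto), smul_zero]

/-- The matrix `1 ⊗ M`, with the signs of the super tensor product. -/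
def leg₂ : Matrix (Fin N) (Fin N) R →+* Matrix (Fin N × Fin N) (Fin N × Fin N) R where
  -- Conjugation by the super permutation makes multiplicativity immediate; the signs of the graded
  -- tensor product come out in `leg₂_apply`.
  toFun M := superPerm s * leg₁ M * superPerm s
  map_zero' := by simp
  map_one' := by rw [map_one, mul_one, superPerm_mul_self]
  map_add' M M' := by rw [map_add, mul_add, add_mul]
  map_mul' M M' := by
    rw [map_mul]
    simp only [mul_assoc]
    rw [← mul_assoc (superPerm s) (superPerm s), superPerm_mul_self, one_mul]

theorem leg₂_def (M : Matrix (Fin N) (Fin N) R) :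
    leg₂ s M = superPerm s * leg₁ M * superPerm s := rfl

theorem superPerm_mul_leg₁ (M : Matrix (Fin N) (Fin N) R) :
    superPerm s * leg₁ M = leg₂ s M * superPerm s := by
  rw [leg₂_def, mul_assoc, mul_assoc, superPerm_mul_self, mul_one]

theorem superPerm_mul_leg₂ (M : Matrix (Fin N) (Fin N) R) :
    superPerm s * leg₂ s M = leg₁ M * superPerm s := by
  rw [leg₂_def, ← mul_assoc, ← mul_assoc, superPerm_mul_self, one_mul]

theorem leg₂_apply (M : Matrix (Fin N) (Fin N) R) (i j k l : Fin N) :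
    leg₂ s M (i, k) (j, l) =
      if i = j then sgn (par s i * (par s k + par s l)) • M k l else 0 := by
  rw [leg₂_def, mul_superPerm_apply, superPerm_mul_apply, leg₁_apply, smul_smul, ← sgn_add]
  split_ifs with h
  · subst h
    congr 2
    ring
  · simp

theorem leg₁_mul_leg₂_apply (M M' : Matrix (Fin N) (Fin N) R) (i j k l : Fin N) :
    (leg₁ M * leg₂ s M') (i, k) (j, l) =
      sgn (par s j * (par s k + par s l)) • (M i j * M' k l) := by
  rw [Matrix.mul_apply, Finset.sum_eq_single (j, k)]
  · simp [leg₁_apply, leg₂_apply]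
  · rintro ⟨a, b⟩ _ h
    rw [leg₁_apply, leg₂_apply]
    by_cases h1 : k = b
    · rw [if_neg (c := a = j), mul_zero]
      rintro rfl
      exact h (by rw [h1])
    · simp [h1]
  · simp

theorem leg₂_mul_leg₁_apply (M M' : Matrix (Fin N) (Fin N) R) (i j k l : Fin N) :
    (leg₂ s M' * leg₁ M) (i, k) (j, l) =
      sgn (par s i * (par s k + par s l)) • (M' k l * M i j) := by
  rw [Matrix.mul_apply, Finset.sum_eq_single (i, l)]
  · simp [leg₁_apply, leg₂_apply]
  · rintro ⟨a, b⟩ _ h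
    rw [leg₁_apply, leg₂_apply]
    by_cases h1 : i = a
    · rw [if_neg (c := b = l), mul_zero]
      rintro rfl
      exact h (by rw [h1])
    · simp [h1]
  · simp

/-- Matrices with supercommuting entries, placed in different legs, commute. -/
theorem commute_leg₁_leg₂ {M M' : Matrix (Fin N) (Fin N) R}
    (h : ∀ i j k l, M i j * M' k l =
      sgn ((par s i + par s j) * (par s k + par s l)) • (M' k l * M i j)) :
    Commute (leg₁ M) (leg₂ s M') := by
  ext ⟨i, k⟩ ⟨j, l⟩
  rw [leg₁_mul_leg₂_apply, leg₂_mul_leg₁_apply, h, smul_smul, ← sgn_add]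
  congr 2
  -- The exponents of the two signs agree modulo 2. The later uses of `CharTwo.two_eq_zero` are
  -- parity counts of the same kind.
  linear_combination (par s j * (par s k + par s l)) * (CharTwo.two_eq_zero (R := ZMod 2))

end Legs

/-! ## Identities in noncommutative rings -/

section RingIdentities

variable {R : Type u} [Ring R]

/-- The exchange relation `(u - v - P) L₁(u) L₂(v) = L₂(v) L₁(u) (u - v - P)` for `L = 1 + h Q`,
where `z = u⁻¹`, `w = v⁻¹`. -/
theorem exchange_of_rank_one {z w h k Q₁ Q₂ P : R} (hz : ∀ x, Commute x z) (hw : ∀ x, Commute x w)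
    (hk : Commute k h) (h₂ : Commute Q₂ h) (hP : Commute P h)
    (k₁ : Commute Q₁ k) (k₂ : Commute Q₂ k) (kP : Commute P k)
    (P₁ : P * Q₁ = Q₂ * P) (P₂ : P * Q₂ = Q₁ * P)
    (Q₁₂ : Q₁ * Q₂ = Q₁ * P) (Q₂₁ : Q₂ * Q₁ = Q₂ * P)
    (E : z * (w * h) - z * (w * k) = z * (h * k) - w * (h * k)) :
    (w - z - z * w * P) * (1 + h * Q₁) * (1 + k * Q₂) =
      (1 + k * Q₂) * (1 + h * Q₁) * (w - z - z * w * P) := by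
  -- With `h = 1/(u - a)` and `k = 1/(v - a)`, `E` is the partial fraction identity `h - k = (v - u)
  -- h k` times `u⁻¹ v⁻¹`. After normal ordering, the two sides of the goal differ by the two sides
  -- of `E` times `(Q₁ - Q₂) P`.
  have E' := congrArg (· * ((Q₁ - Q₂) * P)) E
  have Q₂₁' := fun x => congrArg (· * x) Q₂₁
  simp only [mul_assoc] at Q₂₁'
  simp only [mul_add, add_mul, mul_sub, sub_mul, mul_one, one_mul, mul_assoc,
    (hz h).left_comm, (hw h).left_comm, (hz k).left_comm, (hw k).left_comm,
    (hz P).eq, (hz P).left_comm, (hw P).eq, (hw P).left_comm,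
    (hz Q₁).eq, (hz Q₁).left_comm, (hw Q₁).eq, (hw Q₁).left_comm,
    (hz Q₂).eq, (hz Q₂).left_comm, (hw Q₂).eq, (hw Q₂).left_comm,
    hk.left_comm, h₂.left_comm, hP.left_comm, k₁.left_comm, k₂.left_comm, kP.left_comm,
    P₁, P₂, Q₁₂, Q₂₁, Q₂₁'] at E' ⊢
  linear_combination (norm := abel) E'

/-- The reflection equation for `L₁(u) (u + v - P) L₂(v)`, where `L = 1 + h Q`, `z = u⁻¹`,
`w = v⁻¹`. -/
theorem reflection_of_rank_one {z w h k Q₁ Q₂ P d : R} (hz : ∀ x, Commute x z)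
    (hw : ∀ x, Commute x w) (hd : ∀ x, Commute x d)
    (hk : Commute k h) (h₂ : Commute Q₂ h) (hP : Commute P h)
    (k₁ : Commute Q₁ k) (kP : Commute P k)
    (P₁ : P * Q₁ = Q₂ * P) (P₂ : P * Q₂ = Q₁ * P)
    (Q₁₂ : Q₁ * Q₂ = Q₁ * P) (Q₂₁ : Q₂ * Q₁ = Q₂ * P)
    (Q₁₁ : Q₁ * Q₁ = d * Q₁) (Q₂₂ : Q₂ * Q₂ = d * Q₂)
    (E : z * (w * h) + z * (w * k) = z * (h * k) + w * (h * k) - d * (z * (w * (h * k)))) :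
    (1 + h * Q₁) * (z + w - z * w * P) * (1 + k * Q₂) =
      (1 + k * Q₂) * (z + w - z * w * P) * (1 + h * Q₁) := by
  -- Here `h = 1/(u - a)`, `k = 1/(v - b)` and `d = a + b`, so `E` encodes `h + k = (u + v - d) h
  -- k`. The term with `d` cancels the one produced by `Q² = d Q`; what remains is again a multiple
  -- of `(Q₁ - Q₂) P`.
  have E' := congrArg (· * ((Q₁ - Q₂) * P)) E
  have Q₁₁' := fun x => congrArg (· * x) Q₁₁
  have Q₂₂' := fun x => congrArg (· * x) Q₂₂
  simp only [mul_assoc] at Q₁₁' Q₂₂'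
  simp only [mul_add, add_mul, mul_sub, sub_mul, mul_one, one_mul, mul_assoc,
    (hd z).left_comm, (hd w).left_comm,
    (hd h).left_comm, (hd k).left_comm,
    (hz h).left_comm, (hw h).left_comm,
    (hz k).left_comm, (hw k).left_comm,
    (hz Q₁).eq, (hz Q₁).left_comm, (hw Q₁).eq, (hw Q₁).left_comm,
    (hz Q₂).eq, (hz Q₂).left_comm, (hw Q₂).eq, (hw Q₂).left_comm,
    hk.left_comm, h₂.left_comm, hP.left_comm,
    k₁.left_comm, kP.left_comm,
    P₁, P₂, Q₁₂, Q₂₁, Q₁₁', Q₂₂'] at E' ⊢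
  linear_combination (norm := abel) -E'

/-- The reflection equation for `G + γ u⁻¹`, where `G ^ 2 = 1`. -/
theorem reflection_of_involution {z w γ G₁ G₂ P : R} (hz : ∀ x, Commute x z)
    (hw : ∀ x, Commute x w) (hγ : ∀ x, Commute x γ)
    (P₁ : P * G₁ = G₂ * P) (P₂ : P * G₂ = G₁ * P) (PP : P * P = 1)
    (G₂₁ : G₂ * G₁ = G₁ * G₂) (G₁₁ : G₁ * G₁ = 1) (G₂₂ : G₂ * G₂ = 1) :
    (w - z - z * w * P) * (G₁ + γ * z) * (z + w - z * w * P) * (G₂ + γ * w) =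
      (G₂ + γ * w) * (z + w - z * w * P) * (G₁ + γ * z) * (w - z - z * w * P) := by
  have G₂₁' := fun x => congrArg (· * x) G₂₁
  have G₁₁' := fun x => congrArg (· * x) G₁₁
  have G₂₂' := fun x => congrArg (· * x) G₂₂
  simp only [mul_assoc, one_mul] at G₂₁' G₁₁' G₂₂'
  -- As `G² = 1`, both `G₁ P G₂` and `G₂ P G₁` collapse to `P`, and the expanded sides agree term by
  -- term.
  simp only [mul_add, add_mul, mul_sub, sub_mul, mul_one, mul_assoc,
    (hγ z).left_comm, (hγ w).left_comm,
    (hγ P).left_comm,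
    (hγ G₁).left_comm, (hγ G₂).left_comm,
    (hz w).eq, (hz w).left_comm,
    (hz P).eq, (hz P).left_comm, (hw P).eq, (hw P).left_comm,
    (hz G₁).eq, (hz G₁).left_comm, (hw G₁).eq, (hw G₁).left_comm,
    (hz G₂).eq, (hz G₂).left_comm, (hw G₂).eq, (hw G₂).left_comm,
    P₁, P₂, PP, G₂₁, G₂₂, G₂₁', G₁₁', G₂₂']
  abel

/-- The reflection equation for `T G S`, from the exchange relations between its factors. -/
theorem reflection_of_factors {T₁ T₂ G₁ G₂ S₁ S₂ r k : R}
    (hT : r * T₁ * T₂ = T₂ * T₁ * r) (hS : r * S₁ * S₂ = S₂ * S₁ * r)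
    (hST : S₁ * k * T₂ = T₂ * k * S₁) (hTS : T₁ * k * S₂ = S₂ * k * T₁)
    (hG : r * G₁ * k * G₂ = G₂ * k * G₁ * r)
    (gT : Commute G₁ T₂) (gS : Commute S₁ G₂) (gT' : Commute T₁ G₂) (gS' : Commute G₁ S₂) :
    r * (T₁ * G₁ * S₁) * k * (T₂ * G₂ * S₂) = T₂ * G₂ * S₂ * k * (T₁ * G₁ * S₁) * r := by
  calc r * (T₁ * G₁ * S₁) * k * (T₂ * G₂ * S₂)
      = r * T₁ * G₁ * (S₁ * k * T₂) * G₂ * S₂ := by simp only [mul_assoc]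
    _ = r * T₁ * (G₁ * T₂) * k * (S₁ * G₂) * S₂ := by rw [hST]; simp only [mul_assoc]
    _ = (r * T₁ * T₂) * G₁ * k * G₂ * S₁ * S₂ := by rw [gT.eq, gS.eq]; simp only [mul_assoc]
    _ = T₂ * T₁ * (r * G₁ * k * G₂) * S₁ * S₂ := by rw [hT]; simp only [mul_assoc]
    _ = T₂ * (T₁ * G₂) * k * G₁ * (r * S₁ * S₂) := by rw [hG]; simp only [mul_assoc]
    _ = T₂ * G₂ * T₁ * k * (G₁ * S₂) * S₁ * r := by rw [hS, gT'.eq]; simp only [mul_assoc]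
    _ = T₂ * G₂ * (T₁ * k * S₂) * G₁ * S₁ * r := by rw [gS'.eq]; simp only [mul_assoc]
    _ = T₂ * G₂ * S₂ * k * (T₁ * G₁ * S₁) * r := by rw [hTS]; simp only [mul_assoc]

/-- The product of two factors `1 + h Q` preserves the right ideal generated by `σ P - e`. -/
theorem transport_of_swap {σ P h₁ h₂ Q₁ Q₂ e : R} (he : ∀ x, Commute x e)
    (σP : Commute P σ) (σ₁ : Commute Q₁ σ) (σ₂ : Commute Q₂ σ)
    (hh : Commute h₂ h₁) (h₁P : Commute P h₁) (h₂P : Commute P h₂)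
    (h₁₂ : Commute Q₁ h₂)
    (PP : P * P = 1) (P₁ : P * Q₁ = Q₂ * P) (P₂ : P * Q₂ = Q₁ * P)
    (Q₁₂ : Q₁ * Q₂ = Q₁ * P)
    (E₁ : σ * h₁ = h₂ * σ + e * (h₁ * h₂)) (E₂ : σ * h₂ = h₁ * σ - e * (h₁ * h₂)) :
    (1 + h₁ * Q₁) * (1 + h₂ * Q₂) * (σ * P - e) =
      (σ * P - e) * ((1 + h₁ * Q₁) * (1 + h₂ * Q₂) - h₁ * h₂ * (Q₁ - Q₂) * P) := by
  -- By `E₁` and `E₂`, `σ` commutes with `h₁ h₂`, and the commutator of `σ P` with the product is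
  -- `(σ P - e) h₁ h₂ (Q₁ - Q₂) P`. This explains the correction term on the right.
  have P₁' := fun x => congrArg (· * x) P₁
  have P₂' := fun x => congrArg (· * x) P₂
  have E₁' := fun x => congrArg (· * x) E₁
  have E₂' := fun x => congrArg (· * x) E₂
  simp only [mul_assoc, add_mul, sub_mul] at P₁' P₂' E₁' E₂'
  simp only [mul_add, add_mul, mul_sub, sub_mul, mul_one, one_mul, mul_assoc,
    (he h₁).left_comm,
    (he h₂).left_comm, (he P).eq, (he Q₁).eq, (he Q₁).left_comm, (he Q₂).eq, σP.left_comm,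
    σ₁.eq, σ₁.left_comm, σ₂.left_comm, hh.left_comm,
    h₁P.left_comm, h₂P.left_comm, h₁₂.left_comm,
    PP, P₁, P₂, Q₁₂, P₁', P₂', E₁', E₂']
  abel

/-- The product `L G L'` of the factors `L = 1 + h Q`, `L' = 1 + k Q` and of `G + γ u⁻¹`
preserves the right ideal generated by `ς g - e`. -/
theorem transport_of_sign {ς g G z γ h k Q e d ϖ : R} (he : ∀ x, Commute x e)
    (hz : ∀ x, Commute x z) (hγ : ∀ x, Commute x γ) (hd : ∀ x, Commute x d)
    (hϖ : ∀ x, Commute x ϖ)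
    (ςg : Commute g ς) (ςQ : Commute Q ς) (ςG : Commute G ς) (gG : Commute G g)
    (kG : Commute G k)
    (hk : Commute k h) (hg : Commute g h) (kg : Commute g k)
    (kQ : Commute Q k)
    (gg : g * g = 1) (gQ : G * Q = g * Q) (Qg : Q * G = Q * g)
    (QQ : Q * Q = d * Q) (QgQ : Q * (g * Q) = ϖ * Q)
    (E : ς * h = k * ς + e * ((γ + γ + ϖ) * (h * k)))
    (E' : ς * k = h * ς - e * ((γ + γ + ϖ) * (h * k)))
    (Ez : z * h + z * k = h * k + h * k - d * (z * (h * k))) :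
    (1 + h * Q) * (G + γ * z) * (1 + k * Q) * (ς * g - e) =
      (ς * g - e) * ((1 + h * Q) * (G + γ * z) * (1 + k * Q)
        - (γ + γ + ϖ) * (h * k) * (Q - g * Q * g)) := by
  have gg' := fun x => congrArg (· * x) gg
  simp only [mul_assoc, one_mul] at gg'
  -- The block collapses to a form without products of `Q`: the terms with `γ z` combine by `Ez`,
  -- which is `h + k = (2u - d) h k` times `u⁻¹`, into `2γ h k Q`, and `Q G Q = ϖ Q` adds `ϖ h k Q`.
  -- This is the origin of `2γ + ϖ`.
  have X : (1 + h * Q) * (G + γ * z) * (1 + k * Q) =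
      G + γ * z + h * Q * g + k * g * Q + (γ + γ + ϖ) * (h * k) * Q := by
    have Ez' := congrArg (· * (γ * Q)) Ez
    simp only [mul_add, add_mul, sub_mul, mul_one, one_mul, mul_assoc,
      (hd z).left_comm, (hd h).left_comm,
      (hd k).left_comm,
      (hd γ).left_comm,
      (hϖ h).left_comm, (hϖ k).left_comm,
      (hγ z).left_comm, (hγ h).left_comm,
      (hγ k).left_comm,
      (hγ Q).left_comm,
      (hz Q).eq, (hz h).left_comm,
      kG.left_comm, kg.left_comm, kQ.left_comm,
      gQ, Qg, QQ, QgQ] at Ez' ⊢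
    linear_combination (norm := abel) Ez'
  have E₁' := fun x => congrArg (· * x) E
  have E₂' := fun x => congrArg (· * x) E'
  simp only [mul_assoc, add_mul, sub_mul, mul_add] at E E' E₁' E₂'
  -- In this form the commutator with `ς g` is visibly `(ς g - e) (2γ + ϖ) h k (Q - g Q g)`: `ς`
  -- exchanges `h` and `k` up to the constant in `E` and `E'`.
  rw [X]
  simp only [mul_add, add_mul, mul_sub, sub_mul, mul_one, mul_assoc,
      (he g).eq, (he g).left_comm,
      (he G).eq, (he z).eq, (he h).left_comm,
      (he k).left_comm, (he Q).eq, (he Q).left_comm,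
      (he γ).left_comm, (he ϖ).left_comm,
      (hϖ γ).left_comm,
      (hϖ k).left_comm,
      (hϖ ς).left_comm, (hϖ g).left_comm,
      (hγ k).left_comm,
      (hγ ς).left_comm, (hγ g).left_comm,
      (hz ς).left_comm, (hz g).eq, hk.left_comm, hg.left_comm,
      kg.left_comm, ςg.left_comm, ςQ.eq, ςQ.left_comm, ςG.left_comm, gG.eq, gg, gg', E₁', E₂']
  abel

end RingIdentities

/-! ## Series in two variables -/

section TwoVariables

variable {A : Type u} [Ring A]

theorem commute_scalar {R : Type u} [Ring R] {n : Type*} [Fintype n] [DecidableEq n] {x : R}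
    {M : Matrix n n R} (h : ∀ i j, Commute x (M i j)) : Commute (Matrix.scalar n x) M := by
  ext i j
  simp [(h i j).eq]

/-- In the iterated series ring the inner variable is `u⁻¹` and the outer one is `v⁻¹`: thus `C X`
is `u⁻¹`, `X` is `v⁻¹`, `f(u)` is embedded by `C` and `g(v)` by `map C`. -/
theorem commute_C_X (f : PowerSeries (PowerSeries A)) :
    Commute (PowerSeries.C PowerSeries.X) f := by
  ext q : 1
  rw [PowerSeries.coeff_C_mul, PowerSeries.coeff_mul_C, PowerSeries.X_mul]

theorem commute_C_C {a : A} (h : ∀ x, Commute a x) (f : PowerSeries A) :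
    Commute (PowerSeries.C a) f := by
  ext q
  rw [PowerSeries.coeff_C_mul, PowerSeries.coeff_mul_C, (h _).eq]

theorem coeff_coeff_C_mul_map (f g : PowerSeries A) (p q : ℕ) :
    PowerSeries.coeff p (PowerSeries.coeff q
      (PowerSeries.C f * PowerSeries.map PowerSeries.C g)) =
      PowerSeries.coeff p f * PowerSeries.coeff q g := by
  rw [PowerSeries.coeff_C_mul, PowerSeries.coeff_map, PowerSeries.coeff_mul_C]

theorem coeff_coeff_map_mul_C (f g : PowerSeries A) (p q : ℕ) :
    PowerSeries.coeff p (PowerSeries.coeff q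
      (PowerSeries.map PowerSeries.C g * PowerSeries.C f)) =
      PowerSeries.coeff q g * PowerSeries.coeff p f := by
  rw [PowerSeries.coeff_mul_C, PowerSeries.coeff_map, PowerSeries.coeff_C_mul]

theorem commute_C_map {f g : PowerSeries A}
    (h : ∀ p q, Commute (PowerSeries.coeff p f) (PowerSeries.coeff q g)) :
    Commute (PowerSeries.C f) (PowerSeries.map PowerSeries.C g) := by
  ext q p
  rw [coeff_coeff_C_mul_map, coeff_coeff_map_mul_C, (h p q).eq]

theorem commute_coeff_invSub {a x : A} (h : Commute a x) (p : ℕ) :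
    Commute (PowerSeries.coeff p (invSub a)) x := by
  rw [coeff_invSub]
  split_ifs
  · exact Commute.zero_left _
  · exact h.pow_left _

theorem commute_C_map_invSub {a b : A} (h : Commute a b) :
    Commute (PowerSeries.C (invSub a)) (PowerSeries.map PowerSeries.C (invSub b)) :=
  commute_C_map fun _ q => commute_coeff_invSub (commute_coeff_invSub h.symm q).symm _

/-- This is `(1 - b v⁻¹) · 1/(v - b) = v⁻¹` multiplied by `u⁻¹ · 1/(u - a)`. Together with the
companion `C_X_mul_X_mul_map_invSub` it yields, by subtraction and by addition, the partial fraction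
identities assumed in `exchange_of_rank_one` and `reflection_of_rank_one`. -/
theorem C_X_mul_X_mul_C_invSub {a b : A} (h : Commute a b) :
    PowerSeries.C PowerSeries.X * (PowerSeries.X * PowerSeries.C (invSub a)) =
      PowerSeries.C PowerSeries.X *
          (PowerSeries.C (invSub a) * PowerSeries.map PowerSeries.C (invSub b))
        - PowerSeries.C (PowerSeries.C b) * (PowerSeries.C PowerSeries.X *
          (PowerSeries.X *
            (PowerSeries.C (invSub a) * PowerSeries.map PowerSeries.C (invSub b)))) := by
  have e := congrArg (PowerSeries.map (PowerSeries.C (R := A))) (mul_invSub b)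
  simp only [map_mul, map_sub, map_one, PowerSeries.map_X, PowerSeries.map_C] at e
  conv_lhs => rw [← e]
  have hb : Commute (PowerSeries.C (PowerSeries.C b) : PowerSeries (PowerSeries A))
      (PowerSeries.C PowerSeries.X) := (commute_C_X _).symm
  rw [sub_mul, sub_mul, mul_sub, one_mul, (commute_C_map_invSub h).eq]
  simp only [mul_assoc]
  rw [hb.left_comm]

theorem C_X_mul_X_mul_map_invSub (a b : A) :
    PowerSeries.C PowerSeries.X * (PowerSeries.X * PowerSeries.map PowerSeries.C (invSub b)) =
      PowerSeries.X *
          (PowerSeries.C (invSub a) * PowerSeries.map PowerSeries.C (invSub b))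
        - PowerSeries.C (PowerSeries.C a) * (PowerSeries.C PowerSeries.X *
          (PowerSeries.X *
            (PowerSeries.C (invSub a) * PowerSeries.map PowerSeries.C (invSub b)))) := by
  have e := congrArg (PowerSeries.C (R := PowerSeries A)) (mul_invSub a)
  simp only [map_mul, map_sub, map_one] at e
  have hX : ∀ f : PowerSeries (PowerSeries A), Commute f PowerSeries.X := PowerSeries.commute_X
  rw [(hX (PowerSeries.C PowerSeries.X)).left_comm, (hX (PowerSeries.C PowerSeries.X)).left_comm,
    (hX (PowerSeries.C (PowerSeries.C a))).left_comm]
  conv_lhs => rw [← e]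
  rw [sub_mul, one_mul, sub_mul, mul_sub]
  simp only [mul_assoc]

end TwoVariables

/-! ### Two auxiliary legs with the spectral variables `u` and `v` -/

section TwoLegs

variable {A : Type u} [Ring A] {N : ℕ}

/-- The matrix `M(u) ⊗ 1`. -/
def firstLeg : Matrix (Fin N) (Fin N) (PowerSeries A) →+*
    Matrix (Fin N × Fin N) (Fin N × Fin N) (PowerSeries (PowerSeries A)) :=
  leg₁.comp PowerSeries.C.mapMatrix

variable [Algebra ℂ A] (s : Fin N → ℤˣ)

/-- The matrix `1 ⊗ M(v)`. -/
def secondLeg : Matrix (Fin N) (Fin N) (PowerSeries A) →+*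
    Matrix (Fin N × Fin N) (Fin N × Fin N) (PowerSeries (PowerSeries A)) :=
  (leg₂ s).comp (PowerSeries.map PowerSeries.C).mapMatrix

theorem leg₁_scalar {R : Type u} [Ring R] (x : R) :
    leg₁ (Matrix.scalar (Fin N) x) = Matrix.scalar (Fin N × Fin N) x := by
  ext ⟨i, k⟩ ⟨j, l⟩
  rw [leg₁_apply]
  by_cases h : k = l <;> by_cases h' : i = j <;>
    simp [h, h']

theorem commute_superPerm_scalar {R : Type u} [Ring R] [Algebra ℂ R] (x : R) :
    Commute (superPerm s) (Matrix.scalar (Fin N × Fin N) x) := by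
  refine (commute_scalar fun i j => ?_).symm
  simp only [superPerm, Matrix.of_apply]
  split_ifs
  · exact (Algebra.commutes _ _).symm
  · exact Commute.zero_right _

theorem leg₂_scalar {R : Type u} [Ring R] [Algebra ℂ R] (x : R) :
    leg₂ s (Matrix.scalar (Fin N) x) = Matrix.scalar (Fin N × Fin N) x := by
  rw [leg₂_def, leg₁_scalar, (commute_superPerm_scalar s x).eq, mul_assoc, superPerm_mul_self,
    mul_one]

theorem mapMatrix_scalar {R S : Type*} [Ring R] [Ring S] (f : R →+* S) (x : R) :
    f.mapMatrix (Matrix.scalar (Fin N) x) = Matrix.scalar (Fin N) (f x) := by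
  ext i j
  by_cases h : i = j <;> simp [h]

theorem firstLeg_scalar (x : PowerSeries A) :
    firstLeg (Matrix.scalar (Fin N) x) = Matrix.scalar (Fin N × Fin N) (PowerSeries.C x) := by
  rw [firstLeg, RingHom.comp_apply, mapMatrix_scalar, leg₁_scalar]

theorem secondLeg_scalar (x : PowerSeries A) :
    secondLeg s (Matrix.scalar (Fin N) x) =
      Matrix.scalar (Fin N × Fin N) (PowerSeries.map PowerSeries.C x) := by
  rw [secondLeg, RingHom.comp_apply, mapMatrix_scalar, leg₂_scalar]

/-- The matrix `u⁻¹`. -/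
abbrev uInv : Matrix (Fin N × Fin N) (Fin N × Fin N) (PowerSeries (PowerSeries A)) :=
  Matrix.scalar _ (PowerSeries.C PowerSeries.X)

/-- The matrix `v⁻¹`. -/
abbrev vInv : Matrix (Fin N × Fin N) (Fin N × Fin N) (PowerSeries (PowerSeries A)) :=
  Matrix.scalar _ PowerSeries.X

theorem commute_uInv (M : Matrix (Fin N × Fin N) (Fin N × Fin N) (PowerSeries (PowerSeries A))) :
    Commute M uInv :=
  (commute_scalar fun _ _ => commute_C_X _).symm

theorem commute_vInv (M : Matrix (Fin N × Fin N) (Fin N × Fin N) (PowerSeries (PowerSeries A))) :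
    Commute M vInv :=
  (commute_scalar fun _ _ => (PowerSeries.commute_X _).symm).symm

/-- The matrix `u⁻¹ v⁻¹ (u - v - P)`. -/
abbrev rMinus : Matrix (Fin N × Fin N) (Fin N × Fin N) (PowerSeries (PowerSeries A)) :=
  vInv - uInv - uInv * vInv * superPerm s

/-- The matrix `u⁻¹ v⁻¹ (u + v - P)`. -/
abbrev rPlus : Matrix (Fin N × Fin N) (Fin N × Fin N) (PowerSeries (PowerSeries A)) :=
  uInv + vInv - uInv * vInv * superPerm s

/-- The entries of `M` and `M'` supercommute. -/
def LegsCommute (M M' : Matrix (Fin N) (Fin N) (PowerSeries A)) : Prop :=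
  Commute (firstLeg M) (secondLeg s M')

variable {s}

theorem legsCommute_of_coeff {M M' : Matrix (Fin N) (Fin N) (PowerSeries A)}
    (h : ∀ i j k l p q, PowerSeries.coeff p (M i j) * PowerSeries.coeff q (M' k l) =
      sgn ((par s i + par s j) * (par s k + par s l)) •
        (PowerSeries.coeff q (M' k l) * PowerSeries.coeff p (M i j))) :
    LegsCommute s M M' := by
  refine commute_leg₁_leg₂ s fun i j k l => ?_
  ext q p
  rw [RingHom.mapMatrix_apply, RingHom.mapMatrix_apply, Matrix.map_apply, Matrix.map_apply,
    coeff_coeff_C_mul_map, PowerSeries.coeff_smul, PowerSeries.coeff_smul, coeff_coeff_map_mul_C, h]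

theorem legsCommute_scalar_left {x : PowerSeries A} {M : Matrix (Fin N) (Fin N) (PowerSeries A)}
    (h : ∀ i j p q, Commute (PowerSeries.coeff p x) (PowerSeries.coeff q (M i j))) :
    LegsCommute s (Matrix.scalar _ x) M := by
  refine legsCommute_of_coeff fun i j k l p q => ?_
  by_cases hij : i = j
  · subst hij
    simp [(h k l p q).eq, CharTwo.add_self_eq_zero]
  · simp [hij]

theorem legsCommute_scalar_right {x : PowerSeries A} {M : Matrix (Fin N) (Fin N) (PowerSeries A)}
    (h : ∀ i j p q, Commute (PowerSeries.coeff p (M i j)) (PowerSeries.coeff q x)) :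
    LegsCommute s M (Matrix.scalar _ x) := by
  refine legsCommute_of_coeff fun i j k l p q => ?_
  by_cases hkl : k = l
  · subst hkl
    simp [(h i j p q).eq, CharTwo.add_self_eq_zero]
  · simp [hkl]

/-- Restricted to constant matrices: the permutation exchanges the legs but not the variables `u`
and `v` attached to them. -/
theorem superPerm_mul_firstLeg {M : Matrix (Fin N) (Fin N) A} :
    superPerm s * firstLeg (PowerSeries.C.mapMatrix M) =
      secondLeg s (PowerSeries.C.mapMatrix M) * superPerm s := by
  have : (PowerSeries.C (R := PowerSeries A)).mapMatrix (PowerSeries.C.mapMatrix M) =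
      (PowerSeries.map PowerSeries.C).mapMatrix (PowerSeries.C.mapMatrix M) := by
    ext i j : 2
    simp
  rw [firstLeg, secondLeg, RingHom.comp_apply, RingHom.comp_apply, superPerm_mul_leg₁, this]

theorem superPerm_mul_secondLeg {M : Matrix (Fin N) (Fin N) A} :
    superPerm s * secondLeg s (PowerSeries.C.mapMatrix M) =
      firstLeg (PowerSeries.C.mapMatrix M) * superPerm s := by
  have h := congrArg (fun x => superPerm s * x * superPerm s) (superPerm_mul_firstLeg (s := s)
    (M := M))
  simp only [← mul_assoc, superPerm_mul_self, one_mul] at h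
  rw [h, mul_assoc _ (superPerm s) (superPerm s), superPerm_mul_self, mul_one]

end TwoLegs

/-! ## Factors of rank one -/

section RankOne

variable {A : Type u} [Ring A] [Algebra ℂ A] {N : ℕ} (s : Fin N → ℤˣ)

/-- The matrix with the entries `s i • F i j`. -/
def signedMat (F : Fin N → Fin N → A) : Matrix (Fin N) (Fin N) A :=
  Matrix.of fun i j => signC (s i) • F i j

/-- The matrix of constant series with the entries `s i • F i j`. -/
def signedSeriesMat (F : Fin N → Fin N → A) : Matrix (Fin N) (Fin N) (PowerSeries A) :=
  PowerSeries.C.mapMatrix (signedMat s F)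

/-- The factor `1 + 1 / (u - a) ⊗ Q`, where `Q` has the entries `s i • F i j`. -/
def laxMat (F : Fin N → Fin N → A) (a : A) : Matrix (Fin N) (Fin N) (PowerSeries A) :=
  1 + Matrix.scalar _ (invSub a) * signedSeriesMat s F

variable {s} {F F' : Fin N → Fin N → A}

/-- Summing over the intermediate index gives the superdimension `∑ₐ sₐ = 2ȷ`. This is the reason
for the shifts by `ȷ` in the factors. -/
theorem signedMat_mul_self (hF : ∀ i j k l, F i j * F k l = if j = k then F i l else 0) :
    signedMat s F * signedMat s F =
      Matrix.scalar _ (algebraMap ℂ A (2 * halfSdim s)) * signedMat s F := by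
  ext i j
  simp only [Matrix.scalar_apply, Matrix.diagonal_mul]
  simp only [signedMat, Matrix.mul_apply, Matrix.of_apply, smul_mul_smul_comm, hF, if_true,
    ← Finset.sum_smul, ← Algebra.smul_def, smul_smul, halfSdim, ← Finset.mul_sum]
  congr 1
  ring

/-- By the rule for matrix units, the product `Q₁ Q₂` has the entries of `Q₁` with the column
indices exchanged. The extra sign `s k` cancels `(-1)^(|k||k|)`, which leaves the sign of `P`. -/
theorem firstLeg_mul_secondLeg_signedSeriesMat
    (hF : ∀ i j k l, F i j * F k l = if j = k then F i l else 0) :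
    firstLeg (signedSeriesMat s F) * secondLeg s (signedSeriesMat s F) =
      firstLeg (signedSeriesMat s F) * superPerm s := by
  ext ⟨i, k⟩ ⟨j, l⟩ q p
  rw [mul_superPerm_apply]
  simp only [firstLeg, secondLeg, RingHom.comp_apply, leg₁_mul_leg₂_apply, leg₁_apply,
    RingHom.mapMatrix_apply, Matrix.map_apply, signedSeriesMat, signedMat, Matrix.of_apply,
    PowerSeries.map_C, ← map_mul, smul_mul_smul_comm, hF]
  by_cases h : k = j
  · subst h
    simp only [if_true, PowerSeries.coeff_smul, PowerSeries.coeff_C]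
    split_ifs
    · rw [PowerSeries.coeff_C, PowerSeries.coeff_C]
      split_ifs
      · simp only [smul_smul, signC_eq_sgn, ← sgn_add]
        congr 2
        linear_combination zmod_two_mul_self (par s k) + par s k * CharTwo.two_eq_zero (R := ZMod 2)
      · simp
    · simp
  · simp [h, Ne.symm h]

theorem secondLeg_mul_firstLeg_signedSeriesMat
    (hF : ∀ i j k l, F i j * F k l = if j = k then F i l else 0) :
    secondLeg s (signedSeriesMat s F) * firstLeg (signedSeriesMat s F) =
      secondLeg s (signedSeriesMat s F) * superPerm s := by
  have h := congrArg (fun x => superPerm s * x * superPerm s)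
    (firstLeg_mul_secondLeg_signedSeriesMat (s := s) hF)
  have h₁ := superPerm_mul_firstLeg (s := s) (M := signedMat s F)
  have h₂ := superPerm_mul_secondLeg (s := s) (M := signedMat s F)
  have hP := superPerm_mul_self (R := PowerSeries (PowerSeries A)) s
  simp only [signedSeriesMat] at h ⊢
  rw [← mul_assoc, h₁, mul_assoc (secondLeg s _), h₂, ← mul_assoc,
    ← mul_assoc (superPerm s) (firstLeg _), h₁] at h
  simpa only [mul_assoc, hP, mul_one] using h

theorem commute_scalar_signedSeriesMat {a : A} (h : ∀ i j, Commute a (F i j)) :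
    Commute (Matrix.scalar _ (invSub a)) (signedSeriesMat s F) :=
  commute_scalar fun i j => (commute_C_invSub (((h i j).smul_right _).symm)).symm

theorem legsCommute_invSub_left {a : A} (h : ∀ i j, Commute a (F i j)) :
    LegsCommute s (Matrix.scalar _ (invSub a)) (signedSeriesMat s F) := by
  refine legsCommute_scalar_left fun i j p q => commute_coeff_invSub ?_ p
  simp only [signedSeriesMat, signedMat, RingHom.mapMatrix_apply, Matrix.map_apply,
    Matrix.of_apply, PowerSeries.coeff_C]
  split_ifs
  · exact (h i j).smul_right _
  · exact Commute.zero_right _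

theorem legsCommute_invSub_right {a : A} (h : ∀ i j, Commute a (F i j)) :
    LegsCommute s (signedSeriesMat s F) (Matrix.scalar _ (invSub a)) := by
  refine legsCommute_scalar_right fun i j p q => (commute_coeff_invSub ?_ q).symm
  simp only [signedSeriesMat, signedMat, RingHom.mapMatrix_apply, Matrix.map_apply,
    Matrix.of_apply, PowerSeries.coeff_C]
  split_ifs
  · exact (h i j).smul_right _
  · exact Commute.zero_right _

theorem firstLeg_laxMat (a : A) : firstLeg (laxMat s F a) =
    1 + Matrix.scalar _ (PowerSeries.C (invSub a)) * firstLeg (signedSeriesMat s F) := by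
  rw [laxMat, map_add, map_one, map_mul, firstLeg_scalar]

theorem secondLeg_laxMat (a : A) : secondLeg s (laxMat s F a) =
    1 + Matrix.scalar _ (PowerSeries.map PowerSeries.C (invSub a)) *
      secondLeg s (signedSeriesMat s F) := by
  rw [laxMat, map_add, map_one, map_mul, secondLeg_scalar]

/-- The exchange relation `(u - v - P) M₁(u) M₂(v) = M₂(v) M₁(u) (u - v - P)`. -/
def Exchange (s : Fin N → ℤˣ) (M : Matrix (Fin N) (Fin N) (PowerSeries A)) : Prop :=
  rMinus s * firstLeg M * secondLeg s M = secondLeg s M * firstLeg M * rMinus s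

/-- The reflection relation `M₁(u) (u + v - P) M'₂(v) = M'₂(v) (u + v - P) M₁(u)`. -/
def Reflect (s : Fin N → ℤˣ) (M M' : Matrix (Fin N) (Fin N) (PowerSeries A)) : Prop :=
  firstLeg M * rPlus s * secondLeg s M' = secondLeg s M' * rPlus s * firstLeg M

/-- Both legs carry the same parameter `a`, so the difference of the resolvents is `(v - u) h k`. -/
theorem exchange_laxMat (hF : ∀ i j k l, F i j * F k l = if j = k then F i l else 0)
    {a : A} (h : ∀ i j, Commute a (F i j)) : Exchange s (laxMat s F a) := by
  rw [Exchange, firstLeg_laxMat, secondLeg_laxMat]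
  have c₁ := (commute_scalar_signedSeriesMat (s := s) h)
  have c₂₂ := c₁.map (secondLeg (A := A) s)
  have c₁₂ := legsCommute_invSub_left (s := s) h
  have c₂₁ := legsCommute_invSub_right (s := s) h
  rw [LegsCommute, firstLeg_scalar] at c₁₂
  rw [LegsCommute, secondLeg_scalar] at c₂₁
  rw [secondLeg_scalar] at c₂₂
  refine exchange_of_rank_one commute_uInv commute_vInv
    ((commute_C_map_invSub (Commute.refl a)).map (Matrix.scalar (Fin N × Fin N))).symm
    c₁₂.symm (commute_superPerm_scalar s _) c₂₁ c₂₂.symm (commute_superPerm_scalar s _)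
    superPerm_mul_firstLeg superPerm_mul_secondLeg (firstLeg_mul_secondLeg_signedSeriesMat hF)
    (secondLeg_mul_firstLeg_signedSeriesMat hF) ?_
  simp only [← map_mul, ← map_sub]
  rw [C_X_mul_X_mul_C_invSub (Commute.refl a), C_X_mul_X_mul_map_invSub a a,
    sub_sub_sub_cancel_right]

/-- The condition `a + b = 2ȷ` balances the partial fraction identity for `1/(u - a)` and `1/(v -
b)` against `Q² = 2ȷ Q`. -/
theorem reflect_laxMat (hF : ∀ i j k l, F i j * F k l = if j = k then F i l else 0)
    {a b : A} (hab : Commute a b) (ha : ∀ i j, Commute a (F i j)) (hb : ∀ i j, Commute b (F i j))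
    (h : a + b = algebraMap ℂ A (2 * halfSdim s)) : Reflect s (laxMat s F a) (laxMat s F b) := by
  rw [Reflect, firstLeg_laxMat, secondLeg_laxMat]
  have c₁₂ := legsCommute_invSub_left (s := s) ha
  have c₂₁ := legsCommute_invSub_right (s := s) hb
  rw [LegsCommute, firstLeg_scalar] at c₁₂
  rw [LegsCommute, secondLeg_scalar] at c₂₁
  have q := congrArg (PowerSeries.C (R := A)).mapMatrix (signedMat_mul_self (s := s) hF)
  rw [map_mul, map_mul, mapMatrix_scalar] at q
  have q₁ := congrArg firstLeg q
  have q₂ := congrArg (secondLeg s) q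
  rw [map_mul, map_mul, firstLeg_scalar] at q₁
  rw [map_mul, map_mul, secondLeg_scalar, PowerSeries.map_C] at q₂
  refine reflection_of_rank_one commute_uInv commute_vInv
    (fun x => (commute_scalar fun _ _ => commute_C_C (commute_C_C (Algebra.commutes _)) _).symm)
    ((commute_C_map_invSub hab).map (Matrix.scalar (Fin N × Fin N))).symm
    c₁₂.symm (commute_superPerm_scalar s _) c₂₁ (commute_superPerm_scalar s _)
    superPerm_mul_firstLeg superPerm_mul_secondLeg (firstLeg_mul_secondLeg_signedSeriesMat hF)
    (secondLeg_mul_firstLeg_signedSeriesMat hF) q₁ q₂ ?_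
  simp only [← map_mul, ← map_sub, ← map_add]
  rw [C_X_mul_X_mul_C_invSub hab, C_X_mul_X_mul_map_invSub a b, ← h]
  congr 1
  simp only [map_add, add_mul]
  abel

theorem coeff_laxMat (a : A) (i j : Fin N) (p : ℕ) :
    PowerSeries.coeff p (laxMat s F a i j) =
      if p = 0 then (if i = j then 1 else 0) else a ^ (p - 1) * signC (s i) • F i j := by
  rw [laxMat, Matrix.add_apply, Matrix.scalar_apply, Matrix.diagonal_mul, map_add,
    signedSeriesMat, RingHom.mapMatrix_apply, Matrix.map_apply, PowerSeries.coeff_mul_C,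
    coeff_invSub, Matrix.one_apply]
  rcases p with _ | p
  · by_cases h : i = j <;> simp [h]
  · by_cases h : i = j <;> simp [h, signedMat, PowerSeries.coeff_one]

theorem legsCommute_laxMat {a b : A} (hab : Commute a b)
    (hFF : ∀ i j k l, F i j * F' k l =
      sgn ((par s i + par s j) * (par s k + par s l)) • (F' k l * F i j))
    (haF' : ∀ i j, Commute a (F' i j)) (hbF : ∀ i j, Commute b (F i j)) :
    LegsCommute s (laxMat s F a) (laxMat s F' b) := by
  refine legsCommute_of_coeff fun i j k l p q => ?_
  rw [coeff_laxMat, coeff_laxMat]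
  by_cases hp : p = 0
  · by_cases hij : i = j
    · simp [hp, hij, CharTwo.add_self_eq_zero]
    · simp [hp, hij]
  by_cases hq : q = 0
  · by_cases hkl : k = l
    · simp [hq, hkl, CharTwo.add_self_eq_zero]
    · simp [hq, hkl]
  rw [if_neg hp, if_neg hq]
  have e₁ := ((haF' k l).pow_left (p - 1)).eq
  have e₂ := ((hbF i j).pow_left (q - 1)).eq
  have e₃ := (hab.pow_pow (p - 1) (q - 1)).eq
  simp only [mul_smul_comm, smul_mul_assoc]
  rw [smul_comm (signC (s k)), smul_comm (sgn _), smul_comm (sgn _)]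
  congr 2
  rw [mul_assoc, ← mul_assoc (F i j), ← e₂, mul_assoc (b ^ _), hFF, mul_assoc,
    ← mul_assoc (F' k l), ← e₁]
  simp only [mul_smul_comm]
  rw [← mul_assoc, ← mul_assoc, e₃]
  simp only [mul_assoc]

/-! ## Products -/

theorem LegsCommute.list_prod_left {L : List (Matrix (Fin N) (Fin N) (PowerSeries A))}
    {M' : Matrix (Fin N) (Fin N) (PowerSeries A)} (h : ∀ M ∈ L, LegsCommute s M M') :
    LegsCommute s L.prod M' := by
  rw [LegsCommute, map_list_prod]
  refine Commute.list_prod_left _ _ fun x hx => ?_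
  obtain ⟨M, hM, rfl⟩ := List.mem_map.1 hx
  exact h M hM

theorem LegsCommute.list_prod_right {L : List (Matrix (Fin N) (Fin N) (PowerSeries A))}
    {M : Matrix (Fin N) (Fin N) (PowerSeries A)} (h : ∀ M' ∈ L, LegsCommute s M M') :
    LegsCommute s M L.prod := by
  rw [LegsCommute, map_list_prod]
  refine Commute.list_prod_right _ _ fun x hx => ?_
  obtain ⟨M', hM, rfl⟩ := List.mem_map.1 hx
  exact h M' hM

theorem exchange_one : Exchange s (1 : Matrix (Fin N) (Fin N) (PowerSeries A)) := by
  simp [Exchange]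

theorem reflect_one : Reflect s (1 : Matrix (Fin N) (Fin N) (PowerSeries A)) 1 := by
  simp [Reflect]

/-- Fusion: `u - v - P` passes through one pair of factors after the other, because factors from
different sites in different legs commute. -/
theorem Exchange.mul {M M' : Matrix (Fin N) (Fin N) (PowerSeries A)} (h : Exchange s M)
    (h' : Exchange s M') (c : LegsCommute s M M') (c' : LegsCommute s M' M) :
    Exchange s (M * M') := by
  rw [Exchange] at h h' ⊢
  rw [LegsCommute] at c c'
  rw [map_mul, map_mul]
  generalize firstLeg M = a, secondLeg s M = b, firstLeg M' = a', secondLeg s M' = b',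
    rMinus (A := A) s = r at *
  calc r * (a * a') * (b * b') = r * a * (a' * b) * b' := by simp only [mul_assoc]
    _ = r * a * b * a' * b' := by rw [c'.eq]; simp only [mul_assoc]
    _ = b * a * (r * a' * b') := by rw [h]; simp only [mul_assoc]
    _ = b * (a * b') * a' * r := by rw [h']; simp only [mul_assoc]
    _ = b * b' * (a * a') * r := by rw [c.eq]; simp only [mul_assoc]

/-- The inner pair `M₂`, `M₃` is reflected first and the outer pair `M₁`, `M₄` afterwards. This
nesting is why the right factors of `ℬ^χ(u)` stand in the reversed order. -/
theorem Reflect.mul {M₁ M₂ M₃ M₄ : Matrix (Fin N) (Fin N) (PowerSeries A)} (h : Reflect s M₁ M₄)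
    (h' : Reflect s M₂ M₃) (c : LegsCommute s M₂ M₄) (c' : LegsCommute s M₁ M₃) :
    Reflect s (M₁ * M₂) (M₃ * M₄) := by
  rw [Reflect] at h h' ⊢
  rw [LegsCommute] at c c'
  rw [map_mul, map_mul]
  generalize firstLeg M₁ = a, firstLeg M₂ = b, secondLeg s M₃ = a', secondLeg s M₄ = b',
    rPlus (A := A) s = r at *
  calc a * b * r * (a' * b') = a * (b * r * a') * b' := by simp only [mul_assoc]
    _ = (a * a') * r * (b * b') := by rw [h']; simp only [mul_assoc]
    _ = a' * (a * r * b') * b := by rw [c.eq, c'.eq]; simp only [mul_assoc]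
    _ = a' * b' * r * (a * b) := by rw [h]; simp only [mul_assoc]

end RankOne

/-! ## The reflection equation -/

section Reflection

variable {A : Type u} [Ring A] [Algebra ℂ A] {N : ℕ} {s : Fin N → ℤˣ}

/-- The matrix `G + γ u⁻¹`. -/
def twistMat (ε : Fin N → ℤˣ) (γ : ℂ) : Matrix (Fin N) (Fin N) (PowerSeries A) :=
  Matrix.diagonal fun i =>
    PowerSeries.C (algebraMap ℂ _ (signC (ε i))) +
      PowerSeries.C (algebraMap ℂ _ γ) * PowerSeries.X

/-- The matrix `G`. -/
def signMat (ε : Fin N → ℤˣ) : Matrix (Fin N) (Fin N) A :=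
  Matrix.diagonal fun i => algebraMap ℂ _ (signC (ε i))

theorem twistMat_eq (ε : Fin N → ℤˣ) (γ : ℂ) : (twistMat ε γ : Matrix _ _ (PowerSeries A)) =
    PowerSeries.C.mapMatrix (signMat ε) +
      Matrix.scalar _ (PowerSeries.C (algebraMap ℂ A γ)) * Matrix.scalar _ PowerSeries.X := by
  rw [← map_mul]
  ext i j : 1
  by_cases h : i = j
  · subst h; simp [twistMat, signMat]
  · simp [twistMat, signMat, h]

theorem signMat_mul_self (ε : Fin N → ℤˣ) :
    signMat ε * signMat ε = (1 : Matrix (Fin N) (Fin N) A) := by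
  rw [signMat, Matrix.diagonal_mul_diagonal]
  simp only [← map_mul, signC_mul_self, map_one, Matrix.diagonal_one]

theorem coeff_twistMat_commutes (ε : Fin N → ℤˣ) (γ : ℂ) (i j : Fin N) (p : ℕ) (x : A) :
    Commute (PowerSeries.coeff p (twistMat (A := A) ε γ i j)) x := by
  rw [twistMat, Matrix.diagonal_apply]
  split_ifs
  · rw [map_add, PowerSeries.coeff_C_mul, PowerSeries.coeff_C, PowerSeries.coeff_X]
    refine Commute.add_left ?_ (Commute.mul_left (Algebra.commutes _ _) ?_) <;> split_ifs
    exacts [Algebra.commutes _ _, Commute.zero_left _, Commute.one_left _, Commute.zero_left _]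
  · rw [map_zero]; exact Commute.zero_left _

theorem twistMat_apply_ne (ε : Fin N → ℤˣ) (γ : ℂ) {i j : Fin N} (h : i ≠ j) :
    twistMat (A := A) ε γ i j = 0 := Matrix.diagonal_apply_ne _ h

theorem legsCommute_twistMat_left (ε : Fin N → ℤˣ) (γ : ℂ)
    (M : Matrix (Fin N) (Fin N) (PowerSeries A)) : LegsCommute s (twistMat ε γ) M := by
  refine legsCommute_of_coeff fun i j k l p q => ?_
  by_cases h : i = j
  · rw [(coeff_twistMat_commutes ε γ i j p _).eq, h, CharTwo.add_self_eq_zero, zero_mul, sgn_zero,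
      one_smul]
  · simp [twistMat_apply_ne ε γ h]

theorem legsCommute_twistMat_right (ε : Fin N → ℤˣ) (γ : ℂ)
    (M : Matrix (Fin N) (Fin N) (PowerSeries A)) : LegsCommute s M (twistMat ε γ) := by
  refine legsCommute_of_coeff fun i j k l p q => ?_
  by_cases h : k = l
  · rw [← (coeff_twistMat_commutes ε γ k l q _).eq, h, CharTwo.add_self_eq_zero, mul_zero,
      sgn_zero, one_smul]
  · simp [twistMat_apply_ne ε γ h]

/-- The reflection equation. -/
def ReflectionEq (s : Fin N → ℤˣ) (M : Matrix (Fin N) (Fin N) (PowerSeries A)) : Prop :=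
  rMinus s * firstLeg M * rPlus s * secondLeg s M =
    secondLeg s M * rPlus s * firstLeg M * rMinus s

theorem reflectionEq_twistMat (ε : Fin N → ℤˣ) (γ : ℂ) :
    ReflectionEq s (twistMat (A := A) ε γ) := by
  -- For `γ = 0` the matrix is the constant `G`, so this specializes to `G₁ G₂ = G₂ G₁`.
  have hc := legsCommute_twistMat_left (A := A) (s := s) ε 0 (twistMat ε 0)
  have e0 : (twistMat ε 0 : Matrix _ _ (PowerSeries A)) = PowerSeries.C.mapMatrix (signMat ε) := by
    simp [twistMat_eq]
  rw [e0] at hc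
  rw [ReflectionEq, twistMat_eq]
  simp only [map_add, map_mul, firstLeg_scalar, secondLeg_scalar, PowerSeries.map_C,
    PowerSeries.map_X]
  refine reflection_of_involution commute_uInv commute_vInv
    (fun x => (commute_scalar fun _ _ => commute_C_C (commute_C_C (Algebra.commutes _)) _).symm)
    superPerm_mul_firstLeg superPerm_mul_secondLeg (superPerm_mul_self s) hc.eq.symm ?_ ?_
  · rw [← map_mul, ← map_mul, signMat_mul_self, map_one, map_one]
  · rw [← map_mul, ← map_mul, signMat_mul_self, map_one, map_one]

theorem reflectionEq_of_factors {T S : Matrix (Fin N) (Fin N) (PowerSeries A)} (ε : Fin N → ℤˣ)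
    (γ : ℂ) (hT : Exchange s T) (hS : Exchange s S) (hTS : Reflect s T S) (hST : Reflect s S T) :
    ReflectionEq s (T * twistMat ε γ * S) := by
  rw [ReflectionEq]
  simp only [map_mul]
  exact reflection_of_factors hT hS hST hTS (reflectionEq_twistMat ε γ)
    (legsCommute_twistMat_left _ _ _) (legsCommute_twistMat_right _ _ _)
    (legsCommute_twistMat_right _ _ _) (legsCommute_twistMat_left _ _ _)

/-! ### Exchange and reflection relations for ordered products over the sites -/

section Lists

variable {κ : Type*} {t t' : κ → Matrix (Fin N) (Fin N) (PowerSeries A)} {L : List κ}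

theorem exchange_list_prod (hL : L.Nodup) (h : ∀ k, Exchange s (t k))
    (hc : ∀ k r, k ≠ r → LegsCommute s (t k) (t r)) : Exchange s (L.map t).prod := by
  induction L with
  | nil => simpa using exchange_one
  | cons k L ih =>
    obtain ⟨hk, hL⟩ := List.nodup_cons.1 hL
    rw [List.map_cons, List.prod_cons]
    refine (h k).mul (ih hL) (LegsCommute.list_prod_right ?_) (LegsCommute.list_prod_left ?_) <;>
    · intro M hM
      obtain ⟨r, hr, rfl⟩ := List.mem_map.1 hM
      have hkr : k ≠ r := fun e => hk (e ▸ hr)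
      first | exact hc _ _ hkr | exact hc _ _ hkr.symm

theorem reflect_list_prod (hL : L.Nodup) (h : ∀ k, Reflect s (t k) (t' k))
    (hc : ∀ k r, k ≠ r → LegsCommute s (t k) (t' r)) :
    Reflect s (L.map t).prod (L.map t').reverse.prod := by
  induction L with
  | nil => simpa using reflect_one
  | cons k L ih =>
    obtain ⟨hk, hL⟩ := List.nodup_cons.1 hL
    rw [List.map_cons, List.prod_cons, List.map_cons, List.reverse_cons, List.prod_append,
      List.prod_singleton]
    refine (h k).mul (ih hL) (LegsCommute.list_prod_left ?_) (LegsCommute.list_prod_right ?_)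
    · intro M hM
      obtain ⟨r, hr, rfl⟩ := List.mem_map.1 hM
      exact hc _ _ fun e => hk (e ▸ hr)
    · intro M hM
      obtain ⟨r, hr, rfl⟩ := List.mem_map.1 (List.mem_reverse.1 hM)
      exact hc _ _ fun e => hk (e ▸ hr)

theorem reflect_list_prod' (hL : L.Nodup) (h : ∀ k, Reflect s (t' k) (t k))
    (hc : ∀ k r, k ≠ r → LegsCommute s (t' k) (t r)) :
    Reflect s (L.map t').reverse.prod (L.map t).prod := by
  induction L with
  | nil => simpa using reflect_one
  | cons k L ih =>
    obtain ⟨hk, hL⟩ := List.nodup_cons.1 hL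
    rw [List.map_cons, List.map_cons, List.prod_cons, List.reverse_cons, List.prod_append,
      List.prod_singleton]
    refine (ih hL).mul (h k) (LegsCommute.list_prod_right ?_) (LegsCommute.list_prod_left ?_)
    · intro M hM
      obtain ⟨r, hr, rfl⟩ := List.mem_map.1 hM
      exact hc _ _ fun e => hk (e ▸ hr)
    · intro M hM
      obtain ⟨r, hr, rfl⟩ := List.mem_map.1 (List.mem_reverse.1 hM)
      exact hc _ _ fun e => hk (e ▸ hr)

end Lists

/-! ## The coefficients of the reflection equation -/

/-- The coefficient of `u⁻ᵖ v⁻ᵠ` in an entry of a matrix. -/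
def entryCoeff (x y : Fin N × Fin N) (p q : ℕ) :
    Matrix (Fin N × Fin N) (Fin N × Fin N) (PowerSeries (PowerSeries A)) →+ A where
  toFun X := PowerSeries.coeff p (PowerSeries.coeff q (X x y))
  map_zero' := by simp
  map_add' X Y := by simp

theorem entryCoeff_apply (x y : Fin N × Fin N) (p q : ℕ)
    (X : Matrix (Fin N × Fin N) (Fin N × Fin N) (PowerSeries (PowerSeries A))) :
    entryCoeff x y p q X = PowerSeries.coeff p (PowerSeries.coeff q (X x y)) := rfl

theorem coeff_uInv_pow_mul (a c : ℕ)
    (M : Matrix (Fin N × Fin N) (Fin N × Fin N) (PowerSeries (PowerSeries A)))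
    (x y : Fin N × Fin N) (p q : ℕ) :
    entryCoeff x y p q (uInv ^ a * vInv ^ c * M) =
      shift a c (fun p q => entryCoeff x y p q M) p q := by
  have e : uInv ^ a * vInv ^ c * M =
      Matrix.scalar _ (PowerSeries.C (PowerSeries.X ^ a) * PowerSeries.X ^ c) * M := by
    rw [map_mul, map_pow, map_pow, map_pow]
  simp only [e, entryCoeff_apply]
  rw [Matrix.scalar_apply, Matrix.diagonal_mul, mul_assoc, PowerSeries.coeff_C_mul,
    PowerSeries.coeff_X_pow_mul', shift]
  split_ifs with h₁ h₂ h₂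
  · rw [PowerSeries.coeff_X_pow_mul', if_pos h₂.2]
  · rw [PowerSeries.coeff_X_pow_mul', if_neg (by tauto), map_zero]
  · tauto
  · simp

theorem shift_smul (a c : ℕ) (x : ℂ) (F : ℕ → ℕ → A) (p q : ℕ) :
    shift a c (fun p q => x • F p q) p q = x • shift a c F p q := by
  rw [shift, shift]; split_ifs <;> simp

variable (M : Matrix (Fin N) (Fin N) (PowerSeries A))

/-- The sign `(-1)^(|j|(|k| + |l|))` is common to all four coefficient computations and drops out of
the final comparison. -/
theorem coeff_commutator_legs (i j k l : Fin N) (p q : ℕ) :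
    entryCoeff (i, k) (j, l) p q
      (firstLeg M * secondLeg s M - secondLeg s M * firstLeg M) =
    sgn (par s j * (par s k + par s l)) •
      superComm s (fun i j p => PowerSeries.coeff p (M i j)) i j k l p q := by
  rw [map_sub, entryCoeff_apply, entryCoeff_apply, firstLeg, secondLeg, RingHom.comp_apply, RingHom.comp_apply,
    leg₁_mul_leg₂_apply, leg₂_mul_leg₁_apply]
  simp only [PowerSeries.coeff_smul, RingHom.mapMatrix_apply, Matrix.map_apply,
    coeff_coeff_C_mul_map, coeff_coeff_map_mul_C]
  rw [superComm, smul_sub, smul_smul, ← sgn_add]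
  congr 3
  linear_combination -(par s j * (par s k + par s l)) * (CharTwo.two_eq_zero (R := ZMod 2))

theorem coeff_exchange_legs (i j k l : Fin N) (p q : ℕ) :
    entryCoeff (i, k) (j, l) p q
      (superPerm s * (firstLeg M * secondLeg s M) - secondLeg s M * firstLeg M * superPerm s) =
    (sgn (par s j * (par s k + par s l)) *
        sgn (par s i * par s j + par s i * par s k + par s j * par s k)) •
      exchangeTerm (fun i j p => PowerSeries.coeff p (M i j)) i j k l p q := by
  rw [map_sub, entryCoeff_apply, entryCoeff_apply, superPerm_mul_apply, mul_superPerm_apply, firstLeg, secondLeg,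
    RingHom.comp_apply, RingHom.comp_apply,
    leg₁_mul_leg₂_apply, leg₂_mul_leg₁_apply]
  simp only [PowerSeries.coeff_smul, RingHom.mapMatrix_apply, Matrix.map_apply,
    coeff_coeff_C_mul_map, coeff_coeff_map_mul_C]
  rw [exchangeTerm, smul_sub, smul_smul, smul_smul, ← sgn_add, ← sgn_add, ← sgn_add]
  congr 3
  · linear_combination -(par s j * par s k) * (CharTwo.two_eq_zero (R := ZMod 2))
  · linear_combination -(par s j * par s k) * (CharTwo.two_eq_zero (R := ZMod 2))

theorem coeff_coeff_mul_apply (M' : Matrix (Fin N) (Fin N) (PowerSeries A)) (i j : Fin N)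
    (p q : ℕ) :
    PowerSeries.coeff p (PowerSeries.coeff q
      ((PowerSeries.C.mapMatrix M * (PowerSeries.map PowerSeries.C).mapMatrix M') i j)) =
      ∑ a, PowerSeries.coeff p (M i a) * PowerSeries.coeff q (M' a j) := by
  simp only [Matrix.mul_apply, RingHom.mapMatrix_apply, Matrix.map_apply, map_sum,
    coeff_coeff_C_mul_map]

theorem coeff_coeff_mul_apply' (M' : Matrix (Fin N) (Fin N) (PowerSeries A)) (i j : Fin N)
    (p q : ℕ) :
    PowerSeries.coeff p (PowerSeries.coeff q
      (((PowerSeries.map PowerSeries.C).mapMatrix M * PowerSeries.C.mapMatrix M') i j)) =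
      ∑ a, PowerSeries.coeff q (M i a) * PowerSeries.coeff p (M' a j) := by
  simp only [Matrix.mul_apply, RingHom.mapMatrix_apply, Matrix.map_apply, map_sum,
    coeff_coeff_map_mul_C]

/-- Moving `P` to the right gives `M₁(u) P M₂(v) = (M(u) M(v))₁ P`: both matrices land in one leg,
whence the sum over `a` and the Kronecker delta. The second product lands in the second leg. -/
theorem coeff_contract_legs (i j k l : Fin N) (p q : ℕ) :
    entryCoeff (i, k) (j, l) p q
      (firstLeg M * superPerm s * secondLeg s M - secondLeg s M * superPerm s * firstLeg M) =
    (sgn (par s j * (par s k + par s l)) *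
        sgn (par s i * par s j + par s i * par s k + par s j * par s k)) •
      contractTerm (fun i j p => PowerSeries.coeff p (M i j)) i j k l p q := by
  simp only [firstLeg, secondLeg, RingHom.comp_apply]
  rw [mul_assoc (leg₁ _),
    superPerm_mul_leg₂, mul_assoc (leg₂ s _), superPerm_mul_leg₁, ← mul_assoc, ← mul_assoc,
    ← map_mul, ← map_mul, map_sub, entryCoeff_apply, entryCoeff_apply, mul_superPerm_apply, mul_superPerm_apply, leg₁_apply,
    leg₂_apply, contractTerm, smul_sub, ← sgn_add]
  congr 1
  · by_cases h : k = j
    · subst h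
      simp only [if_true, PowerSeries.coeff_smul, coeff_coeff_mul_apply]
      congr 2
      linear_combination -(par s i * par s k + par s k * par s k) *
        (CharTwo.two_eq_zero (R := ZMod 2))
    · simp [h]
  · by_cases h : i = l
    · subst h
      simp only [if_true, PowerSeries.coeff_smul, coeff_coeff_mul_apply', smul_smul, ← sgn_add]
      congr 2
      linear_combination -(par s j * par s k) * (CharTwo.two_eq_zero (R := ZMod 2))
    · simp [h]

/-- As `P M₁(u) P` is `M(u)` in the second leg, both terms are products within that leg, and the
first leg contributes `δ_{ij}`. -/
theorem coeff_diag_legs (i j k l : Fin N) (p q : ℕ) :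
    entryCoeff (i, k) (j, l) p q
      (superPerm s * firstLeg M * superPerm s * secondLeg s M -
        secondLeg s M * superPerm s * firstLeg M * superPerm s) =
    sgn (par s j * (par s k + par s l)) •
      diagTerm (fun i j p => PowerSeries.coeff p (M i j)) i j k l p q := by
  simp only [firstLeg, secondLeg, RingHom.comp_apply]
  rw [← leg₂_def, mul_assoc (leg₂ s _),
    mul_assoc (leg₂ s _), ← leg₂_def, ← map_mul, ← map_mul, map_sub,
    entryCoeff_apply, entryCoeff_apply, leg₂_apply, leg₂_apply, diagTerm]
  by_cases h : i = j
  · subst h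
    simp only [if_true, PowerSeries.coeff_smul, coeff_coeff_mul_apply', coeff_coeff_mul_apply,
      smul_sub]
  · simp [h]

/-- The scalar part is `(w - z)(w + z) = w² - z²`; the terms are sorted by the number and position
of the `P`. All monomials `zᵃ wᶜ`, trivial powers included, are displayed, so that each coefficient
is a `shift a c`. -/
theorem expand_reflectionEq {R : Type u} [Ring R] {z w b₁ b₂ P : R} (hz : ∀ x, Commute x z)
    (hw : ∀ x, Commute x w)
    (h : (w - z - z * w * P) * b₁ * (z + w - z * w * P) * b₂ =
      b₂ * (z + w - z * w * P) * b₁ * (w - z - z * w * P)) :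
    z ^ 0 * w ^ 2 * (b₁ * b₂ - b₂ * b₁) - z ^ 2 * w ^ 0 * (b₁ * b₂ - b₂ * b₁) =
      z ^ 1 * w ^ 2 * (P * (b₁ * b₂) - b₂ * b₁ * P)
        + z ^ 2 * w ^ 1 * (P * (b₁ * b₂) - b₂ * b₁ * P)
        + (z ^ 1 * w ^ 2 * (b₁ * P * b₂ - b₂ * P * b₁)
        - z ^ 2 * w ^ 1 * (b₁ * P * b₂ - b₂ * P * b₁))
        - z ^ 2 * w ^ 2 * (P * b₁ * P * b₂ - b₂ * P * b₁ * P) := by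
  simp only [pow_zero, pow_one, pow_two, mul_add, add_mul, mul_sub, sub_mul, mul_one, one_mul,
    mul_assoc, fun x => (hz w).left_comm x,
    fun x => (hz P).left_comm x, fun x => (hw P).left_comm x,
    (hz b₁).eq, fun x => (hz b₁).left_comm x, (hw b₁).eq, fun x => (hw b₁).left_comm x,
    (hz b₂).eq, fun x => (hz b₂).left_comm x, (hw b₂).eq, fun x => (hw b₂).left_comm x] at h ⊢
  linear_combination (norm := abel) h

theorem reflLHS_eq_reflRHS {M : Matrix (Fin N) (Fin N) (PowerSeries A)} (h : ReflectionEq s M)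
    (i j k l : Fin N) (p q : ℕ) :
    reflLHS s (fun i j p => PowerSeries.coeff p (M i j)) i j k l p q =
      reflRHS s (fun i j p => PowerSeries.coeff p (M i j)) i j k l p q := by
  have e := congrArg (entryCoeff (i, k) (j, l) p q)
    (expand_reflectionEq commute_uInv commute_vInv h)
  simp only [map_sub, map_add, coeff_uInv_pow_mul] at e
  simp only [← map_sub, coeff_commutator_legs, coeff_exchange_legs, coeff_contract_legs,
    coeff_diag_legs, shift_smul, mul_smul] at e
  simp only [← smul_sub, ← smul_add] at e
  -- The common sign squares to 1, so multiplying by it once more removes it.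
  have e' := congrArg (fun x => sgn (par s j * (par s k + par s l)) • x) e
  simp only [smul_add, smul_sub, smul_smul, ← mul_assoc, sgn_mul_self, one_smul, one_mul] at e'
  rw [reflLHS, reflRHS]
  simpa only [smul_add, smul_sub] using e'

end Reflection

/-! ## The product of the factors of rank one -/

section VertexProduct

variable {A : Type u} [Ring A] [Algebra ℂ A] {N l : ℕ}

/-- Super matrix units at `l` sites, and elements which commute with each other and with them. -/
structure IsVertexData (s : Fin N → ℤˣ) (E : Fin l → Fin N → Fin N → A) (Y : Fin l → A) :
    Prop where
  mul_same : ∀ k i j a b, E k i j * E k a b = if j = a then E k i b else 0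
  mul_ne : ∀ k r, k ≠ r → ∀ i j a b, E k i j * E r a b =
    sgn ((par s i + par s j) * (par s a + par s b)) • (E r a b * E k i j)
  comm_Y : ∀ k r, Commute (Y k) (Y r)
  comm_E : ∀ k r i j, Commute (Y k) (E r i j)

variable (s : Fin N → ℤˣ) (E : Fin l → Fin N → Fin N → A) (Y : Fin l → A)

/-- The factor at site `k` on the left of `G + γ u⁻¹`. -/
def leftFactor (k : Fin l) : Matrix (Fin N) (Fin N) (PowerSeries A) :=
  laxMat s (E k) (algebraMap ℂ A (halfSdim s) + Y k)

/-- The factor at site `k` on the right of `G + γ u⁻¹`. -/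
def rightFactor (k : Fin l) : Matrix (Fin N) (Fin N) (PowerSeries A) :=
  laxMat s (E k) (algebraMap ℂ A (halfSdim s) - Y k)

/-- The product of the left factors. -/
def leftProd : Matrix (Fin N) (Fin N) (PowerSeries A) :=
  ((List.finRange l).map (leftFactor s E Y)).prod

/-- The product of the right factors. -/
def rightProd : Matrix (Fin N) (Fin N) (PowerSeries A) :=
  ((List.finRange l).map (rightFactor s E Y)).reverse.prod

/-- The matrix `T(u) (G + γ u⁻¹) T(-u)⁻¹`. -/
def vertexMat (ε : Fin N → ℤˣ) (γ : ℂ) : Matrix (Fin N) (Fin N) (PowerSeries A) :=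
  leftProd s E Y * twistMat ε γ * rightProd s E Y

variable {s E Y}

theorem commute_algebraMap (c : ℂ) (x : A) : Commute (algebraMap ℂ A c) x :=
  Algebra.commutes c x

theorem commute_algebraMap_add {c : ℂ} {a x : A} (h : Commute a x) :
    Commute (algebraMap ℂ A c + a) x := (commute_algebraMap c x).add_left h

theorem commute_algebraMap_sub {c : ℂ} {a x : A} (h : Commute a x) :
    Commute (algebraMap ℂ A c - a) x := (commute_algebraMap c x).sub_left h

/-- The parameters `ȷ + Y k` and `ȷ - Y k` sum to `2ȷ`, so the left and right factors at one site
reflect each other; factors at different sites supercommute. The relations of the ordered products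
follow, in both orders of the legs. -/
theorem IsVertexData.reflectionEq (H : IsVertexData s E Y) (ε : Fin N → ℤˣ) (γ : ℂ) :
    ReflectionEq s (vertexMat s E Y ε γ) := by
  have hadd : ∀ k i j r, Commute (algebraMap ℂ A (halfSdim s) + Y k) (E r i j) :=
    fun k i j r => commute_algebraMap_add (H.comm_E k r i j)
  have hsub : ∀ k i j r, Commute (algebraMap ℂ A (halfSdim s) - Y k) (E r i j) :=
    fun k i j r => commute_algebraMap_sub (H.comm_E k r i j)
  have haa : ∀ k r, Commute (algebraMap ℂ A (halfSdim s) + Y k)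
      (algebraMap ℂ A (halfSdim s) + Y r) := fun k r =>
    commute_algebraMap_add (commute_algebraMap_add (H.comm_Y r k)).symm
  have has : ∀ k r, Commute (algebraMap ℂ A (halfSdim s) + Y k)
      (algebraMap ℂ A (halfSdim s) - Y r) := fun k r =>
    commute_algebraMap_add (commute_algebraMap_sub (H.comm_Y r k)).symm
  have hss : ∀ k r, Commute (algebraMap ℂ A (halfSdim s) - Y k)
      (algebraMap ℂ A (halfSdim s) - Y r) := fun k r =>
    commute_algebraMap_sub (commute_algebraMap_sub (H.comm_Y r k)).symm
  have h2 : ∀ k, algebraMap ℂ A (halfSdim s) + Y k + (algebraMap ℂ A (halfSdim s) - Y k) =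
      algebraMap ℂ A (2 * halfSdim s) := fun k => by
    rw [two_mul, map_add]; abel
  refine reflectionEq_of_factors ε γ ?_ ?_ ?_ ?_
  · exact exchange_list_prod (List.nodup_finRange l)
      (fun k => exchange_laxMat (H.mul_same k) fun i j => hadd k i j k)
      fun k r hkr => legsCommute_laxMat (haa k r) (H.mul_ne k r hkr) (fun i j => hadd k i j r)
        fun i j => hadd r i j k
  · rw [rightProd, ← List.map_reverse]
    exact exchange_list_prod (List.nodup_reverse.2 (List.nodup_finRange l))
      (fun k => exchange_laxMat (H.mul_same k) fun i j => hsub k i j k)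
      fun k r hkr => legsCommute_laxMat (hss k r) (H.mul_ne k r hkr) (fun i j => hsub k i j r)
        fun i j => hsub r i j k
  · exact reflect_list_prod (List.nodup_finRange l)
      (fun k => reflect_laxMat (H.mul_same k) (has k k) (fun i j => hadd k i j k)
        (fun i j => hsub k i j k) (h2 k))
      fun k r hkr => legsCommute_laxMat (has k r) (H.mul_ne k r hkr) (fun i j => hadd k i j r)
        fun i j => hsub r i j k
  · exact reflect_list_prod' (List.nodup_finRange l)
      (fun k => reflect_laxMat (H.mul_same k) (has k k).symm (fun i j => hsub k i j k)
        (fun i j => hadd k i j k) ((add_comm _ _).trans (h2 k)))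
      fun k r hkr => legsCommute_laxMat (has r k).symm (H.mul_ne k r hkr)
        (fun i j => hsub k i j r) fun i j => hadd r i j k

/-! ## Constant terms -/

theorem constantCoeff_laxMat (F : Fin N → Fin N → A) (a : A) :
    PowerSeries.constantCoeff.mapMatrix (laxMat s F a) = 1 := by
  ext i j
  rw [RingHom.mapMatrix_apply, Matrix.map_apply, ← PowerSeries.coeff_zero_eq_constantCoeff_apply,
    coeff_laxMat, if_pos rfl, Matrix.one_apply]

/-- Each factor of rank one is `1` modulo `u⁻¹`, so only `G` survives. This is needed because the
constant terms `δ_{ij} ε_i` of the series are prescribed and are not generators. -/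
theorem constantCoeff_vertexMat (ε : Fin N → ℤˣ) (γ : ℂ) :
    PowerSeries.constantCoeff.mapMatrix (vertexMat s E Y ε γ) = signMat ε := by
  have h : ∀ (L : List (Fin l)) (a : Fin l → A), (List.map PowerSeries.constantCoeff.mapMatrix
      (L.map fun k => laxMat s (E k) (a k))).prod = 1 := fun L a => by
    rw [List.map_map]
    refine List.prod_eq_one fun x hx => ?_
    obtain ⟨k, -, rfl⟩ := List.mem_map.1 hx
    exact constantCoeff_laxMat _ _
  have hL : PowerSeries.constantCoeff.mapMatrix (leftProd s E Y) = 1 := by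
    rw [leftProd, map_list_prod]
    exact h _ _
  have hR : PowerSeries.constantCoeff.mapMatrix (rightProd s E Y) = 1 := by
    rw [rightProd, ← List.map_reverse, map_list_prod]
    exact h _ _
  rw [vertexMat, map_mul, map_mul, hL, hR, one_mul, mul_one]
  ext i j
  by_cases hij : i = j
  · subst hij; simp [twistMat, signMat]
  · simp [twistMat, signMat, hij]

/-! ## Unitarity -/

/-- With `h = 1/(u - a)`, `k = 1/(u + b)` and `d = a + b`, the resolvent identity `h - k = d h k`
cancels the contribution of `Q² = d Q`. -/
theorem one_add_mul_one_sub {R : Type u} [Ring R] {h k d Q : R} (hd : ∀ x, Commute x d)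
    (hQ : Commute Q h) (kQ : Commute Q k) (QQ : Q * Q = d * Q)
    (E : h = k + k * (d * h)) (E' : Commute h k) :
    (1 + h * Q) * (1 - k * Q) = 1 ∧ (1 - k * Q) * (1 + h * Q) = 1 := by
  have E₁ := congrArg (· * Q) E
  have QQ' := fun x => congrArg (· * x) QQ
  simp only [mul_assoc] at QQ'
  simp only [mul_add, add_mul, mul_sub, sub_mul, mul_one, one_mul, mul_assoc,
    fun x => (hd h).left_comm x, fun x => (hd k).left_comm x,
    hQ.left_comm, kQ.left_comm, E'.left_comm, QQ] at E₁ ⊢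
  constructor <;> linear_combination (norm := abel) E₁

theorem negUHom_laxMat (F : Fin N → Fin N → A) (a : A) :
    negUHom.mapMatrix (laxMat s F a) =
      1 - Matrix.scalar _ (invSub (-a)) * signedSeriesMat s F := by
  have : negUHom.mapMatrix (signedSeriesMat s F) = signedSeriesMat s F := by
    ext i j : 1
    simp [signedSeriesMat]
  rw [laxMat, map_add, map_one, map_mul, mapMatrix_scalar, negUHom_invSub, this, map_neg, neg_mul,
    sub_eq_add_neg]

theorem laxMat_mul_negUHom {F : Fin N → Fin N → A}
    (hF : ∀ i j k l, F i j * F k l = if j = k then F i l else 0)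
    {a b : A} (hab : Commute a b) (ha : ∀ i j, Commute a (F i j)) (hb : ∀ i j, Commute b (F i j))
    (h : a + b = algebraMap ℂ A (2 * halfSdim s)) :
    laxMat s F a * negUHom.mapMatrix (laxMat s F b) = 1 ∧
      negUHom.mapMatrix (laxMat s F b) * laxMat s F a = 1 := by
  rw [negUHom_laxMat, laxMat]
  have q := congrArg (PowerSeries.C (R := A)).mapMatrix (signedMat_mul_self (s := s) hF)
  rw [map_mul, map_mul, mapMatrix_scalar] at q
  refine one_add_mul_one_sub
    (fun x => (commute_scalar fun _ _ => commute_C_C (Algebra.commutes _) _).symm)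
    (commute_scalar_signedSeriesMat ha).symm
    (commute_scalar_signedSeriesMat fun i j => (hb i j).neg_left).symm q ?_
    ((commute_invSub hab.neg_right).map (Matrix.scalar (Fin N)))
  rw [← map_mul, ← map_mul, ← map_add, ← h]
  -- Moving `1` past a resolvent, with `a = -b + (a + b)`, is the resolvent identity.
  have e := C_mul_invSub (τ := 1) (a := a) (b := -b) (c := a + b) (by simp)
  rw [map_one, one_mul, mul_one, mul_assoc] at e
  rw [← e]

theorem list_prod_mul_reverse_prod {R κ : Type*} [Monoid R] {t t' : κ → R}
    (h : ∀ k, t k * t' k = 1) (L : List κ) : (L.map t).prod * (L.map t').reverse.prod = 1 := by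
  induction L with
  | nil => simp
  | cons k L ih =>
    rw [List.map_cons, List.map_cons, List.prod_cons, List.reverse_cons, List.prod_append,
      List.prod_singleton, mul_assoc, ← mul_assoc _ _ (t' k), ih, one_mul, h]

theorem list_reverse_prod_mul_prod {R κ : Type*} [Monoid R] {t t' : κ → R}
    (h : ∀ k, t' k * t k = 1) (L : List κ) : (L.map t').reverse.prod * (L.map t).prod = 1 := by
  induction L with
  | nil => simp
  | cons k L ih =>
    rw [List.map_cons, List.map_cons, List.prod_cons, List.reverse_cons, List.prod_append,
      List.prod_singleton, mul_assoc, ← mul_assoc (t' k), h, one_mul, ih]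

theorem negUHom_mapMatrix_negUHom (M : Matrix (Fin N) (Fin N) (PowerSeries A)) :
    negUHom.mapMatrix (negUHom.mapMatrix M) = M := by
  ext i j : 1
  simp

theorem twistMat_mul_negUHom (ε : Fin N → ℤˣ) (γ : ℂ) :
    twistMat ε γ * negUHom.mapMatrix (twistMat ε γ) =
      Matrix.scalar (Fin N) (1 - PowerSeries.C (algebraMap ℂ A (γ * γ)) *
        (PowerSeries.X * PowerSeries.X)) := by
  have e : negUHom.mapMatrix (twistMat (A := A) ε γ) = Matrix.diagonal fun i =>
      PowerSeries.C (algebraMap ℂ _ (signC (ε i))) -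
        PowerSeries.C (algebraMap ℂ _ γ) * PowerSeries.X := by
    ext i j : 1
    by_cases hij : i = j
    · subst hij; simp [twistMat, sub_eq_add_neg]
    · simp [twistMat, hij]
  rw [e, twistMat, Matrix.diagonal_mul_diagonal, Matrix.scalar_apply]
  congr 1
  funext i
  have h1 : PowerSeries.C (algebraMap ℂ A (signC (ε i))) * PowerSeries.C (algebraMap ℂ A
      (signC (ε i))) = 1 := by
    rw [← map_mul, ← map_mul, signC_mul_self, map_one, map_one]
  have h2 : Commute (PowerSeries.C (algebraMap ℂ A (signC (ε i))))
      (PowerSeries.C (algebraMap ℂ A γ) * PowerSeries.X) := commute_C_C (Algebra.commutes _) _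
  have h3 : Commute (PowerSeries.C (algebraMap ℂ A γ)) PowerSeries.X := PowerSeries.commute_X _
  rw [add_mul, mul_sub, mul_sub, h1, h2.eq, map_mul, map_mul]
  have h4 : PowerSeries.C (algebraMap ℂ A γ) * PowerSeries.X *
      (PowerSeries.C (algebraMap ℂ A γ) * PowerSeries.X) =
      PowerSeries.C (algebraMap ℂ A γ) * PowerSeries.C (algebraMap ℂ A γ) *
        (PowerSeries.X * PowerSeries.X) := by
    simp only [mul_assoc, h3.left_comm]
  rw [h4]
  abel

/-- The right product is the inverse of the left one at `-u`. Hence the product telescopes to `T(u)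
G(u) G(-u) T(u)⁻¹` with `G(u) = G + γ u⁻¹`, and `G(u) G(-u) = 1 - γ² u⁻²` is central. -/
theorem IsVertexData.mul_negUHom (H : IsVertexData s E Y) (ε : Fin N → ℤˣ) (γ : ℂ) :
    vertexMat s E Y ε γ * negUHom.mapMatrix (vertexMat s E Y ε γ) =
      Matrix.scalar (Fin N) (1 - PowerSeries.C (algebraMap ℂ A (γ * γ)) *
        (PowerSeries.X * PowerSeries.X)) := by
  have h : ∀ k, leftFactor s E Y k * negUHom.mapMatrix (rightFactor s E Y k) = 1 ∧
      negUHom.mapMatrix (rightFactor s E Y k) * leftFactor s E Y k = 1 := fun k =>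
    laxMat_mul_negUHom (H.mul_same k)
      (commute_algebraMap_add (commute_algebraMap_sub (H.comm_Y k k)).symm)
      (fun i j => commute_algebraMap_add (H.comm_E k k i j))
      (fun i j => commute_algebraMap_sub (H.comm_E k k i j))
      (by rw [two_mul, map_add]; abel)
  have h' : ∀ k, rightFactor s E Y k * negUHom.mapMatrix (leftFactor s E Y k) = 1 := fun k => by
    have := congrArg negUHom.mapMatrix (h k).2
    rwa [map_mul, negUHom_mapMatrix_negUHom, map_one] at this
  have e₁ : rightProd s E Y * negUHom.mapMatrix (leftProd s E Y) = 1 := by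
    rw [leftProd, map_list_prod, List.map_map]
    exact list_reverse_prod_mul_prod h' _
  have e₂ : leftProd s E Y * negUHom.mapMatrix (rightProd s E Y) = 1 := by
    rw [rightProd, map_list_prod, List.map_reverse, List.map_map]
    exact list_prod_mul_reverse_prod (fun k => (h k).1) _
  have e₃ : ∀ M : Matrix (Fin N) (Fin N) (PowerSeries A),
      Commute (Matrix.scalar (Fin N) (1 - PowerSeries.C (algebraMap ℂ A (γ * γ)) *
        (PowerSeries.X * PowerSeries.X))) M := fun M =>
    commute_scalar fun i j => (Commute.one_left _).sub_left ((commute_C_C (Algebra.commutes _)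
      _).mul_left ((PowerSeries.commute_X _).symm.mul_left (PowerSeries.commute_X _).symm))
  rw [vertexMat, map_mul, map_mul]
  calc leftProd s E Y * twistMat ε γ * rightProd s E Y *
        (negUHom.mapMatrix (leftProd s E Y) * negUHom.mapMatrix (twistMat ε γ) *
          negUHom.mapMatrix (rightProd s E Y))
      = leftProd s E Y * twistMat ε γ * (rightProd s E Y * negUHom.mapMatrix (leftProd s E Y)) *
          negUHom.mapMatrix (twistMat ε γ) * negUHom.mapMatrix (rightProd s E Y) := by
        simp only [mul_assoc]
    _ = leftProd s E Y * (twistMat ε γ * negUHom.mapMatrix (twistMat ε γ)) *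
          negUHom.mapMatrix (rightProd s E Y) := by rw [e₁, mul_one]; simp only [mul_assoc]
    _ = _ := by rw [twistMat_mul_negUHom, (e₃ _).symm.eq, mul_assoc, e₂, mul_one]

/-! ## Normalization -/

/-- The series `(1 - γ u⁻¹)⁻¹`. -/
def geomSeries (A : Type u) [Ring A] [Algebra ℂ A] (γ : ℂ) : PowerSeries A :=
  PowerSeries.mk fun r => algebraMap ℂ A (γ ^ r)

theorem geomSeries_mul (γ : ℂ) :
    geomSeries A γ * (1 - PowerSeries.C (algebraMap ℂ A γ) * PowerSeries.X) = 1 := by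
  ext r
  rw [mul_sub, mul_one, ← mul_assoc, map_sub]
  rcases r with _ | r
  · simp [geomSeries]
  · rw [PowerSeries.coeff_succ_mul_X, PowerSeries.coeff_mul_C]
    simp [geomSeries, pow_succ, PowerSeries.coeff_one]

theorem commute_geomSeries (γ : ℂ) (f : PowerSeries A) : Commute (geomSeries A γ) f := by
  ext r
  rw [PowerSeries.coeff_mul, PowerSeries.coeff_mul, ← Finset.Nat.sum_antidiagonal_swap]
  refine Finset.sum_congr rfl fun pq _ => ?_
  simp only [geomSeries, PowerSeries.coeff_mk, Prod.fst_swap, Prod.snd_swap]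
  exact Algebra.commutes _ _

theorem commute_coeff_geomSeries (γ : ℂ) (r : ℕ) (x : A) :
    Commute (PowerSeries.coeff r (geomSeries A γ)) x := by
  rw [geomSeries, PowerSeries.coeff_mk]
  exact Algebra.commutes _ _

theorem geomSeries_mul_negUHom (γ : ℂ) :
    geomSeries A γ * negUHom (geomSeries A γ) *
      (1 - PowerSeries.C (algebraMap ℂ A (γ * γ)) * (PowerSeries.X * PowerSeries.X)) = 1 := by
  have h1 := geomSeries_mul (A := A) γ
  have h2 := congrArg negUHom h1
  rw [map_mul, map_sub, map_one, map_mul, negUHom_C, negUHom_X, mul_neg, sub_neg_eq_add] at h2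
  have h3 : Commute (PowerSeries.C (algebraMap ℂ A γ)) PowerSeries.X := PowerSeries.commute_X _
  have e : (1 - PowerSeries.C (algebraMap ℂ A (γ * γ)) * (PowerSeries.X * PowerSeries.X)) =
      (1 + PowerSeries.C (algebraMap ℂ A γ) * PowerSeries.X) *
        (1 - PowerSeries.C (algebraMap ℂ A γ) * PowerSeries.X) := by
    rw [map_mul, map_mul]
    simp only [add_mul, mul_sub, one_mul, mul_one, mul_assoc, h3.left_comm]
    rw [← h3.left_comm]
    abel
  rw [e, mul_assoc, ← mul_assoc (negUHom _), h2, one_mul, h1]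

/-- The normalized matrix `(1 - γ u⁻¹)⁻¹ T(u) (G + γ u⁻¹) T(-u)⁻¹`. -/
def normMat (s : Fin N → ℤˣ) (E : Fin l → Fin N → Fin N → A) (Y : Fin l → A) (ε : Fin N → ℤˣ)
    (γ : ℂ) : Matrix (Fin N) (Fin N) (PowerSeries A) :=
  Matrix.scalar (Fin N) (geomSeries A γ) * vertexMat s E Y ε γ

theorem IsVertexData.normMat_mul_negUHom (H : IsVertexData s E Y) (ε : Fin N → ℤˣ) (γ : ℂ) :
    normMat s E Y ε γ * negUHom.mapMatrix (normMat s E Y ε γ) = 1 := by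
  have hc : ∀ M : Matrix (Fin N) (Fin N) (PowerSeries A),
      Commute M (Matrix.scalar (Fin N) (negUHom (geomSeries A γ))) := fun M => by
    refine (commute_scalar fun i j => ?_).symm
    have := (commute_geomSeries γ (negUHom (M i j))).map negUHom
    rwa [negUHom_negUHom] at this
  rw [normMat, map_mul, mapMatrix_scalar, mul_assoc, ← mul_assoc (vertexMat _ _ _ _ _),
    (hc _).eq, mul_assoc (Matrix.scalar _ _), H.mul_negUHom, ← map_mul, ← map_mul, ← mul_assoc,
    geomSeries_mul_negUHom, map_one]

theorem constantCoeff_normMat (ε : Fin N → ℤˣ) (γ : ℂ) :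
    PowerSeries.constantCoeff.mapMatrix (normMat s E Y ε γ) = signMat ε := by
  rw [normMat, map_mul, mapMatrix_scalar, constantCoeff_vertexMat]
  simp [geomSeries, ← PowerSeries.coeff_zero_eq_constantCoeff_apply]

/-- The reflection equation is homogeneous: the central series in `u` and in `v` factor out of both
sides. -/
theorem IsVertexData.reflectionEq_normMat (H : IsVertexData s E Y) (ε : Fin N → ℤˣ) (γ : ℂ) :
    ReflectionEq s (normMat s E Y ε γ) := by
  have h := H.reflectionEq ε γ
  have c₁ : ∀ M : Matrix (Fin N × Fin N) (Fin N × Fin N) (PowerSeries (PowerSeries A)),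
      Commute (Matrix.scalar (Fin N × Fin N) (PowerSeries.C (geomSeries A γ))) M := fun M =>
    commute_scalar fun i j => commute_C_C (commute_geomSeries γ) _
  have c₂ : ∀ M : Matrix (Fin N × Fin N) (Fin N × Fin N) (PowerSeries (PowerSeries A)),
      Commute M (Matrix.scalar (Fin N × Fin N)
        (PowerSeries.map PowerSeries.C (geomSeries A γ))) := fun M => by
    refine (commute_scalar fun i j => ?_).symm
    ext q : 1
    rw [PowerSeries.coeff_mul, PowerSeries.coeff_mul, ← Finset.Nat.sum_antidiagonal_swap]
    refine Finset.sum_congr rfl fun pq _ => ?_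
    simp only [PowerSeries.coeff_map, Prod.fst_swap, Prod.snd_swap]
    rw [(commute_C_C (commute_coeff_geomSeries γ _) _).eq]
  rw [ReflectionEq] at h ⊢
  rw [normMat, map_mul, map_mul, firstLeg_scalar, secondLeg_scalar]
  generalize Matrix.scalar (Fin N × Fin N) (PowerSeries.C (geomSeries A γ)) = f,
    Matrix.scalar (Fin N × Fin N) (PowerSeries.map PowerSeries.C (geomSeries A γ)) = g,
    firstLeg (vertexMat s E Y ε γ) = b₁, secondLeg s (vertexMat s E Y ε γ) = b₂,
    rMinus (A := A) s = r, rPlus (A := A) s = k at *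
  have h' := congrArg (fun x => f * (g * x)) h
  simp only [mul_assoc] at h' ⊢
  simp only [← (c₁ r).left_comm, ← (c₁ b₂).left_comm, ← (c₁ k).left_comm, ← (c₁ g).left_comm,
    (c₂ r).left_comm, (c₂ b₁).left_comm, (c₂ k).left_comm]
  exact h'

end VertexProduct

/-! ## Homomorphisms from the twisted super Yangians -/

section YangianHom

variable {A : Type u} [Ring A] [Algebra ℂ A] {N : ℕ} {s ε : Fin N → ℤˣ}

theorem map_shift {B : Type v} [Ring B] [Algebra ℂ B] (f : B →ₐ[ℂ] A) (a c : ℕ)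
    (F : ℕ → ℕ → B) (p q : ℕ) : f (shift a c F p q) = shift a c (fun p q => f (F p q)) p q := by
  rw [shift, shift]; split_ifs <;> simp

theorem map_reflLHS {B : Type v} [Ring B] [Algebra ℂ B] (f : B →ₐ[ℂ] A)
    (b : Fin N → Fin N → ℕ → B) (i j k l : Fin N) (p q : ℕ) :
    f (reflLHS s b i j k l p q) = reflLHS s (fun i j p => f (b i j p)) i j k l p q := by
  have h : ∀ p q, f (superComm s b i j k l p q) =
      superComm s (fun i j p => f (b i j p)) i j k l p q := fun p q => by
    simp [superComm]
  simp only [reflLHS, map_sub, map_shift, h]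

theorem map_reflRHS {B : Type v} [Ring B] [Algebra ℂ B] (f : B →ₐ[ℂ] A)
    (b : Fin N → Fin N → ℕ → B) (i j k l : Fin N) (p q : ℕ) :
    f (reflRHS s b i j k l p q) = reflRHS s (fun i j p => f (b i j p)) i j k l p q := by
  have h₁ : ∀ p q, f (exchangeTerm b i j k l p q) =
      exchangeTerm (fun i j p => f (b i j p)) i j k l p q := fun p q => by
    simp [exchangeTerm]
  have h₂ : ∀ p q, f (contractTerm b i j k l p q) =
      contractTerm (fun i j p => f (b i j p)) i j k l p q := fun p q => by
    rw [contractTerm, contractTerm, map_sub, apply_ite f, apply_ite f]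
    simp
  have h₃ : ∀ p q, f (diagTerm b i j k l p q) =
      diagTerm (fun i j p => f (b i j p)) i j k l p q := fun p q => by
    rw [diagTerm, diagTerm, apply_ite f]
    simp
  simp only [reflRHS, map_sub, map_add, map_smul, map_shift, h₁, h₂, h₃]

theorem map_unitCoeff {B : Type v} [Ring B] [Algebra ℂ B] (f : B →ₐ[ℂ] A)
    (b : Fin N → Fin N → ℕ → B) (i j : Fin N) (r : ℕ) :
    f (unitCoeff b i j r) = unitCoeff (fun i j p => f (b i j p)) i j r := by
  simp [unitCoeff]

theorem unitCoeff_coeff (M : Matrix (Fin N) (Fin N) (PowerSeries A)) (i j : Fin N) (r : ℕ) :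
    unitCoeff (fun i j p => PowerSeries.coeff p (M i j)) i j r =
      PowerSeries.coeff r ((M * negUHom.mapMatrix M) i j) := by
  rw [Matrix.mul_apply, map_sum, unitCoeff]
  refine Finset.sum_congr rfl fun a _ => ?_
  rw [PowerSeries.coeff_mul]
  refine Finset.sum_congr rfl fun pq _ => ?_
  rw [RingHom.mapMatrix_apply, Matrix.map_apply, negUHom_apply, negU, PowerSeries.coeff_mk,
    ← mul_assoc, ← mul_assoc, ((Commute.neg_one_left _).pow_left _).eq]

/-- The homomorphism from the free algebra given by a matrix of series. -/
def freeHom (M : Matrix (Fin N) (Fin N) (PowerSeries A)) : FreeAlgebra ℂ (YGen N) →ₐ[ℂ] A :=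
  FreeAlgebra.lift ℂ fun g => PowerSeries.coeff (g.2.2 + 1) (M g.1 g.2.1)

theorem freeHom_genSeries {M : Matrix (Fin N) (Fin N) (PowerSeries A)}
    (h₀ : PowerSeries.constantCoeff.mapMatrix M = signMat ε) (i j : Fin N) (r : ℕ) :
    freeHom M (genSeries ε i j r) = PowerSeries.coeff r (M i j) := by
  rcases r with _ | r
  · have e := congrFun (congrFun h₀ i) j
    rw [RingHom.mapMatrix_apply, Matrix.map_apply,
      ← PowerSeries.coeff_zero_eq_constantCoeff_apply] at e
    rw [e, genSeries, AlgHom.commutes, signMat, Matrix.diagonal_apply]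
    split_ifs <;> simp
  · rw [genSeries, freeHom, FreeAlgebra.lift_ι_apply]

theorem freeHom_reflection {M : Matrix (Fin N) (Fin N) (PowerSeries A)}
    (h₀ : PowerSeries.constantCoeff.mapMatrix M = signMat ε) (h : ReflectionEq s M)
    (i j k l : Fin N) (p q : ℕ) :
    freeHom M (reflLHS s (genSeries ε) i j k l p q) =
      freeHom M (reflRHS s (genSeries ε) i j k l p q) := by
  simp only [map_reflLHS, map_reflRHS, freeHom_genSeries h₀]
  exact reflLHS_eq_reflRHS h i j k l p q

/-- The homomorphism from the extended twisted super Yangian given by a solution of the reflection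
equation. -/
def extHom (M : Matrix (Fin N) (Fin N) (PowerSeries A))
    (h₀ : PowerSeries.constantCoeff.mapMatrix M = signMat ε) (h : ReflectionEq s M) :
    ExtTwistedYangian s ε →ₐ[ℂ] A :=
  RingQuot.liftAlgHom ℂ ⟨freeHom M, fun _ _ hxy => by
    obtain ⟨i, j, k, l, p, q⟩ := hxy
    exact freeHom_reflection h₀ h i j k l p q⟩

theorem extHom_b {M : Matrix (Fin N) (Fin N) (PowerSeries A)}
    (h₀ : PowerSeries.constantCoeff.mapMatrix M = signMat ε) (h : ReflectionEq s M)
    (i j : Fin N) (r : ℕ) :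
    extHom M h₀ h (ExtTwistedYangian.b s ε i j r) = PowerSeries.coeff r (M i j) := by
  rw [extHom, ExtTwistedYangian.b, RingQuot.liftAlgHom_mkAlgHom_apply, freeHom_genSeries h₀]

/-- The homomorphism from the twisted super Yangian given by a unitary solution of the reflection
equation. -/
def twHom (M : Matrix (Fin N) (Fin N) (PowerSeries A))
    (h₀ : PowerSeries.constantCoeff.mapMatrix M = signMat ε) (h : ReflectionEq s M)
    (h' : M * negUHom.mapMatrix M = 1) : TwistedYangian s ε →ₐ[ℂ] A :=
  RingQuot.liftAlgHom ℂ ⟨freeHom M, fun _ _ hxy => by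
    cases hxy with
    | reflection i j k l p q => exact freeHom_reflection h₀ h i j k l p q
    | unitary i j r =>
      rw [map_unitCoeff, funext fun i => funext fun j => funext (freeHom_genSeries h₀ i j),
        unitCoeff_coeff, h', Matrix.one_apply, apply_ite (freeHom M), map_one, map_zero]
      by_cases hij : i = j <;> simp [hij, PowerSeries.coeff_one]⟩

theorem twHom_b {M : Matrix (Fin N) (Fin N) (PowerSeries A)}
    (h₀ : PowerSeries.constantCoeff.mapMatrix M = signMat ε) (h : ReflectionEq s M)
    (h' : M * negUHom.mapMatrix M = 1) (i j : Fin N) (r : ℕ) :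
    twHom M h₀ h h' (TwistedYangian.b s ε i j r) = PowerSeries.coeff r (M i j) := by
  rw [twHom, TwistedYangian.b, RingQuot.liftAlgHom_mkAlgHom_apply, freeHom_genSeries h₀]

end YangianHom

/-! ## Stability of the images of `σ_i - e` and `ς_l - e` -/

/-- The elements which preserve the right ideal generated by `d`. -/
def transporter {R : Type u} [Ring R] (d : R) : Submonoid R where
  carrier := {x | ∃ y, x * d = d * y}
  one_mem' := ⟨1, by simp⟩
  mul_mem' := by
    rintro x x' ⟨y, hy⟩ ⟨y', hy'⟩
    exact ⟨y * y', by rw [mul_assoc, hy', ← mul_assoc, hy, mul_assoc]⟩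

theorem mem_transporter_of_commute {R : Type u} [Ring R] {d x : R} (h : Commute d x) :
    x ∈ transporter d := ⟨x, h.eq.symm⟩

section Transport

variable {A : Type u} [Ring A] [Algebra ℂ A] {N l : ℕ} {s : Fin N → ℤˣ}
  {E : Fin l → Fin N → Fin N → A} {Y : Fin l → A}

theorem commute_scalar_C {x : A} {M : Matrix (Fin N) (Fin N) (PowerSeries A)}
    (h : ∀ i j p, Commute x (PowerSeries.coeff p (M i j))) :
    Commute (Matrix.scalar (Fin N) (PowerSeries.C x)) M :=
  commute_scalar fun i j => by
    ext p
    rw [PowerSeries.coeff_C_mul, PowerSeries.coeff_mul_C, (h i j p).eq]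

theorem commute_scalar_laxMat {x a : A} {F : Fin N → Fin N → A} (ha : Commute x a)
    (hF : ∀ i j, Commute x (F i j)) :
    Commute (Matrix.scalar (Fin N) (PowerSeries.C x)) (laxMat s F a) := by
  refine commute_scalar_C fun i j p => ?_
  rw [coeff_laxMat]
  split_ifs
  exacts [Commute.one_right _, Commute.zero_right _,
    (ha.pow_right _).mul_right ((hF i j).smul_right _)]

theorem commute_scalar_twistMat (x : A) (ε : Fin N → ℤˣ) (γ : ℂ) :
    Commute (Matrix.scalar (Fin N) (PowerSeries.C x)) (twistMat ε γ) :=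
  commute_scalar_C fun i j p => (coeff_twistMat_commutes ε γ i j p x).symm

theorem commute_scalar_leftFactor {x : A} {k : Fin l} (hY : Commute x (Y k))
    (hE : ∀ i j, Commute x (E k i j)) :
    Commute (Matrix.scalar (Fin N) (PowerSeries.C x)) (leftFactor s E Y k) :=
  commute_scalar_laxMat (commute_algebraMap_add hY.symm).symm hE

theorem commute_scalar_rightFactor {x : A} {k : Fin l} (hY : Commute x (Y k))
    (hE : ∀ i j, Commute x (E k i j)) :
    Commute (Matrix.scalar (Fin N) (PowerSeries.C x)) (rightFactor s E Y k) :=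
  commute_scalar_laxMat (commute_algebraMap_sub hY.symm).symm hE

theorem commute_scalar_C_signedSeriesMat {x : A} {F : Fin N → Fin N → A}
    (hF : ∀ i j, Commute x (F i j)) :
    Commute (Matrix.scalar (Fin N) (PowerSeries.C x)) (signedSeriesMat s F) := by
  refine commute_scalar fun i j => ?_
  simp only [signedSeriesMat, signedMat, RingHom.mapMatrix_apply, Matrix.map_apply,
    Matrix.of_apply]
  exact ((hF i j).smul_right _).map PowerSeries.C

/-- Two adjacent factors of rank one. -/
theorem laxMat_mul_mem_transporter {F₁ F₂ : Fin N → Fin N → A} {a₁ a₂ σ P : A} {e : ℂ}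
    (PP : P * P = 1) (PF₁ : ∀ i j, P * F₁ i j = F₂ i j * P) (PF₂ : ∀ i j, P * F₂ i j = F₁ i j * P)
    (FP : ∀ i j, F₁ i j * P = ∑ c, signC (s c) • (F₁ i c * F₂ c j))
    (σP : Commute σ P) (σF₁ : ∀ i j, Commute σ (F₁ i j)) (σF₂ : ∀ i j, Commute σ (F₂ i j))
    (aP₁ : Commute P a₁) (aP₂ : Commute P a₂) (aa : Commute a₁ a₂)
    (aF : ∀ i j, Commute a₂ (F₁ i j))
    (h₁ : σ * a₁ = a₂ * σ + algebraMap ℂ A e) (h₂ : σ * a₂ = a₁ * σ - algebraMap ℂ A e) :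
    laxMat s F₁ a₁ * laxMat s F₂ a₂ ∈
      transporter (Matrix.scalar (Fin N) (PowerSeries.C (σ * P - algebraMap ℂ A e))) := by
  have hs : ∀ {x y : PowerSeries A}, Commute x y →
      Commute (Matrix.scalar (Fin N) x) (Matrix.scalar (Fin N) y) := fun h =>
    h.map (Matrix.scalar (Fin N))
  have hC : ∀ {x y : A}, Commute x y → Commute (PowerSeries.C x) (PowerSeries.C y) := fun h =>
    h.map PowerSeries.C
  have hPF : ∀ F F' : Fin N → Fin N → A, (∀ i j, P * F i j = F' i j * P) →
      Matrix.scalar (Fin N) (PowerSeries.C P) * signedSeriesMat s F =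
        signedSeriesMat s F' * Matrix.scalar (Fin N) (PowerSeries.C P) := fun F F' h => by
    ext i j : 1
    simp [signedSeriesMat, signedMat, ← map_mul, h]
  have he : ∀ M, Commute M (Matrix.scalar (Fin N) (PowerSeries.C (algebraMap ℂ A e))) := fun M =>
    (commute_scalar fun _ _ => commute_C_C (Algebra.commutes _) _).symm
  have hE : ∀ (b₁ b₂ : A) (c : ℂ), Commute b₁ b₂ → σ * b₁ = b₂ * σ + algebraMap ℂ A c →
      PowerSeries.C σ * invSub b₁ = invSub b₂ * PowerSeries.C σ +
        PowerSeries.C (algebraMap ℂ A c) * (invSub b₁ * invSub b₂) := fun b₁ b₂ c hb h => by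
    rw [C_mul_invSub h, (commute_invSub hb).eq, ← mul_assoc,
      (commute_C_C (Algebra.commutes _) _ : Commute (PowerSeries.C (algebraMap ℂ A c)) _).eq]
  -- The witness is the right cofactor in `transport_of_swap`.
  refine ⟨laxMat s F₁ a₁ * laxMat s F₂ a₂ - Matrix.scalar _ (invSub a₁) *
    Matrix.scalar _ (invSub a₂) * (signedSeriesMat s F₁ - signedSeriesMat s F₂) *
      Matrix.scalar _ (PowerSeries.C P), ?_⟩
  rw [map_sub, map_sub, map_mul, map_mul]
  refine transport_of_swap he (hs (hC σP.symm)) (commute_scalar_C_signedSeriesMat σF₁).symm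
    (commute_scalar_C_signedSeriesMat σF₂).symm (hs (commute_invSub aa.symm))
    (hs (commute_C_invSub aP₁)) (hs (commute_C_invSub aP₂))
    (commute_scalar_signedSeriesMat aF).symm
    ?_ (hPF _ _ PF₁) (hPF _ _ PF₂) ?_ ?_ ?_
  · rw [← map_mul, ← map_mul, PP, map_one, map_one]
  -- Now `Q₁`, `Q₂` belong to two sites and share one auxiliary space: `Q₁ Q₂ = Q₁ P` is the matrix
  -- form of `FP`, with `P` the flip of the sites.
  · rw [← mapMatrix_scalar, signedSeriesMat, signedSeriesMat, ← map_mul, ← map_mul]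
    congr 1
    ext i j
    rw [Matrix.scalar_apply, Matrix.mul_diagonal, Matrix.mul_apply]
    simp only [signedMat, Matrix.of_apply, smul_mul_assoc, mul_smul_comm, FP, Finset.smul_sum]
    exact Finset.sum_congr rfl fun _ _ => smul_comm _ _ _
  · simp only [← map_mul, ← map_add]
    rw [hE _ _ _ aa h₁]
  · simp only [← map_mul, ← map_sub]
    rw [hE _ _ (-e) aa.symm (by rw [h₂, map_neg, sub_eq_add_neg]), (commute_invSub aa).eq]
    simp [sub_eq_add_neg]

/-- The two factors next to `G + γ u⁻¹`. -/
theorem laxMat_mul_twistMat_mul_laxMat_mem_transporter {F : Fin N → Fin N → A} {a b ς g : A}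
    {e γ : ℂ} (ε : Fin N → ℤˣ) (hF : ∀ i j k l, F i j * F k l = if j = k then F i l else 0)
    (gg : g * g = 1) (gF : ∀ i j, g * F i j = signC (ε i) • F i j)
    (Fg : ∀ i j, F i j * g = signC (ε j) • F i j)
    (ςg : Commute ς g) (ςF : ∀ i j, Commute ς (F i j)) (ga : Commute g a) (gb : Commute g b)
    (ab : Commute a b) (bF : ∀ i j, Commute b (F i j))
    (hab : a + b = algebraMap ℂ A (2 * halfSdim s))
    (h : ς * a = b * ς + algebraMap ℂ A (e * (2 * γ + varpiOne s ε)))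
    (h' : ς * b = a * ς - algebraMap ℂ A (e * (2 * γ + varpiOne s ε))) :
    laxMat s F a * twistMat ε γ * laxMat s F b ∈
      transporter (Matrix.scalar (Fin N) (PowerSeries.C (ς * g - algebraMap ℂ A e))) := by
  have hs : ∀ {x y : PowerSeries A}, Commute x y →
      Commute (Matrix.scalar (Fin N) x) (Matrix.scalar (Fin N) y) := fun h =>
    h.map (Matrix.scalar (Fin N))
  have hC : ∀ {x y : A}, Commute x y → Commute (PowerSeries.C x) (PowerSeries.C y) := fun h =>
    h.map PowerSeries.C
  have hc : ∀ (c : ℂ) (M : Matrix (Fin N) (Fin N) (PowerSeries A)),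
      Commute M (Matrix.scalar (Fin N) (PowerSeries.C (algebraMap ℂ A c))) := fun c M =>
    (commute_scalar fun _ _ => commute_C_C (Algebra.commutes _) _).symm
  have hc' : ∀ (c : ℂ) (x : PowerSeries A), Commute (PowerSeries.C (algebraMap ℂ A c)) x :=
    fun c => commute_C_C (Algebra.commutes _)
  have hX : ∀ M : Matrix (Fin N) (Fin N) (PowerSeries A),
      Commute M (Matrix.scalar (Fin N) PowerSeries.X) := fun M =>
    (commute_scalar fun _ _ => (PowerSeries.commute_X _).symm).symm
  have hG : ∀ x : PowerSeries A, Commute (PowerSeries.C.mapMatrix (signMat ε))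
      (Matrix.scalar (Fin N) x) := fun x => by
    refine (commute_scalar fun i j => ?_).symm
    rw [RingHom.mapMatrix_apply, Matrix.map_apply, signMat, Matrix.diagonal_apply]
    split_ifs
    · exact (hc' _ _).symm
    · rw [map_zero]; exact Commute.zero_right _
  have hE : ∀ (b₁ b₂ : A) (c : ℂ), Commute b₁ b₂ →
      ς * b₁ = b₂ * ς + algebraMap ℂ A (c * (2 * γ + varpiOne s ε)) →
      PowerSeries.C ς * invSub b₁ = invSub b₂ * PowerSeries.C ς +
        PowerSeries.C (algebraMap ℂ A c) * ((PowerSeries.C (algebraMap ℂ A γ) +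
          PowerSeries.C (algebraMap ℂ A γ) + PowerSeries.C (algebraMap ℂ A (varpiOne s ε))) *
            (invSub b₁ * invSub b₂)) := fun b₁ b₂ c hb h => by
    rw [C_mul_invSub h, (commute_invSub hb).eq, ← (hc' _ _).eq, two_mul]
    simp only [map_mul, map_add, mul_assoc]
  have qq : ∀ c : ℂ, signedMat s F * signedMat s F = Matrix.scalar _ (algebraMap ℂ A c) *
      signedMat s F → signedSeriesMat s F * signedSeriesMat s F =
        Matrix.scalar _ (PowerSeries.C (algebraMap ℂ A c)) * signedSeriesMat s F := fun c h => by
    rw [← mapMatrix_scalar, signedSeriesMat, ← map_mul, h, map_mul]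
  refine ⟨laxMat s F a * twistMat ε γ * laxMat s F b -
    (Matrix.scalar (Fin N) (PowerSeries.C (algebraMap ℂ A γ)) +
      Matrix.scalar (Fin N) (PowerSeries.C (algebraMap ℂ A γ)) +
      Matrix.scalar (Fin N) (PowerSeries.C (algebraMap ℂ A (varpiOne s ε)))) *
    (Matrix.scalar (Fin N) (invSub a) * Matrix.scalar (Fin N) (invSub b)) *
    (signedSeriesMat s F - Matrix.scalar (Fin N) (PowerSeries.C g) * signedSeriesMat s F *
      Matrix.scalar (Fin N) (PowerSeries.C g)), ?_⟩
  rw [twistMat_eq, map_sub, map_sub, map_mul, map_mul]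
  refine transport_of_sign (ϖ := Matrix.scalar (Fin N) (PowerSeries.C (algebraMap ℂ A
      (varpiOne s ε)))) (d := Matrix.scalar (Fin N) (PowerSeries.C (algebraMap ℂ A
      (2 * halfSdim s)))) (hc e) hX (hc γ) (hc _) (hc _) (hs (hC ςg.symm))
    (commute_scalar_C_signedSeriesMat ςF).symm (hG _) (hG _) (hG _)
    (hs (commute_invSub ab.symm)) (hs (commute_C_invSub ga)) (hs (commute_C_invSub gb))
    (commute_scalar_signedSeriesMat bF).symm
    ?_ ?_ ?_ (qq _ (signedMat_mul_self hF)) ?_ ?_ ?_ ?_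
  · rw [← map_mul, ← map_mul, gg, map_one, map_one]
  -- `G Q = g Q`: on the auxiliary space and at the site alike, row `i` is multiplied by `ε_i`.
  · rw [← mapMatrix_scalar, signedSeriesMat, ← map_mul, ← map_mul]
    congr 1
    ext i j
    rw [Matrix.scalar_apply, Matrix.diagonal_mul, signMat, Matrix.diagonal_mul,
      ← Algebra.smul_def]
    simp only [signedMat, Matrix.of_apply, mul_smul_comm, gF]
    rw [smul_comm]
  · rw [← mapMatrix_scalar, signedSeriesMat, ← map_mul, ← map_mul]
    congr 1
    ext i j
    rw [Matrix.scalar_apply, Matrix.mul_diagonal, signMat, Matrix.mul_diagonal,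
      ← Algebra.commutes, ← Algebra.smul_def]
    simp only [signedMat, Matrix.of_apply, smul_mul_assoc, Fg]
    rw [smul_comm]
  -- In `Q g Q` the sum over the intermediate index is `∑ₐ sₐ εₐ = ϖ₁`.
  · rw [← mapMatrix_scalar, ← mapMatrix_scalar, signedSeriesMat, ← map_mul, ← map_mul, ← map_mul]
    congr 1
    ext i j
    rw [Matrix.scalar_apply, Matrix.scalar_apply, Matrix.mul_apply, Matrix.diagonal_mul]
    simp only [Matrix.diagonal_mul, signedMat, Matrix.of_apply, mul_smul_comm, gF, smul_mul_assoc,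
      smul_smul, hF, if_true, ← Finset.sum_smul, ← Algebra.smul_def]
    congr 1
    rw [varpiOne, Finset.mul_sum]
    exact Finset.sum_congr rfl fun a _ => by ring
  · simp only [← map_mul, ← map_add]
    rw [hE _ _ _ ab h]
    simp only [map_add, map_mul]
  · simp only [← map_mul, ← map_sub, ← map_add]
    rw [hE _ _ (-e) ab.symm (by rw [h', neg_mul, map_neg, sub_eq_add_neg]), (commute_invSub ab).eq]
    simp [sub_eq_add_neg]
  · have ea := mul_invSub a
    have eb := mul_invSub b
    have ha : PowerSeries.X * invSub b = invSub a * invSub b -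
        PowerSeries.C a * (PowerSeries.X * (invSub a * invSub b)) := by
      conv_lhs => rw [← ea]
      simp only [sub_mul, one_mul, mul_assoc]
    have hb : PowerSeries.X * invSub a = invSub a * invSub b -
        PowerSeries.C b * (PowerSeries.X * (invSub a * invSub b)) := by
      conv_lhs => rw [← eb]
      rw [(commute_invSub ab).eq]
      simp only [sub_mul, one_mul, mul_assoc]
    simp only [← map_mul, ← map_sub, ← map_add]
    rw [ha, hb, ← hab]
    congr 1
    rw [map_add, add_mul]
    abel

end Transport

/-! ### The full matrix preserves the relations of the quotient -/

section VertexTransport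

variable {A : Type u} [Ring A] [Algebra ℂ A] {N l : ℕ}

/-- The flip `σ ⊗ P` of the sites `i`, `j`. -/
structure IsFlip (s : Fin N → ℤˣ) (E : Fin l → Fin N → Fin N → A) (Y : Fin l → A) (i j : Fin l)
    (σ P : A) (e : ℂ) : Prop where
  P_mul_P : P * P = 1
  P_mul_left : ∀ a b, P * E i a b = E j a b * P
  P_mul_right : ∀ a b, P * E j a b = E i a b * P
  left_mul_P : ∀ a b, E i a b * P = ∑ c, signC (s c) • (E i a c * E j c b)
  right_mul_P : ∀ a b, E j a b * P = ∑ c, signC (s c) • (E j a c * E i c b)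
  P_far : ∀ k, k ≠ i → k ≠ j → ∀ a b, Commute P (E k a b)
  P_Y : ∀ k, Commute P (Y k)
  σ_P : Commute σ P
  σ_E : ∀ k a b, Commute σ (E k a b)
  σ_Y_left : σ * Y i = Y j * σ + algebraMap ℂ A e
  σ_Y_right : σ * Y j = Y i * σ - algebraMap ℂ A e
  σ_Y_far : ∀ k, k ≠ i → k ≠ j → Commute σ (Y k)

/-- The sign change `ς ⊗ g` at the site `k`. -/
structure IsSignChange (s ε : Fin N → ℤˣ) (E : Fin l → Fin N → Fin N → A) (Y : Fin l → A)
    (k : Fin l) (ς g : A) (e γ : ℂ) : Prop where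
  g_mul_g : g * g = 1
  g_mul : ∀ a b, g * E k a b = signC (ε a) • E k a b
  mul_g : ∀ a b, E k a b * g = signC (ε b) • E k a b
  g_far : ∀ r, r ≠ k → ∀ a b, Commute g (E r a b)
  g_Y : ∀ r, Commute g (Y r)
  ς_g : Commute ς g
  ς_E : ∀ r a b, Commute ς (E r a b)
  ς_Y : ς * Y k = -(Y k * ς) + algebraMap ℂ A (e * (2 * γ + varpiOne s ε))
  ς_Y_far : ∀ r, r ≠ k → Commute ς (Y r)

variable {s ε : Fin N → ℤˣ} {E : Fin l → Fin N → Fin N → A} {Y : Fin l → A}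

theorem exists_finRange_eq_of_adjacent {i j : Fin l} (h : i.val + 1 = j.val) :
    ∃ L₁ L₂ : List (Fin l), List.finRange l = L₁ ++ i :: j :: L₂ := by
  refine ⟨(List.finRange l).take i, (List.finRange l).drop (i + 2), ?_⟩
  conv_lhs => rw [← List.take_append_drop i (List.finRange l)]
  rw [List.drop_eq_getElem_cons (by simp), List.drop_eq_getElem_cons (by simp [h])]
  have := j.2
  simp [h]
  omega

theorem exists_finRange_eq_of_last {k : Fin l} (h : k.val + 1 = l) :
    ∃ L : List (Fin l), List.finRange l = L ++ [k] := by
  refine ⟨(List.finRange l).take k, ?_⟩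
  conv_lhs => rw [← List.take_append_drop k (List.finRange l)]
  rw [List.drop_eq_getElem_cons (by simp)]
  simp [h]

theorem list_map_prod_mem_transporter {R κ : Type*} [Ring R] {d : R} {L : List κ} {t : κ → R}
    (h : ∀ k ∈ L, Commute d (t k)) : (L.map t).prod ∈ transporter d :=
  Submonoid.list_prod_mem _ fun _ hx => by
    obtain ⟨k, hk, rfl⟩ := List.mem_map.1 hx
    exact mem_transporter_of_commute (h k hk)

theorem list_map_reverse_prod_mem_transporter {R κ : Type*} [Ring R] {d : R} {L : List κ}
    {t : κ → R} (h : ∀ k ∈ L, Commute d (t k)) : (L.map t).reverse.prod ∈ transporter d := by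
  rw [← List.map_reverse]
  exact list_map_prod_mem_transporter fun k hk => h k (List.mem_reverse.1 hk)

theorem algebraMap_add_algebraMap_sub (c : ℂ) (y : A) :
    algebraMap ℂ A c + y + (algebraMap ℂ A c - y) = algebraMap ℂ A (2 * c) := by
  rw [two_mul, map_add]; abel

/-- Factors at other sites and `G + γ u⁻¹` commute with `σ P - e`. The left and the right product
each contain the factors of `i` and `j` as one adjacent block, to which `laxMat_mul_mem_transporter`
applies. -/
theorem IsFlip.vertexMat_mem_transporter (H : IsVertexData s E Y) {i j : Fin l} {σ P : A} {e : ℂ}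
    (F : IsFlip s E Y i j σ P e) (hij : i.val + 1 = j.val) (ε : Fin N → ℤˣ) (γ : ℂ) :
    vertexMat s E Y ε γ ∈
      transporter (Matrix.scalar (Fin N) (PowerSeries.C (σ * P - algebraMap ℂ A e))) := by
  obtain ⟨L₁, L₂, hL⟩ := exists_finRange_eq_of_adjacent hij
  have hn := List.nodup_finRange l
  rw [hL] at hn
  have h₁ : ∀ k ∈ L₁ ++ L₂, k ≠ i ∧ k ≠ j := by
    intro k hk
    have := (List.perm_middle.nodup_iff.1 hn)
    rw [List.nodup_cons] at this
    have h2 := (List.perm_middle.nodup_iff.1 this.2)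
    rw [List.nodup_cons] at h2
    refine ⟨?_, ?_⟩
    · rintro rfl
      refine this.1 ?_
      simp only [List.mem_append, List.mem_cons] at hk ⊢
      tauto
    · rintro rfl
      exact h2.1 hk
  have hE : ∀ k, k ≠ i → k ≠ j → ∀ a b, Commute (σ * P - algebraMap ℂ A e) (E k a b) :=
    fun k hi hj a b => ((F.σ_E k a b).mul_left (F.P_far k hi hj a b)).sub_left
      (commute_algebraMap _ _)
  have hY : ∀ k, k ≠ i → k ≠ j → Commute (σ * P - algebraMap ℂ A e) (Y k) :=
    fun k hi hj => ((F.σ_Y_far k hi hj).mul_left (F.P_Y k)).sub_left (commute_algebraMap _ _)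
  have hl : ∀ k ∈ L₁ ++ L₂, Commute (Matrix.scalar (Fin N)
      (PowerSeries.C (σ * P - algebraMap ℂ A e))) (leftFactor s E Y k) := fun k hk =>
    commute_scalar_leftFactor (hY k (h₁ k hk).1 (h₁ k hk).2) (hE k (h₁ k hk).1 (h₁ k hk).2)
  have hr : ∀ k ∈ L₁ ++ L₂, Commute (Matrix.scalar (Fin N)
      (PowerSeries.C (σ * P - algebraMap ℂ A e))) (rightFactor s E Y k) := fun k hk =>
    commute_scalar_rightFactor (hY k (h₁ k hk).1 (h₁ k hk).2) (hE k (h₁ k hk).1 (h₁ k hk).2)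
  have hσ : Commute σ (algebraMap ℂ A (halfSdim s)) := (commute_algebraMap _ _).symm
  have hP : Commute P (algebraMap ℂ A (halfSdim s)) := (commute_algebraMap _ _).symm
  rw [vertexMat, leftProd, rightProd, hL]
  refine Submonoid.mul_mem _ (Submonoid.mul_mem _ ?_ ?_) ?_
  · rw [List.map_append, List.map_cons, List.map_cons, List.prod_append, List.prod_cons,
      List.prod_cons, ← mul_assoc (leftFactor s E Y i)]
    refine Submonoid.mul_mem _ (list_map_prod_mem_transporter fun k hk =>
      hl k (List.mem_append_left _ hk)) (Submonoid.mul_mem _ ?_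
        (list_map_prod_mem_transporter fun k hk => hl k (List.mem_append_right _ hk)))
    refine laxMat_mul_mem_transporter F.P_mul_P F.P_mul_left F.P_mul_right F.left_mul_P F.σ_P
      (F.σ_E i) (F.σ_E j) (hP.add_right (F.P_Y i)) (hP.add_right (F.P_Y j))
      (commute_algebraMap_add (commute_algebraMap_add (H.comm_Y j i)).symm)
      (fun a b => commute_algebraMap_add (H.comm_E j i a b)) ?_ ?_
    · rw [mul_add, add_mul, hσ.eq, F.σ_Y_left, add_assoc]
    · rw [mul_add, add_mul, hσ.eq, F.σ_Y_right, add_sub_assoc]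
  · exact mem_transporter_of_commute (commute_scalar_twistMat _ _ _)
  -- In the reversed product `j` precedes `i`. The parameters `ȷ - Y` also change the sign of the
  -- commutation with `σ`, so the two sites exchange roles and `e` keeps its sign.
  · have e : ((L₁ ++ i :: j :: L₂).map (rightFactor s E Y)).reverse.prod =
        (L₂.map (rightFactor s E Y)).reverse.prod *
          ((rightFactor s E Y j * rightFactor s E Y i) *
            (L₁.map (rightFactor s E Y)).reverse.prod) := by
      simp only [List.map_append, List.map_cons, List.reverse_append, List.reverse_cons,
        List.prod_append, List.prod_singleton, mul_assoc]
    rw [e]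
    refine Submonoid.mul_mem _ (list_map_reverse_prod_mem_transporter fun k hk =>
      hr k (List.mem_append_right _ hk)) (Submonoid.mul_mem _ ?_
        (list_map_reverse_prod_mem_transporter fun k hk => hr k (List.mem_append_left _ hk)))
    refine laxMat_mul_mem_transporter F.P_mul_P F.P_mul_right F.P_mul_left F.right_mul_P F.σ_P
      (F.σ_E j) (F.σ_E i) (hP.sub_right (F.P_Y j)) (hP.sub_right (F.P_Y i))
      (commute_algebraMap_sub (commute_algebraMap_sub (H.comm_Y i j)).symm)
      (fun a b => commute_algebraMap_sub (H.comm_E i j a b)) ?_ ?_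
    · rw [mul_sub, sub_mul, hσ.eq, F.σ_Y_right]
      abel
    · rw [mul_sub, sub_mul, hσ.eq, F.σ_Y_left]
      abel

/-- The factors of the last site are the neighbours of `G + γ u⁻¹` on both sides and form a block
with it; all other factors commute with `ς g - e`. -/
theorem IsSignChange.vertexMat_mem_transporter (H : IsVertexData s E Y) {k : Fin l} {ς g : A}
    {e γ : ℂ} (F : IsSignChange s ε E Y k ς g e γ) (hk : k.val + 1 = l) :
    vertexMat s E Y ε γ ∈
      transporter (Matrix.scalar (Fin N) (PowerSeries.C (ς * g - algebraMap ℂ A e))) := by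
  obtain ⟨L, hL⟩ := exists_finRange_eq_of_last hk
  have hn := List.nodup_finRange l
  rw [hL] at hn
  have h₁ : ∀ r ∈ L, r ≠ k := by
    rintro r hr rfl
    have := List.disjoint_of_nodup_append hn
    exact this hr (List.mem_singleton_self r)
  have hE : ∀ r, r ≠ k → ∀ a b, Commute (ς * g - algebraMap ℂ A e) (E r a b) :=
    fun r hr a b => ((F.ς_E r a b).mul_left (F.g_far r hr a b)).sub_left (commute_algebraMap _ _)
  have hY : ∀ r, r ≠ k → Commute (ς * g - algebraMap ℂ A e) (Y r) :=
    fun r hr => ((F.ς_Y_far r hr).mul_left (F.g_Y r)).sub_left (commute_algebraMap _ _)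
  have hς : Commute ς (algebraMap ℂ A (halfSdim s)) := (commute_algebraMap _ _).symm
  have hg : Commute g (algebraMap ℂ A (halfSdim s)) := (commute_algebraMap _ _).symm
  rw [vertexMat, leftProd, rightProd, hL, List.map_append, List.map_append, List.reverse_append,
    List.prod_append, List.prod_append, List.map_singleton, List.map_singleton,
    List.reverse_singleton, List.prod_singleton, List.prod_singleton, mul_assoc, mul_assoc,
    ← mul_assoc (twistMat ε γ), ← mul_assoc (leftFactor s E Y k), ← mul_assoc (leftFactor s E Y k)]
  refine Submonoid.mul_mem _ (list_map_prod_mem_transporter fun r hr =>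
      commute_scalar_leftFactor (hY r (h₁ r hr)) (hE r (h₁ r hr)))
    (Submonoid.mul_mem _ ?_ (list_map_reverse_prod_mem_transporter fun r hr =>
      commute_scalar_rightFactor (hY r (h₁ r hr)) (hE r (h₁ r hr))))
  refine laxMat_mul_twistMat_mul_laxMat_mem_transporter ε (H.mul_same k) F.g_mul_g F.g_mul F.mul_g
    F.ς_g (F.ς_E k) (hg.add_right (F.g_Y k)) (hg.sub_right (F.g_Y k))
    (commute_algebraMap_add (commute_algebraMap_sub (H.comm_Y k k)).symm)
    (fun a b => commute_algebraMap_sub (H.comm_E k k a b))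
    (algebraMap_add_algebraMap_sub _ _) ?_ ?_
  · rw [mul_add, sub_mul, hς.eq, F.ς_Y]
    abel
  · rw [mul_sub, add_mul, hς.eq, F.ς_Y]
    abel

/-- Elements preserving the right ideal generated by `d`, coefficientwise. -/
theorem exists_coeff_mul_eq {M : Matrix (Fin N) (Fin N) (PowerSeries A)} {d : A}
    (h : M ∈ transporter (Matrix.scalar (Fin N) (PowerSeries.C d))) (i j : Fin N) (r : ℕ) :
    ∃ x, PowerSeries.coeff r (M i j) * d = d * x := by
  obtain ⟨Z, hZ⟩ := h
  refine ⟨PowerSeries.coeff r (Z i j), ?_⟩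
  have := congrArg (fun X : Matrix (Fin N) (Fin N) (PowerSeries A) =>
    PowerSeries.coeff r (X i j)) hZ
  simpa [Matrix.scalar_apply, Matrix.mul_diagonal, Matrix.diagonal_mul] using this

theorem normMat_mem_transporter {d : A} {γ : ℂ}
    (h : vertexMat s E Y ε γ ∈ transporter (Matrix.scalar (Fin N) (PowerSeries.C d))) :
    normMat s E Y ε γ ∈ transporter (Matrix.scalar (Fin N) (PowerSeries.C d)) :=
  Submonoid.mul_mem _ (mem_transporter_of_commute
    ((commute_geomSeries γ (PowerSeries.C d)).symm.map (Matrix.scalar (Fin N)))) h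

/-! ## Parity -/

/-- The matrix whose commutant consists of the matrices with `(i, j)`-entry of parity
`|i| + |j|`, where `J` is the parity operator. -/
def parityMat (s : Fin N → ℤˣ) (J : A) : Matrix (Fin N) (Fin N) (PowerSeries A) :=
  Matrix.diagonal fun i => PowerSeries.C (sgn (par s i) • J)

theorem commute_parityMat_iff {J : A} {M : Matrix (Fin N) (Fin N) (PowerSeries A)} :
    Commute (parityMat s J) M ↔ ∀ i j r, J * PowerSeries.coeff r (M i j) =
      sgn (par s i + par s j) • (PowerSeries.coeff r (M i j) * J) := by
  have h : ∀ i j r, (PowerSeries.coeff r ((parityMat s J * M) i j) =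
      PowerSeries.coeff r ((M * parityMat s J) i j)) ↔ J * PowerSeries.coeff r (M i j) =
      sgn (par s i + par s j) • (PowerSeries.coeff r (M i j) * J) := fun i j r => by
    rw [parityMat, Matrix.diagonal_mul, Matrix.mul_diagonal, PowerSeries.coeff_C_mul,
      PowerSeries.coeff_mul_C, smul_mul_assoc, mul_smul_comm, sgn_add, mul_smul]
    constructor
    · intro h
      rw [← h, smul_smul, sgn_mul_self, one_smul]
    · intro h
      rw [h, smul_smul, sgn_mul_self, one_smul]
  constructor
  · intro hM i j r
    rw [← h, hM.eq]
  · intro hM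
    ext i j r
    exact (h i j r).2 (hM i j r)

theorem commute_parityMat_laxMat {J a : A} {F : Fin N → Fin N → A} (ha : Commute J a)
    (hF : ∀ i j, J * F i j = sgn (par s i + par s j) • (F i j * J)) :
    Commute (parityMat s J) (laxMat s F a) := by
  rw [commute_parityMat_iff]
  intro i j r
  rw [coeff_laxMat]
  split_ifs with h₁ h₂
  · rw [h₂, CharTwo.add_self_eq_zero, sgn_zero, one_smul, one_mul, mul_one]
  · simp
  · rw [← mul_assoc, (ha.pow_right _).eq, mul_assoc, mul_smul_comm, hF]
    simp only [mul_smul_comm, smul_mul_assoc, mul_assoc]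
    rw [smul_comm]

/-- Commuting with `parityMat` is stable under products, so the parity of the entries is tested on
each factor. -/
theorem commute_parityMat_vertexMat {J : A} (hY : ∀ k, Commute J (Y k))
    (hE : ∀ k i j, J * E k i j = sgn (par s i + par s j) • (E k i j * J)) (γ : ℂ) :
    Commute (parityMat s J) (vertexMat s E Y ε γ) := by
  refine Commute.mul_right (Commute.mul_right (Commute.list_prod_right _ _ ?_) ?_)
    (Commute.list_prod_right _ _ ?_)
  · intro x hx
    obtain ⟨k, -, rfl⟩ := List.mem_map.1 hx
    exact commute_parityMat_laxMat (commute_algebraMap_add (hY k).symm).symm (hE k)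
  · rw [commute_parityMat_iff]
    intro i j r
    by_cases h : i = j
    · rw [(coeff_twistMat_commutes ε γ i j r _).eq, h, CharTwo.add_self_eq_zero, sgn_zero, one_smul]
    · simp [twistMat_apply_ne ε γ h]
  · intro x hx
    obtain ⟨k, -, rfl⟩ := List.mem_map.1 (List.mem_reverse.1 hx)
    exact commute_parityMat_laxMat (commute_algebraMap_sub (hY k).symm).symm (hE k)

theorem commute_parityMat_normMat {J : A} (hY : ∀ k, Commute J (Y k))
    (hE : ∀ k i j, J * E k i j = sgn (par s i + par s j) • (E k i j * J)) (γ : ℂ) :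
    Commute (parityMat s J) (normMat s E Y ε γ) :=
  Commute.mul_right (commute_scalar fun _ _ => commute_geomSeries γ _).symm
    (commute_parityMat_vertexMat hY hE γ)

end VertexTransport

/-! ## Operators on the tensor power -/

section Operators

variable {N l : ℕ} {s : Fin N → ℤˣ}

theorem parityOp_mul (p q : ZMod 2) : parityOp s p * parityOp s q = parityOp s (p + q) := by
  rw [parityOp, parityOp, parityOp, Module.End.mul_eq_comp, ← Matrix.toLin'_mul,
    Matrix.diagonal_mul_diagonal]
  simp only [← sgn_add, ← add_mul]

theorem parityOp_zero : parityOp s 0 = LinearMap.id := by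
  simp [parityOp]

theorem matUnit_mul (i j a b : Fin N) :
    matUnit i j * matUnit a b = if j = a then matUnit i b else 0 := by
  rw [matUnit, matUnit, Module.End.mul_eq_comp, ← Matrix.toLin'_mul]
  split_ifs with h
  · subst h; simp [matUnit]
  · simp [h]

theorem parityOp_mul_matUnit (q : ZMod 2) (i j : Fin N) :
    parityOp s q * matUnit i j = sgn (q * par s i) • matUnit i j := by
  rw [parityOp, matUnit, Module.End.mul_eq_comp, ← Matrix.toLin'_mul, ← map_smul]
  congr 1
  ext a b
  by_cases h : i = a <;> simp [Matrix.diagonal_mul, Matrix.single_apply, h]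

theorem matUnit_mul_parityOp (q : ZMod 2) (i j : Fin N) :
    matUnit i j * parityOp s q = sgn (q * par s j) • matUnit i j := by
  rw [parityOp, matUnit, Module.End.mul_eq_comp, ← Matrix.toLin'_mul, ← map_smul]
  congr 1
  ext a b
  by_cases h : j = b <;> simp [Matrix.mul_diagonal, Matrix.single_apply, h]

theorem sum_matUnit : ∑ a : Fin N, matUnit a a = LinearMap.id := by
  simp only [matUnit, ← map_sum]
  rw [← Matrix.toLin'_one]
  congr 1
  ext i j
  by_cases h : i = j <;> simp [Matrix.sum_apply, Matrix.single_apply, Matrix.one_apply, h]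

theorem piMap_eq_smul {f g : Fin l → Module.End ℂ (Fin N → ℂ)} (k : Fin l) (c : ℂ)
    (hk : f k = c • g k) (h : ∀ q, q ≠ k → f q = g q) :
    PiTensorProduct.map f = c • PiTensorProduct.map g := by
  have : f = Function.update g k (c • g k) := by
    funext q
    by_cases hq : q = k
    · subst hq; simp [hk]
    · simp [hq, h q hq]
  rw [this, PiTensorProduct.map_update_smul, Function.update_eq_self]

theorem matUnitAt_mul_same (k : Fin l) (i j a b : Fin N) :
    matUnitAt s i j k * matUnitAt s a b k = if j = a then matUnitAt s i b k else 0 := by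
  rw [matUnitAt, matUnitAt, ← PiTensorProduct.map_mul]
  split_ifs with h
  · subst h
    rw [matUnitAt]
    congr 1
    funext q
    split_ifs with h₁ h₂
    · rw [parityOp_mul]
      congr 1
      linear_combination par s j * CharTwo.two_eq_zero (R := ZMod 2)
    · rw [matUnit_mul, if_pos rfl]
    · rfl
  · refine (PiTensorProduct.mapMultilinear ℂ _ _).map_coord_zero k ?_
    simp [matUnit_mul, h]

/-- The operators differ only in the factor `k`, where `E_{ij}` meets the parity operator carried by
`E_{ab}^{(r)}`; passing it changes the sign from `|j|` to `|i|`. -/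
theorem matUnitAt_mul_of_lt {k r : Fin l} (h : k < r) (i j a b : Fin N) :
    matUnitAt s i j k * matUnitAt s a b r =
      sgn ((par s i + par s j) * (par s a + par s b)) •
        (matUnitAt s a b r * matUnitAt s i j k) := by
  rw [matUnitAt, matUnitAt, ← PiTensorProduct.map_mul, ← PiTensorProduct.map_mul]
  refine piMap_eq_smul k _ ?_ fun q hq => ?_
  · simp only [lt_irrefl, if_false, if_true, h, matUnit_mul_parityOp, parityOp_mul_matUnit,
      smul_smul, ← sgn_add]
    congr 2
    linear_combination -(par s a + par s b) * par s i * CharTwo.two_eq_zero (R := ZMod 2)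
  · by_cases h₁ : q < k
    · simp only [h₁, h₁.trans h, if_true, parityOp_mul]
      rw [add_comm]
    · simp only [h₁, hq, if_false]
      rfl

theorem matUnitAt_mul_ne {k r : Fin l} (h : k ≠ r) (i j a b : Fin N) :
    matUnitAt s i j k * matUnitAt s a b r =
      sgn ((par s i + par s j) * (par s a + par s b)) •
        (matUnitAt s a b r * matUnitAt s i j k) := by
  rcases lt_or_gt_of_ne h with h | h
  · exact matUnitAt_mul_of_lt h i j a b
  · rw [matUnitAt_mul_of_lt h a b i j, smul_smul, mul_comm (par s i + par s j), sgn_mul_self,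
      one_smul]

theorem sum_matUnitAt (k : Fin l) : ∑ a, matUnitAt s a a k = 1 := by
  have h : ∀ a, matUnitAt s a a k = PiTensorProduct.mapMultilinear ℂ _ _
      (Function.update (fun _ => LinearMap.id) k (matUnit a a)) := fun a => by
    rw [matUnitAt, PiTensorProduct.mapMultilinear_apply]
    congr 1
    funext q
    by_cases hq : q = k
    · subst hq; simp
    · simp [hq, CharTwo.add_self_eq_zero, parityOp_zero]
  simp only [h]
  rw [← MultilinearMap.map_update_sum, sum_matUnit, Function.update_eq_self,
    PiTensorProduct.mapMultilinear_apply, PiTensorProduct.map_id]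
  rfl

/-! ### The super flip -/

theorem superFlip_comm {k r : Fin l} (h : k ≠ r) : superFlip s k r = superFlip s r k := by
  rw [superFlip, superFlip, Finset.sum_comm]
  refine Finset.sum_congr rfl fun b _ => Finset.sum_congr rfl fun a _ => ?_
  rw [matUnitAt_mul_ne h, smul_smul, signC_eq_sgn, signC_eq_sgn, ← sgn_add]
  congr 2
  linear_combination zmod_two_mul_self (par s a) + zmod_two_mul_self (par s b) +
    (par s a * par s b + par s b) * CharTwo.two_eq_zero (R := ZMod 2)

/-- The sum is also the value of `superFlip s k r * matUnitAt s i j r`, so the flip intertwines the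
two sites. It is used once more as the rule `Q₁ Q₂ = Q₁ P` for two sites. -/
theorem matUnitAt_mul_superFlip {k r : Fin l} (i j : Fin N) :
    matUnitAt s i j k * superFlip s k r =
      ∑ c, signC (s c) • (matUnitAt s i c k * matUnitAt s c j r) := by
  rw [superFlip, Finset.mul_sum, Finset.sum_eq_single j]
  · rw [Finset.mul_sum]
    refine Finset.sum_congr rfl fun c _ => ?_
    rw [mul_smul_comm, ← mul_assoc, matUnitAt_mul_same, if_pos rfl]
  · intro a _ ha
    rw [Finset.mul_sum]
    refine Finset.sum_eq_zero fun c _ => ?_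
    rw [mul_smul_comm, ← mul_assoc, matUnitAt_mul_same, if_neg ha.symm, zero_mul, smul_zero]
  · simp

theorem superFlip_mul_matUnitAt' {k r : Fin l} (i j : Fin N) :
    superFlip s k r * matUnitAt s i j r =
      ∑ c, signC (s c) • (matUnitAt s i c k * matUnitAt s c j r) := by
  rw [superFlip, Finset.sum_mul, Finset.sum_eq_single i]
  · rw [Finset.sum_mul]
    refine Finset.sum_congr rfl fun c _ => ?_
    rw [smul_mul_assoc, mul_assoc, matUnitAt_mul_same, if_pos rfl]
  · intro a _ ha
    rw [Finset.sum_mul]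
    refine Finset.sum_eq_zero fun c _ => ?_
    rw [smul_mul_assoc, mul_assoc, matUnitAt_mul_same, if_neg ha, mul_zero, smul_zero]
  · simp

theorem superFlip_mul_right {k r : Fin l} (i j : Fin N) :
    superFlip s k r * matUnitAt s i j r = matUnitAt s i j k * superFlip s k r := by
  rw [superFlip_mul_matUnitAt', matUnitAt_mul_superFlip]

theorem superFlip_mul_left {k r : Fin l} (h : k ≠ r) (i j : Fin N) :
    superFlip s k r * matUnitAt s i j k = matUnitAt s i j r * superFlip s k r := by
  rw [superFlip_comm h, superFlip_mul_right]

theorem superFlip_mul_self {k r : Fin l} (h : k ≠ r) :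
    superFlip s k r * superFlip s k r = 1 := by
  have e : ∀ a b, matUnitAt s a b k * matUnitAt s b a r * superFlip s k r =
      signC (s b) • (matUnitAt s a a k * matUnitAt s b b r) := fun a b => by
    rw [mul_assoc, ← superFlip_mul_left h, ← mul_assoc, matUnitAt_mul_superFlip, Finset.sum_mul,
      Finset.sum_eq_single b]
    · rw [smul_mul_assoc, mul_assoc, matUnitAt_mul_ne h.symm, CharTwo.add_self_eq_zero, zero_mul,
        sgn_zero, one_smul, ← mul_assoc, matUnitAt_mul_same, if_pos rfl]
    · intro c _ hc
      rw [smul_mul_assoc, mul_assoc, matUnitAt_mul_ne h.symm, mul_smul_comm, ← mul_assoc,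
        matUnitAt_mul_same, if_neg hc, zero_mul, smul_zero, smul_zero]
    · simp
  -- Only the left flip is expanded; `e` absorbs the right one, and two resolutions of the identity
  -- remain.
  have : superFlip s k r * superFlip s k r = (∑ a, ∑ b, signC (s b) •
      (matUnitAt s a b k * matUnitAt s b a r)) * superFlip s k r := rfl
  rw [this]
  simp only [Finset.sum_mul, smul_mul_assoc, e, smul_smul, signC_mul_self, one_smul,
    ← Finset.mul_sum, sum_matUnitAt, mul_one]

theorem commute_superFlip_matUnitAt {k r q : Fin l} (hk : q ≠ k) (hr : q ≠ r) (i j : Fin N) :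
    Commute (superFlip s k r) (matUnitAt s i j q) := by
  refine Commute.sum_left _ _ _ fun a _ => Commute.sum_left _ _ _ fun b _ =>
    Commute.smul_left ?_ _
  rw [Commute, SemiconjBy, mul_assoc, matUnitAt_mul_ne hr.symm, mul_smul_comm, ← mul_assoc,
    matUnitAt_mul_ne hk.symm, smul_mul_assoc, smul_smul, mul_assoc, add_comm (par s b),
    sgn_mul_self, one_smul]

/-! ### The diagonal operators -/

theorem diagAt_mul_matUnitAt (ε : Fin N → ℤˣ) (k : Fin l) (i j : Fin N) :
    diagAt s ε k * matUnitAt s i j k = signC (ε i) • matUnitAt s i j k := by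
  rw [diagAt, Finset.sum_mul, Finset.sum_eq_single i]
  · rw [smul_mul_assoc, matUnitAt_mul_same, if_pos rfl]
  · intro a _ ha
    rw [smul_mul_assoc, matUnitAt_mul_same, if_neg ha, smul_zero]
  · simp

theorem matUnitAt_mul_diagAt (ε : Fin N → ℤˣ) (k : Fin l) (i j : Fin N) :
    matUnitAt s i j k * diagAt s ε k = signC (ε j) • matUnitAt s i j k := by
  rw [diagAt, Finset.mul_sum, Finset.sum_eq_single j]
  · rw [mul_smul_comm, matUnitAt_mul_same, if_pos rfl]
  · intro a _ ha
    rw [mul_smul_comm, matUnitAt_mul_same, if_neg ha.symm, smul_zero]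
  · simp

theorem diagAt_mul_self (ε : Fin N → ℤˣ) (k : Fin l) : diagAt s ε k * diagAt s ε k = 1 := by
  conv_lhs => rw [diagAt, Finset.sum_mul]
  rw [← sum_matUnitAt (s := s) k]
  refine Finset.sum_congr rfl fun a _ => ?_
  rw [smul_mul_assoc]
  change signC (ε a) • (matUnitAt s a a k * diagAt s ε k) = _
  rw [matUnitAt_mul_diagAt, smul_smul, signC_mul_self, one_smul]

theorem commute_diagAt_matUnitAt (ε : Fin N → ℤˣ) {k q : Fin l} (h : q ≠ k) (i j : Fin N) :
    Commute (diagAt s ε k) (matUnitAt s i j q) := by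
  refine Commute.sum_left _ _ _ fun a _ => Commute.smul_left ?_ _
  rw [Commute, SemiconjBy, matUnitAt_mul_ne h.symm, CharTwo.add_self_eq_zero, zero_mul, sgn_zero,
    one_smul]

/-! ### The parity operator -/

/-- The parity operator on `V^{⊗l}`. -/
def totalParity (s : Fin N → ℤˣ) (l : ℕ) : Module.End ℂ (TensorV N l) :=
  PiTensorProduct.map fun _ => parityOp s 1

theorem totalParity_mul_matUnitAt (k : Fin l) (i j : Fin N) :
    totalParity s l * matUnitAt s i j k =
      sgn (par s i + par s j) • (matUnitAt s i j k * totalParity s l) := by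
  rw [totalParity, matUnitAt, ← PiTensorProduct.map_mul, ← PiTensorProduct.map_mul]
  refine piMap_eq_smul k _ ?_ fun q hq => ?_
  · simp only [lt_irrefl, if_false, if_true, matUnit_mul_parityOp, parityOp_mul_matUnit, one_mul,
      smul_smul, ← sgn_add]
    congr 2
    linear_combination -par s j * CharTwo.two_eq_zero (R := ZMod 2)
  · by_cases h₁ : q < k
    · simp only [h₁, if_true, parityOp_mul]
      rw [add_comm]
    · simp only [h₁, hq, if_false]
      rfl

theorem commute_totalParity_superFlip (k r : Fin l) :
    Commute (totalParity s l) (superFlip s k r) := by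
  refine Commute.sum_right _ _ _ fun a _ => Commute.sum_right _ _ _ fun b _ =>
    Commute.smul_right ?_ _
  rw [Commute, SemiconjBy, ← mul_assoc, totalParity_mul_matUnitAt, smul_mul_assoc, mul_assoc,
    totalParity_mul_matUnitAt, mul_smul_comm, smul_smul, add_comm (par s b), sgn_mul_self, one_smul,
    mul_assoc]

theorem commute_totalParity_diagAt (ε : Fin N → ℤˣ) (k : Fin l) :
    Commute (totalParity s l) (diagAt s ε k) := by
  refine Commute.sum_right _ _ _ fun a _ => Commute.smul_right ?_ _
  rw [Commute, SemiconjBy, totalParity_mul_matUnitAt, CharTwo.add_self_eq_zero, sgn_zero, one_smul]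

theorem totalParity_basisVec (a : Fin l → Fin N) :
    totalParity s l (basisVec a) = sgn (∑ k, par s (a k)) • basisVec a := by
  rw [totalParity, basisVec, PiTensorProduct.map_tprod, sgn_sum, ← MultilinearMap.map_smul_univ]
  congr 1
  funext k
  ext i
  by_cases h : i = a k
  · subst h; simp [parityOp, Matrix.mulVec_diagonal]
  · simp [parityOp, Matrix.mulVec_diagonal, h]

theorem span_basisVec : Submodule.span ℂ (Set.range (basisVec (N := N) (l := l))) = ⊤ := by
  have h := (Basis.piTensorProduct fun _ : Fin l => Pi.basisFun ℂ (Fin N)).span_eq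
  rw [← h]
  congr 2
  funext a
  rw [Basis.piTensorProduct_apply]
  simp [basisVec]

end Operators

/-- Substituting `-u` turns `1 - 1/(u + ȷ - Y k) Q` into `1 + 1/(u - ȷ + Y k) Q`, a factor of rank
one with parameter `ȷ - Y k`. -/
theorem rightFactor_eq_negUHom {A : Type u} [Ring A] [Algebra ℂ A] {N l : ℕ} (s : Fin N → ℤˣ)
    (E : Fin l → Fin N → Fin N → A) (Y : Fin l → A) (k : Fin l) :
    rightFactor s E Y k = negUHom.mapMatrix
      (1 - Matrix.scalar _ (invSub (algebraMap ℂ A (-halfSdim s) + Y k)) *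
        signedSeriesMat s (E k)) := by
  have h : algebraMap ℂ A (-halfSdim s) + Y k = -(algebraMap ℂ A (halfSdim s) - Y k) := by
    rw [map_neg]; abel
  rw [h, ← negUHom_laxMat, negUHom_mapMatrix_negUHom, rightFactor]

/-! ## The vertex data over the Hecke algebra -/

section HeckeFacts

variable {l : ℕ} {θ₁ θ₂ : ℂ}

theorem Hecke.w_σ_mul_self (i j : Fin l) :
    (Hecke.w (Weyl.σ i j) * Hecke.w (Weyl.σ i j) : Hecke l θ₁ θ₂) = 1 := by
  have h₁ := RingQuot.mkAlgHom_rel ℂ (HeckeRel.w_mul (θ₁ := θ₁) (θ₂ := θ₂) (Weyl.σ i j) (Weyl.σ i j))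
  have h₂ := RingQuot.mkAlgHom_rel ℂ (HeckeRel.w_one (l := l) (θ₁ := θ₁) (θ₂ := θ₂))
  have h₃ : Weyl.σ i j * Weyl.σ i j = 1 := by
    rw [Weyl.σ, ← map_mul, Equiv.swap_mul_self, map_one]
  rw [h₃, map_mul] at h₁
  rw [map_one] at h₂
  exact h₁.trans h₂

theorem Hecke.y_comm (i j : Fin l) :
    Commute (Hecke.y i : Hecke l θ₁ θ₂) (Hecke.y j) := by
  have h := RingQuot.mkAlgHom_rel ℂ (HeckeRel.y_comm (θ₁ := θ₁) (θ₂ := θ₂) i j)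
  rwa [map_mul, map_mul] at h

theorem Hecke.σ_mul_y_left {i j : Fin l} (h : i.val + 1 = j.val) :
    (Hecke.w (Weyl.σ i j) * Hecke.y i : Hecke l θ₁ θ₂) =
      Hecke.y j * Hecke.w (Weyl.σ i j) + algebraMap ℂ _ θ₁ := by
  have h := RingQuot.mkAlgHom_rel ℂ (HeckeRel.σ_y (θ₁ := θ₁) (θ₂ := θ₂) i j h)
  rw [map_sub, map_mul, map_mul, AlgHom.commutes] at h
  exact sub_eq_iff_eq_add'.1 h

/-- Obtained from the defining relation by multiplying with the involution `σ` on both sides. -/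
theorem Hecke.σ_mul_y_right {i j : Fin l} (h : i.val + 1 = j.val) :
    (Hecke.w (Weyl.σ i j) * Hecke.y j : Hecke l θ₁ θ₂) =
      Hecke.y i * Hecke.w (Weyl.σ i j) - algebraMap ℂ _ θ₁ := by
  have h₁ := congrArg (fun x => Hecke.w (Weyl.σ i j) * x * Hecke.w (Weyl.σ i j))
    (Hecke.σ_mul_y_left (θ₁ := θ₁) (θ₂ := θ₂) h)
  beta_reduce at h₁
  rw [← mul_assoc (Hecke.w (Weyl.σ i j)) (Hecke.w (Weyl.σ i j)), Hecke.w_σ_mul_self, one_mul,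
    mul_add, add_mul, ← mul_assoc, mul_assoc _ (Hecke.w (Weyl.σ i j)) (Hecke.w (Weyl.σ i j)),
    ← Algebra.commutes, mul_assoc, mul_assoc, Hecke.w_σ_mul_self, mul_one, mul_one] at h₁
  rw [h₁, add_sub_cancel_right]

theorem Hecke.σ_y_far {i j k : Fin l} (h : i.val + 1 = j.val) (hi : k ≠ i) (hj : k ≠ j) :
    Commute (Hecke.w (Weyl.σ i j) : Hecke l θ₁ θ₂) (Hecke.y k) := by
  have h := RingQuot.mkAlgHom_rel ℂ (HeckeRel.σ_y_far (θ₁ := θ₁) (θ₂ := θ₂) i j k h hi hj)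
  rwa [map_mul, map_mul] at h

theorem Hecke.ς_y_far {k i : Fin l} (h : k.val + 1 = l) (hi : i ≠ k) :
    Commute (Hecke.w (Weyl.ς k) : Hecke l θ₁ θ₂) (Hecke.y i) := by
  have h := RingQuot.mkAlgHom_rel ℂ (HeckeRel.ς_y_far (θ₁ := θ₁) (θ₂ := θ₂) k i h hi)
  rwa [map_mul, map_mul] at h

theorem Hecke.ς_mul_y {k : Fin l} (h : k.val + 1 = l) :
    (Hecke.w (Weyl.ς k) * Hecke.y k : Hecke l θ₁ θ₂) =
      -(Hecke.y k * Hecke.w (Weyl.ς k)) + algebraMap ℂ _ θ₂ := by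
  have h := RingQuot.mkAlgHom_rel ℂ (HeckeRel.ς_y (θ₁ := θ₁) (θ₂ := θ₂) k h)
  rw [map_add, map_mul, map_mul, AlgHom.commutes] at h
  rw [← h]
  exact (neg_add_cancel_comm_assoc _ _).symm

end HeckeFacts

/-! ### The concrete sites, flips and sign changes in `H ⊗ End(V^{⊗l})` -/

section OperatorAlgebra

variable {N l : ℕ} {θ₁ θ₂ : ℂ} {s ε : Fin N → ℤˣ}

/-- The embedding `h ↦ h ⊗ 1`. -/
def heckeHom : Hecke l θ₁ θ₂ →ₐ[ℂ] OpAlg N l θ₁ θ₂ := Algebra.TensorProduct.includeLeft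

/-- The embedding `T ↦ 1 ⊗ T`. -/
def endHom : Module.End ℂ (TensorV N l) →ₐ[ℂ] OpAlg N l θ₁ θ₂ :=
  Algebra.TensorProduct.includeRight

theorem heckeHom_mul_endHom (h : Hecke l θ₁ θ₂) (T : Module.End ℂ (TensorV N l)) :
    heckeHom h * endHom T = h ⊗ₜ[ℂ] T := by
  simp [heckeHom, endHom]

variable (N) in
/-- The element `χ y_k ⊗ 1`. -/
def siteY (χ : ℂ) (k : Fin l) : OpAlg N l θ₁ θ₂ := heckeHom (χ • Hecke.y k)

/-- The element `1 ⊗ E_{ij}^{(k)}`. -/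
def siteE (s : Fin N → ℤˣ) (k : Fin l) (i j : Fin N) : OpAlg N l θ₁ θ₂ :=
  endHom (matUnitAt s i j k)

theorem commute_heckeHom_endHom (h : Hecke l θ₁ θ₂) (T : Module.End ℂ (TensorV N l)) :
    Commute (heckeHom h : OpAlg N l θ₁ θ₂) (endHom T) := by
  rw [Commute, SemiconjBy, heckeHom_mul_endHom]
  simp [heckeHom, endHom]

theorem isVertexData_site (s : Fin N → ℤˣ) (χ : ℂ) :
    IsVertexData s (siteE (l := l) (θ₁ := θ₁) (θ₂ := θ₂) s) (siteY N χ) where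
  mul_same k i j a b := by
    rw [siteE, siteE, ← map_mul, matUnitAt_mul_same]
    split_ifs
    · rfl
    · rw [map_zero]
  mul_ne k r h i j a b := by
    rw [siteE, siteE, ← map_mul, matUnitAt_mul_ne h, map_smul, map_mul]
  comm_Y k r := (((Hecke.y_comm k r).smul_left χ).smul_right χ).map heckeHom
  comm_E k r i j := commute_heckeHom_endHom _ _

/-- Rescaling `y` by `χ` turns the constant `θ₁` of the Hecke relation into `χ θ₁`, which must be
the eigenvalue `e` used in the quotient. -/
theorem isFlip_site {χ : ℂ} {e : ℤˣ} (hχ : θ₁ * χ = signC e) {i j : Fin l}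
    (h : i.val + 1 = j.val) :
    IsFlip s (siteE (l := l) (θ₁ := θ₁) (θ₂ := θ₂) s) (siteY N χ) i j
      (heckeHom (Hecke.w (Weyl.σ i j))) (endHom (superFlip s i j)) (signC e) := by
  have hij : i ≠ j := by rintro rfl; omega
  have hc : algebraMap ℂ (OpAlg N l θ₁ θ₂) (signC e) =
      heckeHom (χ • algebraMap ℂ (Hecke l θ₁ θ₂) θ₁) := by
    rw [← hχ, mul_comm, Algebra.smul_def, ← map_mul]
    exact (AlgHom.commutes (heckeHom : Hecke l θ₁ θ₂ →ₐ[ℂ] OpAlg N l θ₁ θ₂) _).symm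
  refine ⟨?_, fun a b => ?_, fun a b => ?_, fun a b => ?_, fun a b => ?_, fun k hi hj a b => ?_,
    fun k => ?_, ?_, fun k a b => ?_, ?_, ?_, fun k hi hj => ?_⟩
  · rw [← map_mul, superFlip_mul_self hij, map_one]
  · rw [siteE, siteE, ← map_mul, ← map_mul, superFlip_mul_left hij]
  · rw [siteE, siteE, ← map_mul, ← map_mul, superFlip_mul_right]
  · simp only [siteE, ← map_mul, matUnitAt_mul_superFlip, map_sum, map_smul]
  · simp only [siteE, ← map_mul, superFlip_comm hij, matUnitAt_mul_superFlip, map_sum, map_smul]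
  · exact (commute_superFlip_matUnitAt hi hj a b).map endHom
  · exact (commute_heckeHom_endHom _ _).symm
  · exact commute_heckeHom_endHom _ _
  · exact commute_heckeHom_endHom _ _
  · rw [hc, siteY, siteY, ← map_mul, ← map_mul, ← map_add, mul_smul_comm, Hecke.σ_mul_y_left h,
      smul_add, smul_mul_assoc]
  · refine eq_sub_of_add_eq ?_
    rw [hc, siteY, siteY, ← map_mul, ← map_mul, ← map_add, mul_smul_comm, Hecke.σ_mul_y_right h,
      smul_sub, smul_mul_assoc, sub_add_cancel]
  · exact ((Hecke.σ_y_far h hi hj).smul_right χ).map heckeHom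

/-- Likewise `χ θ₂ = e (2γ + ϖ₁)`, by the two assumptions on the parameters. -/
theorem isSignChange_site {χ γ : ℂ} {e : ℤˣ} (hθ : θ₂ = θ₁ * (2 * γ + varpiOne s ε))
    (hχ : θ₁ * χ = signC e) {k : Fin l} (h : k.val + 1 = l) :
    IsSignChange s ε (siteE (l := l) (θ₁ := θ₁) (θ₂ := θ₂) s) (siteY N χ) k
      (heckeHom (Hecke.w (Weyl.ς k))) (endHom (diagAt s ε k)) (signC e) γ := by
  have hc : algebraMap ℂ (OpAlg N l θ₁ θ₂) (signC e * (2 * γ + varpiOne s ε)) =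
      heckeHom (χ • algebraMap ℂ (Hecke l θ₁ θ₂) θ₂) := by
    rw [← hχ, mul_right_comm, ← hθ, mul_comm, Algebra.smul_def, ← map_mul]
    exact (AlgHom.commutes (heckeHom : Hecke l θ₁ θ₂ →ₐ[ℂ] OpAlg N l θ₁ θ₂) _).symm
  refine ⟨?_, fun a b => ?_, fun a b => ?_, fun r hr a b => ?_, fun r => ?_, ?_, fun r a b => ?_,
    ?_, fun r hr => ?_⟩
  · rw [← map_mul, diagAt_mul_self, map_one]
  · rw [siteE, ← map_mul, diagAt_mul_matUnitAt, map_smul]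
  · rw [siteE, ← map_mul, matUnitAt_mul_diagAt, map_smul]
  · exact (commute_diagAt_matUnitAt ε hr a b).map endHom
  · exact (commute_heckeHom_endHom _ _).symm
  · exact commute_heckeHom_endHom _ _
  · exact commute_heckeHom_endHom _ _
  · rw [hc, siteY, ← map_mul, ← map_mul, ← map_neg, ← map_add, mul_smul_comm, Hecke.ς_mul_y h,
      smul_add, smul_mul_assoc, smul_neg]
  · exact ((Hecke.ς_y_far h hr).smul_right χ).map heckeHom

theorem algebraMap_add_siteY (χ c : ℂ) (k : Fin l) :
    algebraMap ℂ (OpAlg N l θ₁ θ₂) c + siteY N χ k = yShift χ c k := by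
  rw [siteY, yShift, add_comm (χ • Hecke.y k), TensorProduct.add_tmul]
  rfl

theorem qMat_eq (s : Fin N → ℤˣ) (k : Fin l) :
    (qMat s k : SeriesMat N l θ₁ θ₂) = signedSeriesMat s (siteE s k) := by
  ext i j : 1
  simp [qMat, signedSeriesMat, signedMat, siteE, endHom, TensorProduct.tmul_smul]

theorem of_mul_qMat (s : Fin N → ℤˣ) (k : Fin l) (f : PowerSeries (OpAlg N l θ₁ θ₂)) :
    (Matrix.of fun i j => f * qMat s k i j) =
      Matrix.scalar (Fin N) f * signedSeriesMat s (siteE s k) := by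
  ext i j : 1
  rw [Matrix.of_apply, qMat_eq, Matrix.scalar_apply, Matrix.diagonal_mul]

theorem tMat_eq (s : Fin N → ℤˣ) (χ : ℂ) (k : Fin l) :
    (tMat s χ k : SeriesMat N l θ₁ θ₂) = leftFactor s (siteE s) (siteY N χ) k := by
  rw [tMat, of_mul_qMat, leftFactor, laxMat, algebraMap_add_siteY]

theorem sMat_map_negU (s : Fin N → ℤˣ) (χ : ℂ) (k : Fin l) :
    ((sMat s χ k).map negU : SeriesMat N l θ₁ θ₂) = rightFactor s (siteE s) (siteY N χ) k := by
  rw [rightFactor_eq_negUHom, algebraMap_add_siteY, sMat, of_mul_qMat]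
  rfl

theorem bMat_eq (s ε : Fin N → ℤˣ) (γ χ : ℂ) :
    bMat l θ₁ θ₂ s ε γ χ = vertexMat s (siteE s) (siteY N χ) ε γ := by
  rw [bMat, vertexMat, leftProd, rightProd, List.ofFn_eq_map, List.ofFn_eq_map]
  simp only [tMat_eq, sMat_map_negU]
  rfl

theorem bMatNorm_eq (s ε : Fin N → ℤˣ) (γ χ : ℂ) :
    bMatNorm l θ₁ θ₂ s ε γ χ = normMat s (siteE s) (siteY N χ) ε γ := by
  ext i j : 1
  rw [bMatNorm, Matrix.of_apply, normMat, Matrix.scalar_apply, Matrix.diagonal_mul, bMat_eq]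
  rfl

end OperatorAlgebra

/-! ## Representations of the twisted super Yangians -/

section Generators

theorem adjoin_range_mkAlgHom_ι {X : Type*} (R : FreeAlgebra ℂ X → FreeAlgebra ℂ X → Prop) :
    Algebra.adjoin ℂ (Set.range fun x => RingQuot.mkAlgHom ℂ R (FreeAlgebra.ι ℂ x)) = ⊤ := by
  have h : (Set.range fun x => RingQuot.mkAlgHom ℂ R (FreeAlgebra.ι ℂ x)) =
      RingQuot.mkAlgHom ℂ R '' Set.range (FreeAlgebra.ι ℂ) := by
    rw [← Set.range_comp]; rfl
  rw [h, ← AlgHom.map_adjoin, FreeAlgebra.adjoin_range_ι, Algebra.map_top,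
    AlgHom.range_eq_top]
  exact RingQuot.mkAlgHom_surjective ℂ R

variable {B : Type u} [Ring B] [Algebra ℂ B] {N : ℕ} {s : Fin N → ℤˣ}
variable {W : Type v} [AddCommGroup W] [Module ℂ W]

/-- The grading by words is written out, so that the gradings of both Yangians are instances by
definition. -/
theorem isEvenRep_of_generators {g : YGen N → B} {𝒲 : ZMod 2 → Submodule ℂ W}
    {ρ : B →ₐ[ℂ] Module.End ℂ W}
    (h : ∀ y q, ∀ x ∈ 𝒲 q, ρ (g y) x ∈ 𝒲 (par s y.1 + par s y.2.1 + q)) :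
    IsEvenRep (fun p => Submodule.span ℂ {x | ∃ w : List (YGen N), wordPar s w = p ∧
      x = (w.map g).prod}) 𝒲 ρ := by
  have hw : ∀ (w : List (YGen N)) q, ∀ x ∈ 𝒲 q, ρ (w.map g).prod x ∈ 𝒲 (wordPar s w + q) := by
    intro w
    induction w with
    | nil => intro q x hx; simpa [wordPar] using hx
    | cons y w ih =>
      intro q x hx
      have := h y _ _ (ih q x hx)
      rw [List.map_cons, List.prod_cons, map_mul, Module.End.mul_apply]
      rwa [← add_assoc] at this
  intro p q a ha x hx
  induction ha using Submodule.span_induction with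
  | mem a ha =>
    obtain ⟨w, rfl, rfl⟩ := ha
    exact hw w q x hx
  | zero => simp
  | add a b _ _ ha hb => rw [map_add, LinearMap.add_apply]; exact add_mem ha hb
  | smul c a _ ha => rw [map_smul, LinearMap.smul_apply]; exact Submodule.smul_mem _ c ha

/-- The representation on a quotient by an invariant subspace. -/
def quotientRep (K : Submodule ℂ W) (Φ : B →ₐ[ℂ] Module.End ℂ W)
    (h : ∀ b, K ≤ K.comap (Φ b)) : B →ₐ[ℂ] Module.End ℂ (W ⧸ K) where
  toFun b := K.mapQ K (Φ b) (h b)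
  map_one' := by
    refine Submodule.linearMap_qext _ (LinearMap.ext fun x => ?_)
    simp
  map_mul' a b := by
    refine Submodule.linearMap_qext _ (LinearMap.ext fun x => ?_)
    simp
  map_zero' := by
    refine Submodule.linearMap_qext _ (LinearMap.ext fun x => ?_)
    simp
  map_add' a b := by
    refine Submodule.linearMap_qext _ (LinearMap.ext fun x => ?_)
    simp
  commutes' c := by
    refine Submodule.linearMap_qext _ (LinearMap.ext fun x => ?_)
    simp [Module.algebraMap_end_apply]

/-- The operators which preserve a subspace. -/
def stabilizerSubalgebra (K : Submodule ℂ W) : Subalgebra ℂ (Module.End ℂ W) where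
  carrier := {T | K ≤ K.comap T}
  mul_mem' hS hT _ hx := hS (hT hx)
  add_mem' hS hT _ hx := K.add_mem (hS hx) (hT hx)
  algebraMap_mem' c _ hx := K.smul_mem c hx

theorem le_comap_of_generators {X : Type*} {g : X → B} (hg : Algebra.adjoin ℂ (Set.range g) = ⊤)
    {K : Submodule ℂ W} {Φ : B →ₐ[ℂ] Module.End ℂ W} (h : ∀ x, K ≤ K.comap (Φ (g x))) (b : B) :
    K ≤ K.comap (Φ b) := by
  have : Algebra.adjoin ℂ (Set.range g) ≤ (stabilizerSubalgebra K).comap Φ :=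
    Algebra.adjoin_le (by rintro _ ⟨x, rfl⟩; exact h x)
  rw [hg] at this
  exact this (Algebra.mem_top (x := b))

end Generators

/-! ## The parity of the quotient -/

section Grading

variable {N l : ℕ} {θ₁ θ₂ : ℂ} {s ε : Fin N → ℤˣ} {e : ℤˣ}
variable {M : Type v} [AddCommGroup M] [Module ℂ M] [Module (Hecke l θ₁ θ₂) M]
  [IsScalarTower ℂ (Hecke l θ₁ θ₂) M]

/-- The elements of `H ⊗ End(V^{⊗l})` which preserve the right ideal generated by the elements
`σ_i - e` and `ς_l - e`. -/
def TransportsRelations (s ε : Fin N → ℤˣ) (e : ℤˣ) (T : OpAlg N l θ₁ θ₂) : Prop :=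
  (∀ i j : Fin l, i.val + 1 = j.val → ∃ x,
    T * (heckeHom (Hecke.w (Weyl.σ i j)) * endHom (superFlip s i j) -
        algebraMap ℂ (OpAlg N l θ₁ θ₂) (signC e)) =
      (heckeHom (Hecke.w (Weyl.σ i j)) * endHom (superFlip s i j) -
        algebraMap ℂ (OpAlg N l θ₁ θ₂) (signC e)) * x) ∧
  ∀ k : Fin l, k.val + 1 = l → ∃ x,
    T * (heckeHom (Hecke.w (Weyl.ς k)) * endHom (diagAt s ε k) -
        algebraMap ℂ (OpAlg N l θ₁ θ₂) (signC e)) =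
      (heckeHom (Hecke.w (Weyl.ς k)) * endHom (diagAt s ε k) -
        algebraMap ℂ (OpAlg N l θ₁ θ₂) (signC e)) * x

theorem act_relation (h : Hecke l θ₁ θ₂) (T : Module.End ℂ (TensorV N l)) (c : ℂ) :
    act M (heckeHom h * endHom T - algebraMap ℂ (OpAlg N l θ₁ θ₂) c) =
      act M (h ⊗ₜ[ℂ] T) - c • 1 := by
  rw [heckeHom_mul_endHom]
  refine (map_sub (act M) _ _).trans ?_
  rw [AlgHom.commutes, Algebra.algebraMap_eq_smul_one]

theorem range_le_comap_of_mul_eq {W : Type v} [AddCommGroup W] [Module ℂ W]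
    {T d x : Module.End ℂ W} (h : T * d = d * x) :
    LinearMap.range d ≤ (LinearMap.range d).comap T := by
  rintro _ ⟨y, rfl⟩
  exact ⟨x y, (LinearMap.congr_fun h y).symm⟩

theorem TransportsRelations.le_comap {T : OpAlg N l θ₁ θ₂} (h : TransportsRelations s ε e T) :
    drinfeldKer l θ₁ θ₂ M s ε e ≤ (drinfeldKer l θ₁ θ₂ M s ε e).comap (act M T) := by
  refine sup_le (iSup_le fun i => iSup_le fun j => iSup_le fun hij => ?_)
    (iSup_le fun k => iSup_le fun hk => ?_)
  · obtain ⟨x, hx⟩ := h.1 i j hij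
    have hx := congrArg (act M) hx
    rw [map_mul, map_mul, act_relation] at hx
    refine (range_le_comap_of_mul_eq hx).trans (Submodule.comap_mono ?_)
    exact le_sup_of_le_left (le_iSup_of_le i (le_iSup_of_le j (le_iSup_of_le hij le_rfl)))
  · obtain ⟨x, hx⟩ := h.2 k hk
    have hx := congrArg (act M) hx
    rw [map_mul, map_mul, act_relation] at hx
    refine (range_le_comap_of_mul_eq hx).trans (Submodule.comap_mono ?_)
    exact le_sup_of_le_right (le_iSup_of_le k (le_iSup_of_le hk le_rfl))

theorem commute_mul_sub_algebraMap {A : Type u} [Ring A] [Algebra ℂ A] {x y z : A}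
    (hy : Commute x y) (hz : Commute x z) (c : ℂ) : Commute x (y * z - algebraMap ℂ A c) :=
  (hy.mul_right hz).sub_right (commute_algebraMap c x).symm

theorem transportsRelations_totalParity (s ε : Fin N → ℤˣ) (e : ℤˣ) :
    TransportsRelations s ε e (endHom (totalParity s l) : OpAlg N l θ₁ θ₂) := by
  refine ⟨fun i j _ => ⟨endHom (totalParity s l), ?_⟩, fun k _ => ⟨endHom (totalParity s l), ?_⟩⟩
  · exact commute_mul_sub_algebraMap (A := OpAlg N l θ₁ θ₂) (commute_heckeHom_endHom _ _).symm
      ((commute_totalParity_superFlip i j).map endHom) _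
  · exact commute_mul_sub_algebraMap (A := OpAlg N l θ₁ θ₂) (commute_heckeHom_endHom _ _).symm
      ((commute_totalParity_diagAt ε k).map endHom) _

/-- The parity operator on `𝒟^e_{s,ε}(M)`. -/
def quotientParity (l : ℕ) (θ₁ θ₂ : ℂ) (M : Type v) [AddCommGroup M] [Module ℂ M]
    [Module (Hecke l θ₁ θ₂) M] [IsScalarTower ℂ (Hecke l θ₁ θ₂) M] (s ε : Fin N → ℤˣ) (e : ℤˣ) :
    Module.End ℂ (DrinfeldObj l θ₁ θ₂ M s ε e) :=
  Submodule.mapQ _ _ (act M (endHom (totalParity s l)))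
    (transportsRelations_totalParity s ε e).le_comap

theorem act_endHom_tmul (T : Module.End ℂ (TensorV N l)) (m : M) (t : TensorV N l) :
    act M (endHom T : OpAlg N l θ₁ θ₂) (m ⊗ₜ[ℂ] t) = m ⊗ₜ[ℂ] T t := by
  simp [act, endHom, Module.endTensorEndAlgHom_apply]

theorem quotientParity_eq_smul {p : ZMod 2} {x : DrinfeldObj l θ₁ θ₂ M s ε e}
    (hx : x ∈ drinfeldGrade l θ₁ θ₂ M s ε e p) : quotientParity l θ₁ θ₂ M s ε e x = sgn p • x := by
  induction hx using Submodule.span_induction with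
  | mem x hx =>
    obtain ⟨m, a, rfl, rfl⟩ := hx
    change Submodule.mkQ _ (act M _ (m ⊗ₜ[ℂ] basisVec a)) = _
    rw [act_endHom_tmul, totalParity_basisVec, TensorProduct.tmul_smul, map_smul]
  | zero => simp
  | add x y _ _ hx hy => rw [map_add, hx, hy, smul_add]
  | smul c x _ hx => rw [map_smul, hx, smul_comm]

theorem drinfeldGrade_sup_eq_top :
    drinfeldGrade l θ₁ θ₂ M s ε e 0 ⊔ drinfeldGrade l θ₁ θ₂ M s ε e 1 = ⊤ := by
  rw [eq_top_iff]
  rintro x -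
  obtain ⟨y, rfl⟩ := Submodule.mkQ_surjective _ x
  induction y using TensorProduct.induction_on with
  | zero => simp
  | add y z hy hz => rw [map_add]; exact add_mem hy hz
  | tmul m t =>
    have ht : t ∈ Submodule.span ℂ (Set.range (basisVec (N := N) (l := l))) := by
      rw [span_basisVec]; trivial
    induction ht using Submodule.span_induction with
    | mem t ht =>
      obtain ⟨a, rfl⟩ := ht
      rcases zmod_two_cases (∑ k, par s (a k)) with h | h
      · exact Submodule.mem_sup_left (Submodule.subset_span ⟨m, a, h, rfl⟩)
      · exact Submodule.mem_sup_right (Submodule.subset_span ⟨m, a, h, rfl⟩)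
    | zero => simp
    | add t t' _ _ h h' => rw [TensorProduct.tmul_add, map_add]; exact add_mem h h'
    | smul c t _ h => rw [TensorProduct.tmul_smul, map_smul]; exact Submodule.smul_mem _ c h

theorem eq_zero_of_eq_neg {W : Type v} [AddCommGroup W] [Module ℂ W] {x : W} (h : x = -x) :
    x = 0 :=
  have := IsAddTorsionFree.of_isTorsionFree ℂ W
  self_eq_neg.1 h

/-- The two components span the quotient and lie in the eigenspaces for `1` and `-1`, so they
exhaust these eigenspaces. Evenness of operators thereby becomes commutation with the parity up to
sign. -/
theorem mem_drinfeldGrade_iff {p : ZMod 2} {x : DrinfeldObj l θ₁ θ₂ M s ε e} :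
    x ∈ drinfeldGrade l θ₁ θ₂ M s ε e p ↔ quotientParity l θ₁ θ₂ M s ε e x = sgn p • x := by
  refine ⟨quotientParity_eq_smul, fun hx => ?_⟩
  have hm : x ∈ drinfeldGrade l θ₁ θ₂ M s ε e 0 ⊔ drinfeldGrade l θ₁ θ₂ M s ε e 1 := by
    rw [drinfeldGrade_sup_eq_top]; trivial
  obtain ⟨x₀, h₀, x₁, h₁, rfl⟩ := Submodule.mem_sup.1 hm
  rw [map_add, quotientParity_eq_smul h₀, quotientParity_eq_smul h₁, smul_add, sgn_zero, sgn_one,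
    neg_smul, one_smul, one_smul] at hx
  rcases zmod_two_cases p with rfl | rfl
  · rw [sgn_zero, one_smul, one_smul] at hx
    rwa [eq_zero_of_eq_neg (add_left_cancel hx).symm, add_zero]
  · rw [sgn_one, neg_smul, neg_smul, one_smul, one_smul] at hx
    rwa [eq_zero_of_eq_neg (add_right_cancel hx), zero_add]

/-- The images of the even and odd basis tensors cannot overlap in the quotient: the parity operator
descends and acts on them with the distinct eigenvalues `1` and `-1`. -/
theorem isInternal_drinfeldGrade : DirectSum.IsInternal (drinfeldGrade l θ₁ θ₂ M s ε e) := by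
  refine (DirectSum.isInternal_submodule_iff_isCompl _ (i := 0) (j := 1) (by decide) ?_).2
    ⟨?_, codisjoint_iff.2 drinfeldGrade_sup_eq_top⟩
  · ext p
    simpa using zmod_two_cases p
  · rw [Submodule.disjoint_def]
    intro x h₀ h₁
    have h := quotientParity_eq_smul h₁
    rw [quotientParity_eq_smul h₀, sgn_zero, sgn_one, neg_smul, one_smul] at h
    exact eq_zero_of_eq_neg h

end Grading

/-! ## The action on the quotient -/

section Action

variable {N l : ℕ} {θ₁ θ₂ : ℂ} {s ε : Fin N → ℤˣ} {e : ℤˣ}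
variable {B : Type u} [Ring B] [Algebra ℂ B]

/-- A homomorphism from an algebra with generators `b i j r`, of parity `|i| + |j|`, to
`H ⊗ End(V^{⊗l})`, which is even and preserves the defining relations of the quotient. -/
structure IsCompatible (s ε : Fin N → ℤˣ) (e : ℤˣ) (b : Fin N → Fin N → ℕ → B)
    (Φ : B →ₐ[ℂ] OpAlg N l θ₁ θ₂) : Prop where
  adjoin : Algebra.adjoin ℂ (Set.range fun y : YGen N => b y.1 y.2.1 (y.2.2 + 1)) = ⊤
  transports : ∀ i j r, TransportsRelations s ε e (Φ (b i j r))
  parity : ∀ i j r, endHom (totalParity s l) * Φ (b i j r) =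
    sgn (par s i + par s j) • (Φ (b i j r) * endHom (totalParity s l))

variable {b : Fin N → Fin N → ℕ → B} {Φ : B →ₐ[ℂ] OpAlg N l θ₁ θ₂}
variable (M : Type v) [AddCommGroup M] [Module ℂ M] [Module (Hecke l θ₁ θ₂) M]
  [IsScalarTower ℂ (Hecke l θ₁ θ₂) M]
variable (M' : Type v) [AddCommGroup M'] [Module ℂ M'] [Module (Hecke l θ₁ θ₂) M']
  [IsScalarTower ℂ (Hecke l θ₁ θ₂) M']

theorem IsCompatible.le_comap (H : IsCompatible s ε e b Φ) (x : B) :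
    drinfeldKer l θ₁ θ₂ M s ε e ≤
      (drinfeldKer l θ₁ θ₂ M s ε e).comap ((act M).comp Φ x) := by
  refine le_comap_of_generators (Φ := (act M).comp Φ) H.adjoin (fun y => ?_) x
  exact (H.transports y.1 y.2.1 (y.2.2 + 1)).le_comap (M := M)

/-- The representation on `𝒟^e_{s,ε}(M)`. -/
def IsCompatible.rep (H : IsCompatible s ε e b Φ) :
    B →ₐ[ℂ] Module.End ℂ (DrinfeldObj l θ₁ θ₂ M s ε e) :=
  quotientRep _ ((act M).comp Φ) (H.le_comap M)

theorem IsCompatible.rep_mkQ (H : IsCompatible s ε e b Φ) (y : B) (x : M ⊗[ℂ] TensorV N l) :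
    H.rep M y ((drinfeldKer l θ₁ θ₂ M s ε e).mkQ x) =
      (drinfeldKer l θ₁ θ₂ M s ε e).mkQ (act M (Φ y) x) := rfl

theorem IsCompatible.isEvenRep (H : IsCompatible s ε e b Φ) :
    IsEvenRep (fun p => Submodule.span ℂ {x | ∃ w : List (YGen N), wordPar s w = p ∧
      x = (w.map fun y => b y.1 y.2.1 (y.2.2 + 1)).prod})
      (drinfeldGrade l θ₁ θ₂ M s ε e) (H.rep M) := by
  refine isEvenRep_of_generators fun y q x hx => ?_
  rw [mem_drinfeldGrade_iff] at hx ⊢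
  have h : quotientParity l θ₁ θ₂ M s ε e * H.rep M (b y.1 y.2.1 (y.2.2 + 1)) =
      sgn (par s y.1 + par s y.2.1) •
        (H.rep M (b y.1 y.2.1 (y.2.2 + 1)) * quotientParity l θ₁ θ₂ M s ε e) := by
    refine Submodule.linearMap_qext _ (LinearMap.ext fun z => ?_)
    have := congrArg (fun T => (drinfeldKer l θ₁ θ₂ M s ε e).mkQ (act M T z))
      (H.parity y.1 y.2.1 (y.2.2 + 1))
    beta_reduce at this
    rwa [map_mul, map_smul, map_mul, LinearMap.smul_apply, map_smul] at this
  have hz := LinearMap.congr_fun h x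
  rw [LinearMap.smul_apply, Module.End.mul_apply, Module.End.mul_apply, hx, map_smul, smul_smul,
    ← sgn_add] at hz
  exact hz

/-- Uniqueness holds because the operators of the generators are prescribed on all classes `mkQ x`,
and the generators generate the algebra. -/
theorem IsCompatible.existsUnique_rep (H : IsCompatible s ε e b Φ)
    {𝒜 : ZMod 2 → Submodule ℂ B}
    (h𝒜 : 𝒜 = fun p => Submodule.span ℂ {x | ∃ w : List (YGen N), wordPar s w = p ∧
      x = (w.map fun y => b y.1 y.2.1 (y.2.2 + 1)).prod}) :
    ∃! ρ : B →ₐ[ℂ] Module.End ℂ (DrinfeldObj l θ₁ θ₂ M s ε e),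
      IsEvenRep 𝒜 (drinfeldGrade l θ₁ θ₂ M s ε e) ρ ∧
      ∀ (i j : Fin N) (r : ℕ) (x : M ⊗[ℂ] TensorV N l),
        ρ (b i j r) ((drinfeldKer l θ₁ θ₂ M s ε e).mkQ x) =
          (drinfeldKer l θ₁ θ₂ M s ε e).mkQ (act M (Φ (b i j r)) x) := by
  subst h𝒜
  refine ⟨H.rep M, ⟨H.isEvenRep M, fun i j r x => H.rep_mkQ M _ x⟩, fun ρ hρ => ?_⟩
  refine AlgHom.ext_of_adjoin_eq_top H.adjoin ?_
  rintro _ ⟨y, rfl⟩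
  exact Submodule.linearMap_qext _ (LinearMap.ext fun x => hρ.2 _ _ _ x)

variable {M M'}

theorem IsCompatible.drinfeldMap_rep (H : IsCompatible s ε e b Φ) (f : M →ₗ[Hecke l θ₁ θ₂] M')
    (y : B) (x : DrinfeldObj l θ₁ θ₂ M s ε e) :
    drinfeldMap s ε e f (H.rep M y x) = H.rep M' y (drinfeldMap s ε e f x) := by
  obtain ⟨x, rfl⟩ := Submodule.mkQ_surjective _ x
  exact congrArg (drinfeldKer l θ₁ θ₂ M' s ε e).mkQ (rTensor_act f (Φ y) x)

theorem drinfeldMap_mem_grade (f : M →ₗ[Hecke l θ₁ θ₂] M') {p : ZMod 2}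
    {x : DrinfeldObj l θ₁ θ₂ M s ε e} (hx : x ∈ drinfeldGrade l θ₁ θ₂ M s ε e p) :
    drinfeldMap s ε e f x ∈ drinfeldGrade l θ₁ θ₂ M' s ε e p := by
  induction hx using Submodule.span_induction with
  | mem x hx =>
    obtain ⟨m, a, h, rfl⟩ := hx
    exact Submodule.subset_span ⟨f m, a, h, rfl⟩
  | zero => rw [map_zero]; exact Submodule.zero_mem _
  | add x y _ _ hx hy => rw [map_add]; exact Submodule.add_mem _ hx hy
  | smul c x _ hx => rw [map_smul]; exact Submodule.smul_mem _ c hx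

theorem drinfeldMap_id (x : DrinfeldObj l θ₁ θ₂ M s ε e) :
    drinfeldMap s ε e (LinearMap.id : M →ₗ[Hecke l θ₁ θ₂] M) x = x := by
  obtain ⟨x, rfl⟩ := Submodule.mkQ_surjective _ x
  exact congrArg (drinfeldKer l θ₁ θ₂ M s ε e).mkQ (LinearMap.rTensor_id_apply _ _ x)

theorem drinfeldMap_comp {M'' : Type v} [AddCommGroup M''] [Module ℂ M'']
    [Module (Hecke l θ₁ θ₂) M''] [IsScalarTower ℂ (Hecke l θ₁ θ₂) M'']
    (g : M' →ₗ[Hecke l θ₁ θ₂] M'') (f : M →ₗ[Hecke l θ₁ θ₂] M')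
    (x : DrinfeldObj l θ₁ θ₂ M s ε e) :
    drinfeldMap s ε e (g ∘ₗ f) x = drinfeldMap s ε e g (drinfeldMap s ε e f x) := by
  obtain ⟨x, rfl⟩ := Submodule.mkQ_surjective _ x
  exact congrArg (drinfeldKer l θ₁ θ₂ M'' s ε e).mkQ
    (LinearMap.rTensor_comp_apply _ (g.restrictScalars ℂ) (f.restrictScalars ℂ) x)

/-- The functor with values the modules `𝒟^e_{s,ε}(M)`. -/
def IsCompatible.functor {Φ : TwistedYangian s ε →ₐ[ℂ] OpAlg N l θ₁ θ₂}
    (H : IsCompatible s ε e (TwistedYangian.b s ε) Φ) :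
    CategoryTheory.Functor (ModuleCat.{v} (Hecke l θ₁ θ₂))
      (SuperRep.{0, v} (TwistedYangian s ε) (TwistedYangian.grade s ε)) where
  obj M := ⟨DrinfeldObj l θ₁ θ₂ M s ε e, drinfeldGrade l θ₁ θ₂ M s ε e, isInternal_drinfeldGrade,
    H.rep M, H.isEvenRep M⟩
  map f := ⟨drinfeldMap s ε e f.hom, H.drinfeldMap_rep f.hom,
    fun _ _ hx => drinfeldMap_mem_grade f.hom hx⟩
  map_id M := SuperRep.Hom.ext (LinearMap.ext fun x => drinfeldMap_id (M := M) x)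
  map_comp f g := SuperRep.Hom.ext (LinearMap.ext fun x => drinfeldMap_comp g.hom f.hom x)

/-- The homomorphism `B(u) ↦ ℬ^χ(u)`. -/
def extOpHom (l : ℕ) (θ₁ θ₂ : ℂ) (s ε : Fin N → ℤˣ) (γ χ : ℂ) :
    ExtTwistedYangian s ε →ₐ[ℂ] OpAlg N l θ₁ θ₂ :=
  extHom (bMat l θ₁ θ₂ s ε γ χ) (bMat_eq s ε γ χ ▸ constantCoeff_vertexMat ε γ)
    (bMat_eq s ε γ χ ▸ (isVertexData_site s χ).reflectionEq ε γ)

/-- The homomorphism `B(u) ↦ (1 - γ u⁻¹)⁻¹ ℬ^χ(u)`. -/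
def twOpHom (l : ℕ) (θ₁ θ₂ : ℂ) (s ε : Fin N → ℤˣ) (γ χ : ℂ) :
    TwistedYangian s ε →ₐ[ℂ] OpAlg N l θ₁ θ₂ :=
  twHom (bMatNorm l θ₁ θ₂ s ε γ χ) (bMatNorm_eq s ε γ χ ▸ constantCoeff_normMat ε γ)
    (bMatNorm_eq s ε γ χ ▸ (isVertexData_site s χ).reflectionEq_normMat ε γ)
    (bMatNorm_eq s ε γ χ ▸ (isVertexData_site s χ).normMat_mul_negUHom ε γ)

theorem extOpHom_b (γ χ : ℂ) (i j : Fin N) (r : ℕ) :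
    extOpHom l θ₁ θ₂ s ε γ χ (ExtTwistedYangian.b s ε i j r) =
      PowerSeries.coeff r (bMat l θ₁ θ₂ s ε γ χ i j) := extHom_b _ _ i j r

theorem twOpHom_b (γ χ : ℂ) (i j : Fin N) (r : ℕ) :
    twOpHom l θ₁ θ₂ s ε γ χ (TwistedYangian.b s ε i j r) =
      PowerSeries.coeff r (bMatNorm l θ₁ θ₂ s ε γ χ i j) := twHom_b _ _ _ i j r

theorem isCompatible_extOpHom {γ χ : ℂ} (hθ : θ₂ = θ₁ * (2 * γ + varpiOne s ε))
    (hχ : θ₁ * χ = signC e) :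
    IsCompatible s ε e (ExtTwistedYangian.b s ε) (extOpHom l θ₁ θ₂ s ε γ χ) where
  adjoin := adjoin_range_mkAlgHom_ι (ExtRel s ε)
  transports i j r := by
    rw [extOpHom_b, bMat_eq]
    exact ⟨fun a c h => exists_coeff_mul_eq ((isFlip_site hχ h).vertexMat_mem_transporter
        (isVertexData_site s χ) h ε γ) i j r,
      fun k h => exists_coeff_mul_eq ((isSignChange_site hθ hχ h).vertexMat_mem_transporter
        (isVertexData_site s χ) h) i j r⟩
  parity i j r := by
    rw [extOpHom_b, bMat_eq]
    exact commute_parityMat_iff.1 (commute_parityMat_vertexMat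
      (fun k => (commute_heckeHom_endHom _ _).symm)
      (fun k i j => by rw [siteE, ← map_mul, totalParity_mul_matUnitAt, map_smul, map_mul]) γ) i j r

theorem isCompatible_twOpHom {γ χ : ℂ} (hθ : θ₂ = θ₁ * (2 * γ + varpiOne s ε))
    (hχ : θ₁ * χ = signC e) :
    IsCompatible s ε e (TwistedYangian.b s ε) (twOpHom l θ₁ θ₂ s ε γ χ) where
  adjoin := adjoin_range_mkAlgHom_ι (TwRel s ε)
  transports i j r := by
    rw [twOpHom_b, bMatNorm_eq]
    exact ⟨fun a c h => exists_coeff_mul_eq (normMat_mem_transporter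
        ((isFlip_site hχ h).vertexMat_mem_transporter (isVertexData_site s χ) h ε γ)) i j r,
      fun k h => exists_coeff_mul_eq (normMat_mem_transporter
        ((isSignChange_site hθ hχ h).vertexMat_mem_transporter (isVertexData_site s χ) h)) i j r⟩
  parity i j r := by
    rw [twOpHom_b, bMatNorm_eq]
    exact commute_parityMat_iff.1 (commute_parityMat_normMat
      (fun k => (commute_heckeHom_endHom _ _).symm)
      (fun k i j => by rw [siteE, ← map_mul, totalParity_mul_matUnitAt, map_smul, map_mul]) γ) i j r

end Action

end DrinfeldBC

end

theorem mainTheorem12 (N l : ℕ) (hl : 0 < l) (s ε : Fin N → ℤˣ) (e : ℤˣ)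
    (θ₁ θ₂ γ χ : ℂ)
    (hθ : θ₂ = θ₁ * (2 * γ + varpiOne s ε))
    (hχ : θ₁ * χ = signC e) :
    (∀ (M : Type v) [AddCommGroup M] [Module ℂ M] [Module (Hecke l θ₁ θ₂) M]
        [IsScalarTower ℂ (Hecke l θ₁ θ₂) M],
      -- the quotient is a superspace
      DirectSum.IsInternal (drinfeldGrade l θ₁ θ₂ M s ε e) ∧
      -- the extended twisted super Yangian acts on it by the entries of `ℬ^χ(u)`
      (∃! ρ : ExtTwistedYangian s ε →ₐ[ℂ]
            Module.End ℂ (DrinfeldObj l θ₁ θ₂ M s ε e),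
        IsEvenRep (ExtTwistedYangian.grade s ε)
          (drinfeldGrade l θ₁ θ₂ M s ε e) ρ ∧
        ∀ (i j : Fin N) (r : ℕ) (x : M ⊗[ℂ] TensorV N l),
          ρ (ExtTwistedYangian.b s ε i j r)
              ((drinfeldKer l θ₁ θ₂ M s ε e).mkQ x) =
            (drinfeldKer l θ₁ θ₂ M s ε e).mkQ (act M
              (PowerSeries.coeff r (bMat l θ₁ θ₂ s ε γ χ i j)) x)) ∧
      -- the twisted super Yangian acts on it by the entries of the normalized matrix
      (∃! ρ : TwistedYangian s ε →ₐ[ℂ]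
            Module.End ℂ (DrinfeldObj l θ₁ θ₂ M s ε e),
        IsEvenRep (TwistedYangian.grade s ε)
          (drinfeldGrade l θ₁ θ₂ M s ε e) ρ ∧
        ∀ (i j : Fin N) (r : ℕ) (x : M ⊗[ℂ] TensorV N l),
          ρ (TwistedYangian.b s ε i j r)
              ((drinfeldKer l θ₁ θ₂ M s ε e).mkQ x) =
            (drinfeldKer l θ₁ θ₂ M s ε e).mkQ (act M
              (PowerSeries.coeff r (bMatNorm l θ₁ θ₂ s ε γ χ i j)) x))) ∧
    -- these modules are the values of a functor, which sends `f` to the map induced by `f ⊗ 1`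
    ∃ (F : CategoryTheory.Functor (ModuleCat.{v} (Hecke l θ₁ θ₂))
          (SuperRep.{0, v} (TwistedYangian s ε)
            (TwistedYangian.grade s ε)))
      (η : ∀ M : ModuleCat.{v} (Hecke l θ₁ θ₂),
        (F.obj M).carrier ≃ₗ[ℂ] DrinfeldObj l θ₁ θ₂ M s ε e),
      (∀ M p, ((F.obj M).grade p).map (η M).toLinearMap = drinfeldGrade l θ₁ θ₂ M s ε e p) ∧
      (∀ (M : ModuleCat.{v} (Hecke l θ₁ θ₂)) (i j : Fin N) (r : ℕ)
          (x : M ⊗[ℂ] TensorV N l),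
        η M ((F.obj M).ρ (TwistedYangian.b s ε i j r)
            ((η M).symm ((drinfeldKer l θ₁ θ₂ M s ε e).mkQ x))) =
          (drinfeldKer l θ₁ θ₂ M s ε e).mkQ (act M
            (PowerSeries.coeff r (bMatNorm l θ₁ θ₂ s ε γ χ i j)) x)) ∧
      (∀ (M M' : ModuleCat.{v} (Hecke l θ₁ θ₂)) (f : M ⟶ M')
          (x : (F.obj M).carrier),
        η M' (SuperRep.linOf (F.map f) x) =
          drinfeldMap s ε e f.hom (η M x)) := by
  have H := isCompatible_extOpHom (l := l) hθ hχ
  have H' := isCompatible_twOpHom (l := l) hθ hχ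
  -- The functor is built on the quotients themselves, so the comparison isomorphisms `η` are
  -- identities.
  refine ⟨fun M _ _ _ _ => ⟨isInternal_drinfeldGrade, ?_, ?_⟩, H'.functor,
    fun M => LinearEquiv.refl ℂ _, fun M p => Submodule.map_id _, fun M i j r x => ?_,
    fun M M' f x => rfl⟩
  · have h := H.existsUnique_rep M (𝒜 := ExtTwistedYangian.grade s ε) rfl
    simpa only [extOpHom_b] using h
  · have h := H'.existsUnique_rep M (𝒜 := TwistedYangian.grade s ε) rfl
    simpa only [twOpHom_b] using h
  · rw [← twOpHom_b]
    exact H'.rep_mkQ M _ x
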